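/- **Setting.** Let $d\in\{2,3\}$ and let $\Omega\subset\mathbb R^d$ be a bounded open set with $\Omega=\operatorname{int}\overline\Omega$ (for instance a bounded Lipschitz domain), with boundary $\Gamma$. Let $\mathcal T_h$ be a finite partition of $\Omega$ into pairwise disjoint open polygons/polyhedra $T$ of arbitrary shape (with $\overline\Omega=\bigcup_T\overline T$), with diameters $h_T$. Let $\mathcal E_h$ be its set of (relatively open, pairwise disjoint) flat edges/faces: each $\partial T$ is the union of the closures of the $e\in\mathcal E_h$ lying on it, each such $e$ has a constant unit normal $\mathbf n$ pointing out of $T$, and each $e\in\mathcal E_h$ is contained in $\Omega$ or in $\Gamma$. For $d=3$ the curl and the cross product are the usual ones. For $d=2$, $\nabla\times\mathbf v=\partial_1v_2-\partial_2v_1$ and $\mathbf a\times\mathbf b=a_1b_2-a_2b_1$ are scalars, and $\nabla\times\varphi=(\partial_2\varphi,-\partial_1\varphi)$ for a scalar $\varphi$. Put $d'=3$ if $d=3$ and $d'=1$ if $d=2$. Let $\omega\in\mathbb R$, and let $\varepsilon$, $\mu$, $\sigma$ be constant on each $T$: $\varepsilon|_T\in\mathbb R^{d\times d}$ and $\mu|_T\in\mathbb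 R^{d'\times d'}$ symmetric positive definite, $\sigma|_T\in\mathbb R$. All functions are complex valued, $\mathbf j_e\in[L^2(\Omega)]^d$, $\rho\in L^2(\Omega)$, and $(f,g)_D=\int_D f\cdot g$, $\langle f,g\rangle_{\partial T}=\int_{\partial T}f\cdot g$ are the bilinear pairings (no conjugation). **Continuous problem.** $(\mathbf u,p)\in\big(H_0(\mathrm{curl};\Omega)\cap H(\mathrm{div}_\varepsilon;\Omega)\big)\times L^2(\Omega)$ satisfies $$(\mu^{-1}\nabla\times\mathbf u,\nabla\times\mathbf v)+((i\omega\sigma-\omega^2\varepsilon)\mathbf u,\mathbf v)-(\nabla\cdot(\varepsilon\mathbf v),p)=-(i\omega\mathbf j_e,\mathbf v),\qquad(\nabla\cdot(\varepsilon\mathbf u),q)=(\rho,q)$$ for all $\mathbf v\in H_0(\mathrm{curl};\Omega)\cap H(\mathrm{div}_\varepsilon;\Omega)$ and $q\in L^2(\Omega)$, where $H(\mathrm{div}_\varepsilon;\Omega)=\{\mathbf v\in[L^2(\Omega)]^d:\nabla\cdot(\varepsilon\mathbf v)\in L^2(\Omega)\}$. Moreover $(\mathbf u,p)$ is smooth enough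 on each $T\in\mathcal T_h$: the components of $\mathbf u$ and of $\nabla\times\mathbf u$, and $p$, belong to $H^1(T)$ with trace in $L^2(\partial T)$, in the sense that they are limits in $H^1(T)$ of functions smooth on $\mathbb R^d$ whose boundary values converge in $L^2(\partial T)$, the limit being the trace. **Discrete problem.** Let $k\ge1$. $\mathbf V_h$ consists of the $\mathbf v=\{\mathbf v_0,\mathbf v_b\}$ with $\mathbf v_0|_T\in[P_k(T)]^d$ for $T\in\mathcal T_h$ and one value $\mathbf v_b|_e\in[P_k(e)]^d$ for each $e\in\mathcal E_h$; $\mathbf V_{h,0}^1=\{\mathbf v\in\mathbf V_h:\mathbf v_b\times\mathbf n=0\text{ on }\Gamma\}$; $W_h^1=\{q:q|_T\in P_{k-1}(T),\,T\in\mathcal T_h\}$. On each $T$, $\nabla_w\cdot(\varepsilon\mathbf v)\in P_{k-1}(T)$ and $\nabla_w\times\mathbf v\in[P_{k-1}(T)]^{d'}$ are defined by $$(\nabla_w\cdot(\varepsilon\mathbf v),\varphi)_T=-(\varepsilon\mathbf v_0,\nabla\varphi)_T+\langle\mathbf v_b\cdot\mathbf n,\varphi\rangle_{\partial T},\qquad(\nabla_w\times\mathbf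 v,\psi)_T=(\mathbf v_0,\nabla\times\psi)_T-\langle\mathbf v_b\times\mathbf n,\psi\rangle_{\partial T}$$ for all $\varphi\in P_{k-1}(T)$ and $\psi\in[P_{k-1}(T)]^{d'}$. Put $$s_1(\mathbf v,\mathbf w)=\sum_Th_T^{-1}\langle(\varepsilon\mathbf v_0-\mathbf v_b)\cdot\mathbf n,(\varepsilon\mathbf w_0-\mathbf w_b)\cdot\mathbf n\rangle_{\partial T}+h_T^{-1}\langle(\mathbf v_0-\mathbf v_b)\times\mathbf n,(\mathbf w_0-\mathbf w_b)\times\mathbf n\rangle_{\partial T},$$ $$a_1(\mathbf v,\mathbf w)=\sum_T\big[(\mu^{-1}\nabla_w\times\mathbf v,\nabla_w\times\mathbf w)_T+((i\omega\sigma-\omega^2\varepsilon)\mathbf v_0,\mathbf w_0)_T\big]+s_1(\mathbf v,\mathbf w),\qquad b_1(\mathbf v,q)=\sum_T(\nabla_w\cdot(\varepsilon\mathbf v),q)_T.$$ Let $(\mathbf u_h,p_h)\in\mathbf V_{h,0}^1\times W_h^1$ solve the weak Galerkin scheme $$a_1(\mathbf u_h,\mathbf v)-b_1(\mathbf v,p_h)=-(i\omega\mathbf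 j_e,\mathbf v_0)\quad\forall\mathbf v\in\mathbf V_{h,0}^1,\qquad b_1(\mathbf u_h,w)=(\rho,w)\quad\forall w\in W_h^1.$$ **Projections.** Let $Q_0$, $Q_b$, $\mathcal Q_h$, $\mathbf Q_h$ be the $L^2$ projections onto polynomials of degree $\le k$ on each $T$, of degree $\le k$ on each $e$, and, for scalars and vectors respectively, of degree $\le k-1$ on each $T$. Put $Q_h\mathbf u=\{Q_0\mathbf u,\ Q_b(\varepsilon\mathbf u\cdot\mathbf n)\,\mathbf n+Q_b(\mathbf n\times(\mathbf u\times\mathbf n))\}$, where $\mathbf n\times(\mathbf u\times\mathbf n)=\mathbf u-(\mathbf u\cdot\mathbf n)\mathbf n$ and the boundary values on $e$ are taken from either element adjacent to $e$. Define $$\mathbf e_h=Q_h\mathbf u-\mathbf u_h,\qquad\epsilon_h=\mathcal Q_hp-p_h,$$ $$l_{\mathbf u}(\mathbf v)=\sum_T\langle(\mathbf Q_h-I)(\mu^{-1}\nabla\times\mathbf u),(\mathbf v_0-\mathbf v_b)\times\mathbf n\rangle_{\partial T},\qquad\theta_p(\mathbf v)=\sum_T\langle p-\mathcal Q_hp,(\varepsilon\mathbf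 v_0-\mathbf v_b)\cdot\mathbf n\rangle_{\partial T}.$$ **Theorem.** Then $\mathbf e_h\in\mathbf V_{h,0}^1$, $\epsilon_h\in W_h^1$, and $$a_1(\mathbf e_h,\mathbf v)-b_1(\mathbf v,\epsilon_h)=l_{\mathbf u}(\mathbf v)-\theta_p(\mathbf v)+s_1(Q_h\mathbf u,\mathbf v)\qquad\forall\,\mathbf v\in\mathbf V_{h,0}^1,$$ $$b_1(\mathbf e_h,q)=0\qquad\forall\,q\in W_h^1.$$ -/

import Mathlib

open MeasureTheory Filter Topology
open scoped Matrix MeasureTheory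

namespace WG

noncomputable section

/-! ### Vector calculus in dimensions two and three -/

/-- The Euclidean space `ℝ^d`. -/
abbrev E (d : ℕ) : Type := EuclideanSpace ℝ (Fin d)

/-- Number of components of a curl: in the plane the curl of a vector field is a scalar (one
component), in space it is a vector with three components. -/
abbrev curlDim (d : ℕ) : ℕ := if d = 2 then 1 else d

/-- The alternating coefficients `ε_{mij}` of the cross product; for `d = 2` there is the single
value `m = 0` and `ε_{12} = 1 = -ε_{21}`, for `d = 3` this is the Levi-Civita symbol. -/
def crossCoeff (d : ℕ) (m : Fin (curlDim d)) (i j : Fin d) : ℂ :=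
  if d = 2 then ((j : ℕ) : ℂ) - ((i : ℕ) : ℂ)
  else if (i : ℕ) = ((m : ℕ) + 1) % 3 ∧ (j : ℕ) = ((m : ℕ) + 2) % 3 then 1
  else if (i : ℕ) = ((m : ℕ) + 2) % 3 ∧ (j : ℕ) = ((m : ℕ) + 1) % 3 then -1
  else 0

/-- The cross product `a × b`; for `d = 2` this is the scalar `a₁ b₂ - a₂ b₁`. -/
def cross {d : ℕ} (a b : Fin d → ℂ) : Fin (curlDim d) → ℂ :=
  fun m => ∑ i, ∑ j, crossCoeff d m i j * a i * b j

/-- The partial derivative `∂ᵢ f`. -/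
def pd {d : ℕ} (i : Fin d) (f : E d → ℂ) (x : E d) : ℂ :=
  fderiv ℝ f x (EuclideanSpace.single i 1)

/-- The curl `∇ × φ` of a (test) field `φ` with `curlDim d` components: for `d = 3` the usual curl,
for `d = 2` the vector curl `(∂₂ φ, -∂₁ φ)` of a scalar. -/
def testCurl {d : ℕ} (φ : E d → Fin (curlDim d) → ℂ) (x : E d) : Fin d → ℂ :=
  fun j => ∑ m, ∑ i, crossCoeff d m j i * pd i (fun y => φ y m) x

/-- A real vector seen as a complex one. -/
def cvec {d : ℕ} (n : E d) : Fin d → ℂ := fun i => (n i : ℂ)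

/-- A real matrix acting on a complex vector. -/
def rmul {n : ℕ} (A : Matrix (Fin n) (Fin n) ℝ) (v : Fin n → ℂ) : Fin n → ℂ :=
  (A.map (fun t : ℝ => (t : ℂ))) *ᵥ v

/-- The tangential component `n × (a × n) = a - (a · n) n` for a unit vector `n`. -/
def tang {d : ℕ} (n : E d) (a : Fin d → ℂ) : Fin d → ℂ := a - (a ⬝ᵥ cvec n) • cvec n

/-! ### The spaces `H(div; Ω)`, `H(curl; Ω)` and `H₀(curl; Ω)` -/

/-- `φ` is smooth with compact support contained in `U`. -/
def IsTest {d : ℕ} (U : Set (E d)) (φ : E d → ℂ) : Prop :=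
  ContDiff ℝ (⊤ : ℕ∞) φ ∧ HasCompactSupport φ ∧ tsupport φ ⊆ U

/-- `g ∈ L²(Ω)` is the weak divergence in `Ω` of `w ∈ L²(Ω)^d`. -/
def HasWeakDiv {d : ℕ} (Ω : Set (E d)) (w : E d → Fin d → ℂ) (g : E d → ℂ) : Prop :=
  MemLp w 2 (volume.restrict Ω) ∧ MemLp g 2 (volume.restrict Ω) ∧
  ∀ φ, IsTest Ω φ → ∫ x in Ω, g x * φ x = - ∫ x in Ω, ∑ i, w x i * pd i φ x

/-- `w ∈ H(div; Ω)`. -/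
def MemHdiv {d : ℕ} (Ω : Set (E d)) (w : E d → Fin d → ℂ) : Prop := ∃ g, HasWeakDiv Ω w g

open Classical in
/-- The weak divergence `∇ · w` in `Ω` (unique almost everywhere for `w ∈ H(div; Ω)`). -/
def weakDiv {d : ℕ} (Ω : Set (E d)) (w : E d → Fin d → ℂ) : E d → ℂ :=
  if h : MemHdiv Ω w then h.choose else 0

/-- `c ∈ L²(Ω)` is the weak curl in `Ω` of `v ∈ L²(Ω)^d`. -/
def HasWeakCurl {d : ℕ} (Ω : Set (E d)) (v : E d → Fin d → ℂ)
    (c : E d → Fin (curlDim d) → ℂ) : Prop :=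
  MemLp v 2 (volume.restrict Ω) ∧ MemLp c 2 (volume.restrict Ω) ∧
  ∀ φ : E d → Fin (curlDim d) → ℂ, (∀ m, IsTest Ω (fun x => φ x m)) →
    ∫ x in Ω, c x ⬝ᵥ φ x = ∫ x in Ω, v x ⬝ᵥ testCurl φ x

/-- `v ∈ H(curl; Ω)`. -/
def MemHcurl {d : ℕ} (Ω : Set (E d)) (v : E d → Fin d → ℂ) : Prop := ∃ c, HasWeakCurl Ω v c

open Classical in
/-- The weak curl `∇ × v` in `Ω` (unique almost everywhere for `v ∈ H(curl; Ω)`). -/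
def weakCurl {d : ℕ} (Ω : Set (E d)) (v : E d → Fin d → ℂ) : E d → Fin (curlDim d) → ℂ :=
  if h : MemHcurl Ω v then h.choose else 0

/-- `v ∈ H₀(curl; Ω)`: `v ∈ H(curl; Ω)` and the tangential trace `v × n` vanishes on `∂Ω`, that is,
`(∇ × v, φ) = (v, ∇ × φ)` for all `φ` that are smooth up to the boundary. -/
def MemHcurl0 {d : ℕ} (Ω : Set (E d)) (v : E d → Fin d → ℂ) : Prop :=
  MemHcurl Ω v ∧
  ∀ φ : E d → Fin (curlDim d) → ℂ, (∀ m, IsTest Set.univ (fun x => φ x m)) →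
    ∫ x in Ω, weakCurl Ω v x ⬝ᵥ φ x = ∫ x in Ω, v x ⬝ᵥ testCurl φ x

/-! ### Partitions into polygons or polyhedra -/

/-- A finite union of convex polytopes. -/
def IsPolytopal {d : ℕ} (S : Set (E d)) : Prop :=
  ∃ C : Finset (Finset (E d)), S = ⋃ c ∈ C, convexHull ℝ (c : Set (E d))

/-- A finite partition of `Ω` into open polygons/polyhedra `elem i` (not necessarily convex),
together with its edges/faces `face e`. -/
structure Mesh (d : ℕ) (Ω : Set (E d)) (ι κ : Type*) where
  /-- the elements -/
  elem : ι → Set (E d)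
  /-- the (relatively open) flat edges/faces -/
  face : κ → Set (E d)
  /-- `normal i e` is the unit normal on the face `e` that points out of the element `i`; it is
  meaningful if `e` lies on the boundary of `i` -/
  normal : ι → κ → E d
  elem_open : ∀ i, IsOpen (elem i)
  elem_nonempty : ∀ i, (elem i).Nonempty
  elem_disjoint : Pairwise (fun i j => Disjoint (elem i) (elem j))
  elem_cover : ⋃ i, closure (elem i) = closure Ω
  /-- each face is a `(d-1)`-dimensional flat polytope without its relative boundary -/
  face_dim : ∀ e, Module.finrank ℝ (affineSpan ℝ (face e)).direction + 1 = d
  face_polytopal : ∀ e, IsPolytopal (closure (face e))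
  face_relint : ∀ e, intrinsicInterior ℝ (closure (face e)) = face e
  face_disjoint : Pairwise (fun e f => Disjoint (face e) (face f))
  /-- the boundary of an element consists of the faces that lie on it -/
  frontier_elem : ∀ i, frontier (elem i) = ⋃ e ∈ {e | face e ⊆ frontier (elem i)}, closure (face e)
  /-- every face lies on the boundary of some element -/
  face_elem : ∀ e, ∃ i, face e ⊆ frontier (elem i)
  /-- every face is an interior face or a boundary face -/
  face_position : ∀ e, face e ⊆ Ω ∨ face e ⊆ frontier Ω
  normal_unit : ∀ i e, face e ⊆ frontier (elem i) → ‖normal i e‖ = 1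
  /-- along a face on its boundary the element lies locally on the inner side of the face -/
  normal_outward : ∀ i e, face e ⊆ frontier (elem i) → ∀ x ∈ face e, ∃ r > 0,
    ∀ y ∈ Metric.ball x r, y ∈ elem i ↔ inner ℝ (y - x) (normal i e) < 0

namespace Mesh

variable {d : ℕ} {Ω : Set (E d)} {ι κ : Type*} [Fintype ι] [Fintype κ]

open Classical in
/-- The edges/faces on the boundary of the element `i`. -/
def faces (M : Mesh d Ω ι κ) (i : ι) : Finset κ :=
  Finset.univ.filter fun e => M.face e ⊆ frontier (M.elem i)

/-- Lebesgue measure on the element `i`. -/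
def vol (M : Mesh d Ω ι κ) (i : ι) : Measure (E d) := volume.restrict (M.elem i)

/-- Length (`d = 2`) or area (`d = 3`) measure on the edge/face `e`. -/
def surf (M : Mesh d Ω ι κ) (e : κ) : Measure (E d) := (μHE[d - 1]).restrict (M.face e)

/-- The integral over the boundary of the element `i` of a function `g e x` of the edge/face `e` and
the point `x ∈ e`. -/
def bdInt (M : Mesh d Ω ι κ) (i : ι) (g : κ → E d → ℂ) : ℂ :=
  ∑ e ∈ M.faces i, ∫ x, g e x ∂(M.surf e)

/-- The diameter `h_T` of an element. -/
def h (M : Mesh d Ω ι κ) (i : ι) : ℂ := (Metric.diam (M.elem i) : ℂ)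

/-- An element that has `e` on its boundary. -/
def owner (M : Mesh d Ω ι κ) (e : κ) : ι := (M.face_elem e).choose

/-- The function on `Ω` that has the constant value `c i` on the element `i`. -/
def pwConst (M : Mesh d Ω ι κ) {V : Type*} [AddCommMonoid V] (c : ι → V) (x : E d) : V :=
  ∑ i, (M.elem i).indicator (fun _ => c i) x

/-! ### Traces of functions in `H¹(T)` -/

/-- `f ∈ H¹(T)` with trace `g ∈ L²(∂T)`, for the element `T = elem i`: there are functions, smooth
up to the boundary, that converge to `f` in `H¹(T)` and whose boundary values converge to `g`
in `L²(∂T)`. -/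
def HasTrace (M : Mesh d Ω ι κ) (i : ι) (f g : E d → ℂ) : Prop :=
  MemLp f 2 (M.vol i) ∧ (∀ e ∈ M.faces i, MemLp g 2 (M.surf e)) ∧
  ∃ (G : Fin d → E d → ℂ) (φ : ℕ → E d → ℂ),
    (∀ j, MemLp (G j) 2 (M.vol i)) ∧ (∀ n, ContDiff ℝ (⊤ : ℕ∞) (φ n)) ∧
    Tendsto (fun n => eLpNorm (fun x => φ n x - f x) 2 (M.vol i)) atTop (𝓝 0) ∧
    (∀ j, Tendsto (fun n => eLpNorm (fun x => pd j (φ n) x - G j x) 2 (M.vol i)) atTop (𝓝 0)) ∧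
    ∀ e ∈ M.faces i,
      Tendsto (fun n => eLpNorm (fun x => φ n x - g x) 2 (M.surf e)) atTop (𝓝 0)

/-- `f ∈ H¹(T)` (with a trace in `L²(∂T)`) for the element `T = elem i`. -/
def MemH1 (M : Mesh d Ω ι κ) (i : ι) (f : E d → ℂ) : Prop := ∃ g, M.HasTrace i f g

open Classical in
/-- The trace on `∂T` of `f ∈ H¹(T)`, for the element `T = elem i`. -/
def trace (M : Mesh d Ω ι κ) (i : ι) (f : E d → ℂ) : E d → ℂ :=
  if h : M.MemH1 i f then h.choose else 0

/-- The trace of a vector field, component by component. -/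
def traceVec (M : Mesh d Ω ι κ) (i : ι) {N : ℕ} (f : E d → Fin N → ℂ) : E d → Fin N → ℂ :=
  fun x j => M.trace i (fun y => f y j) x

end Mesh

/-! ### Polynomials, projections -/

/-- The value at `x` of a polynomial in `d` variables. -/
def ev {d : ℕ} (P : MvPolynomial (Fin d) ℂ) (x : E d) : ℂ :=
  MvPolynomial.eval (fun i => (x i : ℂ)) P

/-- On `S` the components of `f` are polynomials of degree at most `r`. -/
def IsPolyOn {d : ℕ} {N : ℕ} (r : ℕ) (S : Set (E d)) (f : E d → Fin N → ℂ) : Prop :=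
  ∃ P : Fin N → MvPolynomial (Fin d) ℂ,
    (∀ j, (P j).totalDegree ≤ r) ∧ ∀ x ∈ S, ∀ j, f x j = ev (P j) x

open Classical in
/-- The vector `g` of `N` polynomials of degree at most `r` such that `∫ g · φ dm = ℓ φ` for all
vectors `φ` of `N` polynomials of degree at most `r`. -/
def polyRepr {d N : ℕ} (m : Measure (E d)) (r : ℕ)
    (ℓ : (Fin N → MvPolynomial (Fin d) ℂ) → ℂ) : E d → Fin N → ℂ :=
  if h : ∃ P : Fin N → MvPolynomial (Fin d) ℂ, (∀ j, (P j).totalDegree ≤ r) ∧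
      ∀ φ : Fin N → MvPolynomial (Fin d) ℂ, (∀ j, (φ j).totalDegree ≤ r) →
        ∫ x, ∑ j, ev (P j) x * ev (φ j) x ∂m = ℓ φ
  then fun x j => ev (h.choose j) x else 0

/-- The `L²(m)` projection of a vector field onto the polynomials of degree at most `r`. -/
def projVec {d N : ℕ} (m : Measure (E d)) (r : ℕ) (f : E d → Fin N → ℂ) : E d → Fin N → ℂ :=
  polyRepr m r fun φ => ∫ x, ∑ j, f x j * ev (φ j) x ∂m

/-- The `L²(m)` projection of a scalar function onto the polynomials of degree at most `r`. -/
def proj {d : ℕ} (m : Measure (E d)) (r : ℕ) (f : E d → ℂ) : E d → ℂ :=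
  fun x => projVec (N := 1) m r (fun y _ => f y) x 0

/-! ### Weak finite element functions -/

/-- A pair `v = {v₀, v_b}`: on each element `T` a vector field `v.1 T`, on each edge/face `e` a
vector field `v.2 e` (one value on `e`, shared by the elements that contain `e`). -/
abbrev WeakField (d : ℕ) (ι κ : Type*) : Type _ :=
  (ι → E d → Fin d → ℂ) × (κ → E d → Fin d → ℂ)

namespace Mesh

variable {d : ℕ} {Ω : Set (E d)} {ι κ : Type*} [Fintype ι] [Fintype κ]

/-- The weak Galerkin space `V_h`. The interior part on each element is stored as a polynomial on
`ℝ^d`, so that its values on `∂T` are the boundary values taken from inside `T`. -/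
def Vh (M : Mesh d Ω ι κ) (k : ℕ) : Set (WeakField d ι κ) :=
  {v | (∀ i, IsPolyOn k Set.univ (v.1 i)) ∧ ∀ e, IsPolyOn k (M.face e) (v.2 e)}

/-- The subspace `V_{h,0}^1` of `V_h` given by `v_b × n = 0` on `∂Ω`. -/
def Vh01 (M : Mesh d Ω ι κ) (k : ℕ) : Set (WeakField d ι κ) :=
  {v | v ∈ M.Vh k ∧ ∀ e, M.face e ⊆ frontier Ω → ∀ i, e ∈ M.faces i →
    ∀ x ∈ M.face e, cross (v.2 e x) (cvec (M.normal i e)) = 0}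

/-- The space `W_h^1` of piecewise polynomials of degree at most `k - 1`. -/
def Wh1 (_M : Mesh d Ω ι κ) (k : ℕ) : Set (ι → E d → ℂ) :=
  {q | ∀ i, IsPolyOn (N := 1) (k - 1) Set.univ (fun x _ => q i x)}

/-- The discrete weak divergence `∇_{w,r} · (A v)` on the element `i`. -/
def wdiv (M : Mesh d Ω ι κ) (r : ℕ) (A : ι → Matrix (Fin d) (Fin d) ℝ) (v : WeakField d ι κ)
    (i : ι) : E d → ℂ :=
  fun x => polyRepr (N := 1) (M.vol i) r (fun φ =>
    - (∫ y, ∑ j, rmul (A i) (v.1 i y) j * ev (MvPolynomial.pderiv j (φ 0)) y ∂(M.vol i))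
    + M.bdInt i (fun e y => (v.2 e y ⬝ᵥ cvec (M.normal i e)) * ev (φ 0) y)) x 0

/-- The discrete weak curl `∇_{w,r} × v` on the element `i`. -/
def wcurl (M : Mesh d Ω ι κ) (r : ℕ) (v : WeakField d ι κ) (i : ι) :
    E d → Fin (curlDim d) → ℂ :=
  polyRepr (M.vol i) r (fun φ =>
    (∫ y, v.1 i y ⬝ᵥ testCurl (fun z m => ev (φ m) z) y ∂(M.vol i))
    - M.bdInt i (fun e y =>
        cross (v.2 e y) (cvec (M.normal i e)) ⬝ᵥ fun m => ev (φ m) y))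

/-- The stabilizer `s₁(v, w)`. -/
def s1 (M : Mesh d Ω ι κ) (eps : ι → Matrix (Fin d) (Fin d) ℝ) (v w : WeakField d ι κ) : ℂ :=
  ∑ i,
    ((M.h i)⁻¹ * M.bdInt i (fun e x =>
        ((rmul (eps i) (v.1 i x) - v.2 e x) ⬝ᵥ cvec (M.normal i e)) *
        ((rmul (eps i) (w.1 i x) - w.2 e x) ⬝ᵥ cvec (M.normal i e)))
    + (M.h i)⁻¹ * M.bdInt i (fun e x =>
        cross (v.1 i x - v.2 e x) (cvec (M.normal i e)) ⬝ᵥ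
        cross (w.1 i x - w.2 e x) (cvec (M.normal i e))))

/-- The zeroth order term `(iωσ - ω² ε) a` on the element `i`. -/
def lowCoeff (ω : ℝ) (σ : ℝ) (eps : Matrix (Fin d) (Fin d) ℝ) (a : Fin d → ℂ) : Fin d → ℂ :=
  (Complex.I * ω * σ) • a - ((ω : ℂ) ^ 2) • rmul eps a

/-- The bilinear form `a₁(v, w)`. -/
def a1 (M : Mesh d Ω ι κ) (k : ℕ) (ω : ℝ) (mu : ι → Matrix (Fin (curlDim d)) (Fin (curlDim d)) ℝ)
    (eps : ι → Matrix (Fin d) (Fin d) ℝ) (σ : ι → ℝ) (v w : WeakField d ι κ) : ℂ :=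
  (∑ i,
    ((∫ x, rmul (mu i)⁻¹ (M.wcurl (k - 1) v i x) ⬝ᵥ M.wcurl (k - 1) w i x ∂(M.vol i))
    + ∫ x, lowCoeff ω (σ i) (eps i) (v.1 i x) ⬝ᵥ w.1 i x ∂(M.vol i)))
  + M.s1 eps v w

/-- The bilinear form `b₁(v, q)`. -/
def b1 (M : Mesh d Ω ι κ) (k : ℕ) (eps : ι → Matrix (Fin d) (Fin d) ℝ) (v : WeakField d ι κ)
    (q : ι → E d → ℂ) : ℂ :=
  ∑ i, ∫ x, M.wdiv (k - 1) eps v i x * q i x ∂(M.vol i)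

/-! ### The continuous and the discrete problem for the electric field -/

/-- `(u, p) ∈ (H₀(curl; Ω) ∩ H(div_ε; Ω)) × L²(Ω)` solves the variational problem for the electric
field with current density `je` and charge density `ρ`. -/
def SolvesElectric (M : Mesh d Ω ι κ) (ω : ℝ)
    (mu : ι → Matrix (Fin (curlDim d)) (Fin (curlDim d)) ℝ)
    (eps : ι → Matrix (Fin d) (Fin d) ℝ) (σ : ι → ℝ) (je : E d → Fin d → ℂ) (ρ : E d → ℂ)
    (u : E d → Fin d → ℂ) (p : E d → ℂ) : Prop :=
  MemHcurl0 Ω u ∧ MemHdiv Ω (fun x => rmul (M.pwConst eps x) (u x)) ∧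
  MemLp p 2 (volume.restrict Ω) ∧
  (∀ v : E d → Fin d → ℂ, MemHcurl0 Ω v → MemHdiv Ω (fun x => rmul (M.pwConst eps x) (v x)) →
    (∫ x in Ω, rmul (M.pwConst mu x)⁻¹ (weakCurl Ω u x) ⬝ᵥ weakCurl Ω v x)
    + (∫ x in Ω, lowCoeff ω (M.pwConst σ x) (M.pwConst eps x) (u x) ⬝ᵥ v x)
    - (∫ x in Ω, weakDiv Ω (fun y => rmul (M.pwConst eps y) (v y)) x * p x)
    = - ∫ x in Ω, ((Complex.I * ω) • je x) ⬝ᵥ v x) ∧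
  ∀ q : E d → ℂ, MemLp q 2 (volume.restrict Ω) →
    ∫ x in Ω, weakDiv Ω (fun y => rmul (M.pwConst eps y) (u y)) x * q x = ∫ x in Ω, ρ x * q x

/-- `(uh, ph) ∈ V_{h,0}^1 × W_h^1` solves the weak Galerkin scheme for the electric field. -/
def SolvesScheme (M : Mesh d Ω ι κ) (k : ℕ) (ω : ℝ)
    (mu : ι → Matrix (Fin (curlDim d)) (Fin (curlDim d)) ℝ)
    (eps : ι → Matrix (Fin d) (Fin d) ℝ) (σ : ι → ℝ) (je : E d → Fin d → ℂ) (ρ : E d → ℂ)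
    (uh : WeakField d ι κ) (ph : ι → E d → ℂ) : Prop :=
  uh ∈ M.Vh01 k ∧ ph ∈ M.Wh1 k ∧
  (∀ v ∈ M.Vh01 k, M.a1 k ω mu eps σ uh v - M.b1 k eps v ph
    = - ∑ i, ∫ x, ((Complex.I * ω) • je x) ⬝ᵥ v.1 i x ∂(M.vol i)) ∧
  ∀ w ∈ M.Wh1 k, M.b1 k eps uh w = ∑ i, ∫ x, ρ x * w i x ∂(M.vol i)

/-! ### Projections of the exact solution and the functionals of the error equation -/

/-- The projection `Q_h u = {Q₀ u, Q_b(ε u · n) n + Q_b(n × (u × n))}`. On an interior edge/face the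
boundary values of `u` are taken from one of the two adjacent elements. -/
def Qh (M : Mesh d Ω ι κ) (k : ℕ) (eps : ι → Matrix (Fin d) (Fin d) ℝ) (u : E d → Fin d → ℂ) :
    WeakField d ι κ :=
  (fun i => projVec (M.vol i) k u,
   fun e x =>
    proj (M.surf e) k (fun y => rmul (eps (M.owner e)) (M.traceVec (M.owner e) u y) ⬝ᵥ
        cvec (M.normal (M.owner e) e)) x • cvec (M.normal (M.owner e) e)
    + projVec (M.surf e) k
        (fun y => tang (M.normal (M.owner e) e) (M.traceVec (M.owner e) u y)) x)

/-- The `L²` projection of `p` onto the piecewise polynomials of degree at most `k - 1`. -/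
def calQh (M : Mesh d Ω ι κ) (k : ℕ) (p : E d → ℂ) : ι → E d → ℂ :=
  fun i => proj (M.vol i) (k - 1) p

/-- `l_u(v) = ∑_T ⟨(Q_h - I)(μ⁻¹ ∇ × u), (v₀ - v_b) × n⟩_{∂T}`. -/
def lFun (M : Mesh d Ω ι κ) (k : ℕ) (mu : ι → Matrix (Fin (curlDim d)) (Fin (curlDim d)) ℝ)
    (u : E d → Fin d → ℂ) (v : WeakField d ι κ) : ℂ :=
  ∑ i, M.bdInt i (fun e x =>
    (projVec (M.vol i) (k - 1) (fun y => rmul (mu i)⁻¹ (weakCurl Ω u y)) x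
      - rmul (mu i)⁻¹ (M.traceVec i (weakCurl Ω u) x)) ⬝ᵥ
    cross (v.1 i x - v.2 e x) (cvec (M.normal i e)))

/-- `θ_p(v) = ∑_T ⟨p - 𝒬_h p, (ε v₀ - v_b) · n⟩_{∂T}`. -/
def thetaFun (M : Mesh d Ω ι κ) (k : ℕ) (eps : ι → Matrix (Fin d) (Fin d) ℝ)
    (p : E d → ℂ) (v : WeakField d ι κ) : ℂ :=
  ∑ i, M.bdInt i (fun e x =>
    (M.trace i p x - M.calQh k p i x) *
    ((rmul (eps i) (v.1 i x) - v.2 e x) ⬝ᵥ cvec (M.normal i e)))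

end Mesh

end

end WG

/-! The error equation is the difference of two identities: the scheme, and the identity that the
projections of the exact solution satisfy up to the consistency terms (`a1_Qh_sub_b1_calQh`,
`b1_Qh`). The forms are linear, so all the work lies in consistency.

Write c = μ⁻¹ ∇ × u. The test polynomials in the definitions of the weak operators have low degree,
and so have their derivatives. Hence the L² projections hidden in Q_h u can be dropped, and the weak
curl and weak divergence of Q_h u act on polynomials as the true curl of u and the true divergence
of εu (`curlPair_Qh`, `divPair_Qh`). The face values are taken from one side only, so this requires
that u × n and εu · n agree from both sides (`tangential_jump`, `normal_jump`). Integrating by parts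
on each element then moves the curl from v₀ to c and the divergence from εv₀ to p, while exchanging
c and p with their projections on the faces produces l_u and θ_p (`integral_wcurl_Qh`,
`divPair_calQh`). Two groups of terms remain: the strong equation ∇ × c + (iωσ - ω²ε)u + ε∇p + iωj =
0 tested with v₀, and the face integrals of c and p against v_b.

Both groups vanish because of the variational problem. A piecewise smooth field is conforming as
soon as its tangential and ε-normal jumps vanish (`memHcurl0_pw`, `hasWeakDiv_pw`). Bumps inside one
element yield the strong equation (`residual_eq_zero`). Bumps near one face, with a constant vector
on each side, yield the interface conditions. Adding a multiple of n to a one-sided vector w leaves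
w × n unchanged and changes εw · n at the nonzero rate εn · n. So tangential and normal data can be
prescribed independently although ε jumps (`flux_jump_const`). The outcome is the continuity of the
combined flux of c and p across interior faces and p = 0 on Γ, which is what cancels the v_b terms
(`sum_bdInt_flux`).

The analytic base is the divergence theorem on an element of arbitrary polyhedral shape (`green`).
It holds locally at inner points and at points of open faces by the half-space formula. The relative
boundaries of the faces have codimension two, so they can be cut off by functions whose gradients
are small in L¹. Density extends the formula to H¹ functions with a trace. -/

namespace WG

/-! ### Divergence theorem in a half-space -/

section HalfSpace

variable {V : Type*} [NormedAddCommGroup V] [InnerProductSpace ℝ V] [FiniteDimensional ℝ V]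
  [MeasurableSpace V] [BorelSpace V]

/-- This is integration by parts against the constant function 1. -/
theorem integral_fderiv_eq_zero {φ : V → ℂ} (hφ : ContDiff ℝ 1 φ) (hc : HasCompactSupport φ)
    (v : V) : ∫ x, fderiv ℝ φ x v = 0 := by
  have hd : Continuous fun x => fderiv ℝ φ x v :=
    (hφ.continuous_fderiv one_ne_zero).clm_apply continuous_const
  have h := integral_bilinear_hasLineDerivAt_right_eq_neg_left_of_integrable (μ := (volume : Measure V))
    (f := fun _ : V => (1 : ℂ)) (f' := fun _ => 0) (g := φ) (g' := fun x => fderiv ℝ φ x v) (v := v)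
    (B := ContinuousLinearMap.mul ℝ ℂ) (by simp)
    (by simpa using hd.integrable_of_hasCompactSupport (hc.fderiv_apply ℝ v))
    (by simpa using hφ.continuous.integrable_of_hasCompactSupport hc)
    (fun x _ => by simpa using (hasFDerivAt_const (1 : ℂ) x).hasLineDerivAt v)
    (fun x _ => ((hφ.differentiable one_ne_zero) x).hasFDerivAt.hasLineDerivAt v)
  simpa using h

/-- The map (t, z) ↦ t n + z + x₀ from ℝ × n^⊥ preserves volume and turns the half-space into {t <
0}. For v = n, Fubini reduces the claim to the fundamental theorem of calculus on a half-line. For v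
orthogonal to n, the integral over each slice {t} × n^⊥ vanishes by `integral_fderiv_eq_zero`. Every
v is a combination of the two cases. -/
theorem halfSpace_formula {φ : V → ℂ} (hφ : ContDiff ℝ 1 φ) (hc : HasCompactSupport φ)
    (x₀ n : V) (hn : ‖n‖ = 1) (v : V) :
    ∫ y in {y | inner ℝ (y - x₀) n < 0}, fderiv ℝ φ y v =
      (inner ℝ v n : ℝ) * ∫ y in {y | inner ℝ (y - x₀) n = 0}, φ y ∂μHE[Module.finrank ℝ V - 1] := by
  set s : Submodule ℝ V := ℝ ∙ n with hs
  have hn0 : n ≠ 0 := by rintro rfl; simp at hn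
  have hnn : inner ℝ n n = 1 := by rw [real_inner_self_eq_norm_sq, hn]; norm_num
  have hperp : ∀ z : sᗮ, inner ℝ (z : V) n = 0 := fun z =>
    Submodule.mem_orthogonal_singleton_iff_inner_left.1 z.2
  set ψ : ℝ × sᗮ → V := fun q => (q.1 • n + q.2) + x₀ with hψ
  have hψc : Continuous ψ := by fun_prop
  set l := (LinearIsometryEquiv.toSpanUnitSingleton (𝕜 := ℝ) n hn).toHomeomorph.toMeasurableEquiv with hl
  set e : V ≃ᵐ s × sᗮ := s.measurableEquivProd x₀ with he
  set m : ℝ × sᗮ ≃ᵐ V := (l.prodCongr (MeasurableEquiv.refl _)).trans e.symm with hm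
  have hmψ : ⇑m = ψ := by
    ext1 q
    simp [hm, hψ, he, hl, MeasurableEquiv.prodCongr]
  have hmp : MeasurePreserving m ((volume : Measure ℝ).prod (volume : Measure sᗮ)) volume := by
    have h1 : MeasurePreserving e.symm volume volume := by
      have := (s.measurePreserving_measurableEquivProd x₀).symm
      rwa [InnerProductSpace.euclideanHausdorffMeasure_eq_volume] at this
    have h2 : MeasurePreserving l volume volume :=
      (LinearIsometryEquiv.toSpanUnitSingleton (𝕜 := ℝ) n hn).measurePreserving
    exact h1.comp (h2.prod (MeasurePreserving.id _))
  rw [hmψ] at hmp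
  have hemb : MeasurableEmbedding ψ := hmψ ▸ m.measurableEmbedding
  have hinner : ∀ q : ℝ × sᗮ, inner ℝ (ψ q - x₀) n = q.1 := fun q => by
    simp [hψ, inner_add_left, inner_smul_left, hn, hperp]
  have hpre : ψ ⁻¹' {y | inner ℝ (y - x₀) n < 0} = Set.Iio (0 : ℝ) ×ˢ Set.univ := by
    ext q; simp [hinner]
  have hdc : Continuous (fderiv ℝ φ) := hφ.continuous_fderiv one_ne_zero
  have key : ∀ w : V, ∫ y in {y | inner ℝ (y - x₀) n < 0}, fderiv ℝ φ y w =
      ∫ q, fderiv ℝ φ (ψ q) w ∂((volume.restrict (Set.Iio (0 : ℝ))).prod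
        (volume : Measure sᗮ)) := by
    intro w
    conv_rhs => rw [← Measure.restrict_univ (μ := (volume : Measure sᗮ)), Measure.prod_restrict]
    rw [← hpre, ← hmp.setIntegral_preimage_emb hemb]
  have hint : ∀ w : V, Integrable (fun q : ℝ × sᗮ => fderiv ℝ φ (ψ q) w)
      ((volume.restrict (Set.Iio (0 : ℝ))).prod (volume : Measure sᗮ)) := by
    intro w
    rw [← Measure.restrict_univ (μ := (volume : Measure sᗮ)), Measure.prod_restrict]
    refine Integrable.integrableOn ?_
    have := (hdc.clm_apply continuous_const).integrable_of_hasCompactSupport (μ := volume)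
      (hc.fderiv_apply ℝ w)
    exact (hmp.integrable_comp_emb hemb).2 this
  have hψ' : ∀ (t : ℝ), Isometry (fun z : sᗮ => ψ (t, z)) := fun t =>
    Isometry.of_dist_eq fun a b => by simp [hψ, dist_eq_norm]
  -- normal derivative
  have hnor : ∫ y in {y | inner ℝ (y - x₀) n < 0}, fderiv ℝ φ y n = ∫ z : sᗮ, φ (ψ (0, z)) := by
    rw [key, integral_prod_symm _ (hint n)]
    refine integral_congr_ae (Eventually.of_forall fun z => ?_)
    have hline : ∀ t : ℝ, HasDerivAt (fun t => ψ (t, z)) n t := fun t => by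
      simpa [hψ] using ((((hasDerivAt_id t).smul_const n).add_const (z : V)).add_const x₀)
    have hdiff : ContDiff ℝ 1 (fun t : ℝ => φ (ψ (t, z))) := by
      apply hφ.comp
      simp only [hψ]
      fun_prop
    have hcs : HasCompactSupport (fun t : ℝ => φ (ψ (t, z))) := by
      refine hc.comp_isClosedEmbedding (g := fun t : ℝ => ψ (t, z)) ?_
      refine Isometry.isClosedEmbedding (Isometry.of_dist_eq fun a b => ?_)
      simp [hψ, dist_eq_norm, ← sub_smul, norm_smul, hn]
    have hder : ∀ t : ℝ, deriv (fun t : ℝ => φ (ψ (t, z))) t = fderiv ℝ φ (ψ (t, z)) n := fun t =>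
      (((hφ.differentiable one_ne_zero) (ψ (t, z))).hasFDerivAt.comp_hasDerivAt t (hline t)).deriv
    have := hcs.integral_Iic_deriv_eq hdiff 0
    beta_reduce
    rw [← integral_Iic_eq_integral_Iio]
    simpa only [hder] using this
  have htan : ∀ w : sᗮ, ∫ y in {y | inner ℝ (y - x₀) n < 0}, fderiv ℝ φ y (w : V) = 0 := by
    intro w
    rw [key, integral_prod _ (hint w)]
    refine integral_eq_zero_of_ae (Eventually.of_forall fun t => ?_)
    simp only [Pi.zero_apply]
    have hsub : ∀ z : sᗮ, HasFDerivAt (fun z : sᗮ => ψ (t, z)) (sᗮ.subtypeL) z := fun z => by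
      simpa [hψ] using ((sᗮ.subtypeL.hasFDerivAt (x := z)).const_add (t • n)).add_const x₀
    have hder : ∀ z : sᗮ, fderiv ℝ (fun z : sᗮ => φ (ψ (t, z))) z w = fderiv ℝ φ (ψ (t, z)) w :=
      fun z => by
        have := (((hφ.differentiable one_ne_zero) (ψ (t, z))).hasFDerivAt.comp z (hsub z)).fderiv
        simp only [Function.comp_def] at this
        rw [this]
        simp
    simp only [← hder]
    refine integral_fderiv_eq_zero ?_ (hc.comp_isClosedEmbedding (hψ' t).isClosedEmbedding) w
    apply hφ.comp
    have h1 : ContDiff ℝ 1 (fun z : sᗮ => t • n + sᗮ.subtypeL z + x₀) := by fun_prop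
    exact h1
  -- The slice t = 0 is an isometric copy of n^⊥, on which the Euclidean Hausdorff measure of full
  -- dimension is the volume; so no normalising constant appears.
  have hsurf : ∫ y in {y | inner ℝ (y - x₀) n = 0}, φ y ∂μHE[Module.finrank ℝ V - 1]
      = ∫ z : sᗮ, φ (ψ (0, z)) := by
    have hrange : Set.range (fun z : sᗮ => ψ (0, z)) = {y | inner ℝ (y - x₀) n = 0} := by
      ext y
      constructor
      · rintro ⟨z, rfl⟩
        simpa using hinner (0, z)
      · intro hy
        refine ⟨⟨y - x₀, Submodule.mem_orthogonal_singleton_iff_inner_left.2 hy⟩, ?_⟩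
        simp [hψ]
    have hfr : Module.finrank ℝ sᗮ = Module.finrank ℝ V - 1 := by
      have h1 := s.finrank_add_finrank_orthogonal
      have h2 : Module.finrank ℝ s = 1 := finrank_span_singleton hn0
      omega
    rw [← hrange, ← (hψ' 0).map_euclideanHausdorffMeasure,
      (hψ' 0).isClosedEmbedding.measurableEmbedding.integral_map, ← hfr,
      InnerProductSpace.euclideanHausdorffMeasure_eq_volume]
  obtain ⟨w, hw⟩ : ∃ w : sᗮ, v = (inner ℝ v n : ℝ) • n + (w : V) := by
    refine ⟨⟨v - (inner ℝ v n : ℝ) • n, ?_⟩, by simp⟩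
    rw [hs, Submodule.mem_orthogonal_singleton_iff_inner_left]
    simp [inner_sub_left, inner_smul_left, hn]
  have hintV : ∀ w : V, Integrable (fun y => fderiv ℝ φ y w)
      (volume.restrict {y | inner ℝ (y - x₀) n < 0}) := fun w =>
    ((hdc.clm_apply continuous_const).integrable_of_hasCompactSupport (μ := volume)
      (hc.fderiv_apply ℝ w)).restrict
  rw [hsurf, ← hnor]
  conv_lhs => rw [hw]
  simp only [map_add, map_smul]
  rw [integral_add (by exact (hintV n).smul (inner ℝ v n : ℝ)) (hintV w), htan w, add_zero,
    integral_smul]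
  simp

end HalfSpace

/-! ### Null sets and relative boundaries of flat polytopes -/

section Null

/-- A nonempty affine subspace is an isometric copy of its direction, so its Hausdorff dimension is
the linear dimension, which is below m. -/
theorem euclideanHausdorff_affineSubspace_eq_zero {d m : ℕ} (Q : AffineSubspace ℝ (E d))
    (h : Module.finrank ℝ Q.direction < m) : μHE[m] (Q : Set (E d)) = 0 := by
  rcases (Q : Set (E d)).eq_empty_or_nonempty with hQ | ⟨p, hp⟩
  · simp [hQ]
  have hiso : Isometry (fun z : Q.direction => (z : E d) + p) :=
    Isometry.of_dist_eq fun a b => by simp [dist_eq_norm]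
  have himg : (Q : Set (E d)) = (fun z : Q.direction => (z : E d) + p) '' Set.univ := by
    ext y
    constructor
    · intro hy
      exact ⟨⟨y -ᵥ p, AffineSubspace.vsub_mem_direction hy hp⟩, trivial, by simp⟩
    · rintro ⟨z, -, rfl⟩
      exact AffineSubspace.vadd_mem_of_mem_direction z.2 hp
  have hdim : dimH (Q : Set (E d)) < ((m : NNReal) : ENNReal) := by
    rw [himg, hiso.dimH_image, Real.dimH_univ_eq_finrank]
    exact_mod_cast h
  have := hausdorffMeasure_of_dimH_lt hdim
  rw [Measure.euclideanHausdorffMeasure_def, Measure.smul_apply]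
  simp only [NNReal.coe_natCast] at this
  rw [this, smul_zero]

end Null

section RelativeBoundary

theorem mem_intrinsicInterior_iff_ball {d : ℕ} {s : Set (E d)} {x : E d} :
    x ∈ intrinsicInterior ℝ s ↔ x ∈ affineSpan ℝ s ∧
      ∃ r > 0, ∀ y ∈ affineSpan ℝ s, dist y x < r → y ∈ s := by
  rw [mem_intrinsicInterior]
  constructor
  · rintro ⟨y, hy, rfl⟩
    refine ⟨y.2, ?_⟩
    obtain ⟨r, hr, h⟩ := Metric.mem_nhds_iff.1 (mem_interior_iff_mem_nhds.1 hy)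
    exact ⟨r, hr, fun z hz hzy => @h ⟨z, hz⟩ hzy⟩
  · rintro ⟨hx, r, hr, h⟩
    refine ⟨⟨x, hx⟩, mem_interior_iff_mem_nhds.2 (Metric.mem_nhds_iff.2 ⟨r, hr, ?_⟩), rfl⟩
    exact fun z hz => h z z.2 hz

/-- The z i form an affine basis of A, and a point with positive barycentric coordinates is interior
to the simplex. The points are moved to the direction of A, where interior is meant in a full vector
space, and the result is carried back. -/
theorem exists_ball_subset_convexHull {d : ℕ} {ι : Type*} [Fintype ι] {z : ι → E d}
    (hz : AffineIndependent ℝ z) {A : AffineSubspace ℝ (E d)} (hA : ∀ i, z i ∈ A)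
    (hcard : Fintype.card ι = Module.finrank ℝ A.direction + 1) {w : ι → ℝ} (hw : ∀ i, 0 < w i)
    (hw1 : ∑ i, w i = 1) :
    ∃ r > 0, ∀ y ∈ A, dist y (∑ i, w i • z i) < r → y ∈ convexHull ℝ (Set.range z) := by
  classical
  obtain ⟨i₀⟩ : Nonempty ι := Fintype.card_pos_iff.1 (by omega)
  set p := z i₀
  let b : ι → A.direction := fun i => ⟨z i -ᵥ p, AffineSubspace.vsub_mem_direction (hA i) (hA i₀)⟩
  let f : A.direction →ᵃ[ℝ] E d := A.direction.subtype.toAffineMap + AffineMap.const ℝ _ p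
  have hf : ∀ y : A.direction, f y = (y : E d) + p := fun y => rfl
  have hfb : f ∘ b = z := by ext1 i; simp [hf, b]
  have hb : AffineIndependent ℝ b := by
    refine AffineIndependent.of_comp f ?_
    rwa [hfb]
  let B : AffineBasis ι ℝ A.direction :=
    ⟨b, hb, (hb.affineSpan_eq_top_iff_card_eq_finrank_add_one).2 hcard⟩
  have hBb : ⇑B = b := rfl
  let x : A.direction := ∑ i, w i • b i
  have hx : f x = ∑ i, w i • z i := by
    have hsum : ∑ i, w i • z i = ∑ i, w i • (z i - p) + p := by
      simp [smul_sub, ← Finset.sum_smul, hw1]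
    rw [hf, hsum]
    simp [x, b]
  have hxint : x ∈ interior (convexHull ℝ (Set.range B)) := by
    rw [B.interior_convexHull]
    intro i
    have : x = Finset.univ.affineCombination ℝ B w := by
      rw [Finset.affineCombination_eq_linear_combination _ _ _ hw1]; rfl
    rw [this, B.coord_apply_combination_of_mem (Finset.mem_univ i) hw1]
    exact hw i
  obtain ⟨r, hr, h⟩ := Metric.mem_nhds_iff.1 (mem_interior_iff_mem_nhds.1 hxint)
  refine ⟨r, hr, fun y hy hyx => ?_⟩
  let y' : A.direction := ⟨y -ᵥ p, AffineSubspace.vsub_mem_direction hy (hA i₀)⟩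
  have hy' : f y' = y := by simp [hf, y']
  have hmem : y' ∈ convexHull ℝ (Set.range B) := by
    apply h
    rw [← hx, ← hy', hf, hf, dist_add_right] at hyx
    exact hyx
  have := Set.mem_image_of_mem f hmem
  rw [AffineMap.image_convexHull, ← Set.range_comp, hBb, hfb, hy'] at this
  exact this

/-- By Carathéodory every point of S is a combination with positive weights of affinely independent
vertices from one of the generating sets. If the simplex has the full dimension d - 1, the point is
in the relative interior of S. Otherwise it has at most d - 1 vertices, and there are only finitely
many such vertex sets. -/
theorem IsPolytopal.sdiff_intrinsicInterior_subset {d : ℕ} {S : Set (E d)} (hS : IsPolytopal S)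
    (hdim : Module.finrank ℝ (affineSpan ℝ S).direction + 1 = d) :
    ∃ T : Finset (Finset (E d)), (∀ t ∈ T, t.card + 1 ≤ d) ∧
      S \ intrinsicInterior ℝ S ⊆ ⋃ t ∈ T, convexHull ℝ (t : Set (E d)) := by
  classical
  obtain ⟨C, hC⟩ := hS
  refine ⟨(C.biUnion Finset.powerset).filter (fun t => t.card + 1 ≤ d), fun t ht =>
    (Finset.mem_filter.1 ht).2, ?_⟩
  rintro x ⟨hxS, hx⟩
  obtain ⟨c, hcC, hxc⟩ : ∃ c ∈ C, x ∈ convexHull ℝ (c : Set (E d)) := by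
    rw [hC] at hxS; simpa using hxS
  have hcS : convexHull ℝ (c : Set (E d)) ⊆ S := by
    rw [hC]; exact Set.subset_biUnion_of_mem (u := fun c : Finset (E d) => convexHull ℝ (c : Set (E d))) hcC
  obtain ⟨ι, _, z, w, hzc, hz, hw, hw1, rfl⟩ := eq_pos_convex_span_of_mem_convexHull hxc
  have hzA : ∀ i, z i ∈ affineSpan ℝ S := fun i =>
    subset_affineSpan ℝ S (hcS (subset_convexHull ℝ _ (hzc ⟨i, rfl⟩)))
  by_cases hcard : Fintype.card ι = Module.finrank ℝ (affineSpan ℝ S).direction + 1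
  · exfalso
    apply hx
    obtain ⟨r, hr, h⟩ := exists_ball_subset_convexHull hz hzA hcard hw hw1
    refine mem_intrinsicInterior_iff_ball.2 ⟨subset_affineSpan ℝ S hxS, r, hr, fun y hy hyx => ?_⟩
    exact hcS (convexHull_mono hzc (h y hy hyx))
  · have hle : Fintype.card ι ≤ Module.finrank ℝ (affineSpan ℝ S).direction + 1 := by
      refine hz.card_le_finrank_succ.trans (Nat.add_le_add_right (Submodule.finrank_mono ?_) 1)
      rw [direction_affineSpan] at *
      refine vectorSpan_mono ℝ ?_
      rintro _ ⟨i, rfl⟩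
      exact hcS (subset_convexHull ℝ _ (hzc ⟨i, rfl⟩))
    simp only [Set.mem_iUnion]
    refine ⟨Finset.univ.image z, ?_, ?_⟩
    · simp only [Finset.mem_filter, Finset.mem_biUnion, Finset.mem_powerset]
      refine ⟨⟨c, hcC, ?_⟩, ?_⟩
      · intro y hy
        obtain ⟨i, -, rfl⟩ := Finset.mem_image.1 hy
        exact hzc ⟨i, rfl⟩
      · have := Finset.card_image_le (s := (Finset.univ : Finset ι)) (f := z)
        rw [Finset.card_univ] at this
        omega
    · have : (∑ i, w i • z i) ∈ convexHull ℝ (Set.range z) :=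
        (convex_convexHull ℝ _).sum_mem (fun i _ => (hw i).le) hw1
          (fun i _ => subset_convexHull ℝ _ ⟨i, rfl⟩)
      simpa using this

/-- The affine span of n ≥ 1 points has dimension at most n - 1, which is less than m. -/
theorem euclideanHausdorff_convexHull_eq_zero {d m : ℕ} {t : Finset (E d)} (ht : t.card ≤ m) :
    μHE[m] (convexHull ℝ (t : Set (E d))) = 0 := by
  rcases t.eq_empty_or_nonempty with rfl | hne
  · simp
  refine measure_mono_null (convexHull_subset_affineSpan _)
    (euclideanHausdorff_affineSubspace_eq_zero (affineSpan ℝ (t : Set (E d))) ?_)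
  have h := finrank_vectorSpan_range_le (n := t.card - 1) ℝ (fun i : t => (i : E d))
    (by simpa using (Nat.sub_add_cancel hne.card_pos).symm)
  rw [direction_affineSpan]
  have h2 : Set.range (fun i : t => (i : E d)) = (t : Set (E d)) := by simp
  rw [h2] at h
  have := hne.card_pos
  omega

end RelativeBoundary

/-! ### Coverings of codimension two and cutoff functions -/

section Cover

/-- `K` can be covered by `O(N^{d-2})` balls of radius `O(1/N)`. -/
def CodimTwoCover {d : ℕ} (K : Set (E d)) : Prop :=
  ∃ C : ℝ, 0 < C ∧ ∀ N : ℕ, 1 ≤ N → ∃ F : Finset (E d), (F.card : ℝ) ≤ C * (N : ℝ) ^ (d - 2) ∧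
    K ⊆ ⋃ x ∈ F, Metric.ball x (C / N)

theorem codimTwoCover_empty {d : ℕ} : CodimTwoCover (∅ : Set (E d)) :=
  ⟨1, one_pos, fun N _ => ⟨∅, by simp, by simp⟩⟩

theorem CodimTwoCover.union {d : ℕ} {K K' : Set (E d)} (h : CodimTwoCover K)
    (h' : CodimTwoCover K') : CodimTwoCover (K ∪ K') := by
  classical
  obtain ⟨C, hC, h⟩ := h
  obtain ⟨C', hC', h'⟩ := h'
  refine ⟨C + C', by positivity, fun N hN => ?_⟩
  obtain ⟨F, hF, hKF⟩ := h N hN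
  obtain ⟨F', hF', hKF'⟩ := h' N hN
  refine ⟨F ∪ F', ?_, ?_⟩
  · have : ((F ∪ F').card : ℝ) ≤ F.card + F'.card := by exact_mod_cast Finset.card_union_le F F'
    linarith
  · have hN0 : (0 : ℝ) < N := by exact_mod_cast hN
    have h1 : C / N ≤ (C + C') / N := by gcongr; linarith
    have h2 : C' / N ≤ (C + C') / N := by gcongr; linarith
    rintro x (hx | hx)
    · obtain ⟨y, hy, hxy⟩ := Set.mem_iUnion₂.1 (hKF hx)
      exact Set.mem_iUnion₂.2 ⟨y, Finset.mem_union_left _ hy, Metric.ball_subset_ball h1 hxy⟩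
    · obtain ⟨y, hy, hxy⟩ := Set.mem_iUnion₂.1 (hKF' hx)
      exact Set.mem_iUnion₂.2 ⟨y, Finset.mem_union_right _ hy, Metric.ball_subset_ball h2 hxy⟩

theorem CodimTwoCover.biUnion {d : ℕ} {α : Type*} (s : Finset α) {K : α → Set (E d)}
    (h : ∀ a ∈ s, CodimTwoCover (K a)) : CodimTwoCover (⋃ a ∈ s, K a) := by
  classical
  induction s using Finset.induction_on with
  | empty => simpa using codimTwoCover_empty
  | insert a s ha ih =>
    rw [Finset.set_biUnion_insert]
    exact (h a (Finset.mem_insert_self _ _)).union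
      (ih fun b hb => h b (Finset.mem_insert_of_mem hb))

theorem codimTwoCover_singleton {d : ℕ} (a : E d) : CodimTwoCover ({a} : Set (E d)) := by
  refine ⟨1, one_pos, fun N hN => ⟨{a}, ?_, ?_⟩⟩
  · have : (1 : ℝ) ≤ N := by exact_mod_cast hN
    simpa using one_le_pow₀ this
  · have : (0 : ℝ) < N := by exact_mod_cast hN
    simp [this]

/-- N + 1 equally spaced points suffice. The constant 2 + dist a b meets both demands: N + 1 ≤ 2 N
bounds the number of balls, and the radius exceeds the spacing dist a b / N. -/
theorem codimTwoCover_segment {d : ℕ} (hd : 3 ≤ d) (a b : E d) : CodimTwoCover (segment ℝ a b) := by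
  classical
  refine ⟨2 + dist a b, by positivity, fun N hN => ⟨(Finset.range (N + 1)).image fun j : ℕ =>
    AffineMap.lineMap a b ((j : ℝ) / N), ?_, ?_⟩⟩
  · have hN1 : (1 : ℝ) ≤ N := by exact_mod_cast hN
    have h1 : (((Finset.range (N + 1)).image fun j : ℕ =>
      AffineMap.lineMap a b ((j : ℝ) / N)).card : ℝ) ≤ N + 1 := by
      exact_mod_cast Finset.card_image_le.trans (by simp)
    have h2 : (N : ℝ) ≤ (N : ℝ) ^ (d - 2) := le_self_pow₀ hN1 (by omega)
    have h3 : 0 ≤ dist a b * (N : ℝ) ^ (d - 2) := by positivity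
    nlinarith
  · have hN0 : (0 : ℝ) < N := by exact_mod_cast hN
    intro x hx
    rw [segment_eq_image_lineMap] at hx
    obtain ⟨t, ⟨ht0, ht1⟩, rfl⟩ := hx
    simp only [Set.mem_iUnion, Finset.mem_image, Finset.mem_range, exists_prop]
    refine ⟨_, ⟨⌊t * N⌋₊, ?_, rfl⟩, ?_⟩
    · have : ⌊t * N⌋₊ ≤ N := Nat.floor_le_of_le (by nlinarith)
      omega
    · rw [Metric.mem_ball, dist_lineMap_lineMap, Real.dist_eq]
      have h1 : |t - (⌊t * N⌋₊ : ℝ) / N| ≤ 1 / N := by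
        have e : t - (⌊t * N⌋₊ : ℝ) / N = (t * N - ⌊t * N⌋₊) / N := by field_simp
        rw [e, abs_div, abs_of_pos hN0]
        gcongr
        have := Nat.floor_le (a := t * N) (by positivity)
        have := Nat.lt_floor_add_one (t * N)
        rw [abs_le]; constructor <;> linarith
      calc _ ≤ 1 / N * dist a b := by gcongr
        _ < (2 + dist a b) / N := by
          rw [one_div_mul_eq_div]
          gcongr
          linarith

/-- In these dimensions at most d - 1 points span the empty set, a point or a segment, and a segment
can occur only for d = 3. -/
theorem codimTwoCover_convexHull {d : ℕ} (hd : d = 2 ∨ d = 3) {t : Finset (E d)}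
    (ht : t.card + 1 ≤ d) : CodimTwoCover (convexHull ℝ (t : Set (E d))) := by
  classical
  rcases t.eq_empty_or_nonempty with rfl | hne
  · simpa using codimTwoCover_empty
  have hpos := hne.card_pos
  by_cases h1 : t.card = 1
  · obtain ⟨a, rfl⟩ := Finset.card_eq_one.1 h1
    simpa using codimTwoCover_singleton a
  · obtain ⟨a, b, -, rfl⟩ := Finset.card_eq_two.1 (show t.card = 2 by omega)
    rw [Finset.coe_pair, convexHull_pair]
    exact codimTwoCover_segment (by omega) a b

end Cover

section Cutoff

variable {V : Type*} [NormedAddCommGroup V] [NormedSpace ℝ V]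

/-- In the product rule every undifferentiated factor lies in [0, 1]. -/
theorem norm_fderiv_prod_le {α : Type*} (s : Finset α) {g : α → V → ℝ} (x : V)
    (hg : ∀ a ∈ s, Differentiable ℝ (g a)) (h0 : ∀ a ∈ s, 0 ≤ g a x) (h1 : ∀ a ∈ s, g a x ≤ 1) :
    ‖fderiv ℝ (fun y => ∏ a ∈ s, g a y) x‖ ≤ ∑ a ∈ s, ‖fderiv ℝ (g a) x‖ := by
  classical
  induction s using Finset.induction_on with
  | empty => simp
  | insert a s ha ih =>
    have hs : ∀ b ∈ s, b ∈ insert a s := fun b hb => Finset.mem_insert_of_mem hb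
    have hd : Differentiable ℝ (fun y => ∏ b ∈ s, g b y) := by
      intro y
      have := (HasFDerivAt.finsetProd (u := s) (g := g) (x := y)
        fun b hb => (hg b (hs b hb) y).hasFDerivAt).differentiableAt
      simpa [Finset.prod_fn] using this
    have hprod0 : 0 ≤ ∏ b ∈ s, g b x := Finset.prod_nonneg fun b hb => h0 b (hs b hb)
    have hprod1 : ∏ b ∈ s, g b x ≤ 1 :=
      Finset.prod_le_one (fun b hb => h0 b (hs b hb)) fun b hb => h1 b (hs b hb)
    have ha' := Finset.mem_insert_self a s
    simp only [Finset.prod_insert ha, Finset.sum_insert ha]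
    rw [fderiv_fun_mul (hg a ha' x) (hd x)]
    refine (norm_add_le _ _).trans ?_
    rw [norm_smul, norm_smul, Real.norm_of_nonneg hprod0, Real.norm_of_nonneg (h0 a ha')]
    have e1 := ih (fun b hb => hg b (hs b hb)) (fun b hb => h0 b (hs b hb))
      (fun b hb => h1 b (hs b hb))
    have e2 : g a x * ‖fderiv ℝ (fun y => ∏ b ∈ s, g b y) x‖ ≤ ‖fderiv ℝ (fun y => ∏ b ∈ s, g b y) x‖ :=
      mul_le_of_le_one_left (norm_nonneg _) (h1 a ha')
    have e3 : (∏ b ∈ s, g b x) * ‖fderiv ℝ (g a) x‖ ≤ ‖fderiv ℝ (g a) x‖ :=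
      mul_le_of_le_one_left (norm_nonneg _) hprod1
    linarith

/-- The cutoff is the product of the functions 1 - b_a, where b_a is a fixed bump shrunk by the
factor N and centred at a ball of the covering. The gradient of b_a has L¹ norm of order N^(1-d),
and there are of order N^(d-2) factors, so the total is of order 1/N. -/
theorem exists_cutoff {d : ℕ} (hd : 2 ≤ d) {K : Set (E d)} (hK : CodimTwoCover K) {δ : ℝ}
    (hδ : 0 < δ) :
    ∃ χ : E d → ℝ, ContDiff ℝ (⊤ : ℕ∞) χ ∧ (∀ x, 0 ≤ χ x) ∧ (∀ x, χ x ≤ 1) ∧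
      (∃ U, IsOpen U ∧ K ⊆ U ∧ ∀ x ∈ U, χ x = 0) ∧
      (∀ x, (∀ y ∈ K, δ ≤ dist x y) → χ x = 1) ∧
      Integrable (fun x => ‖fderiv ℝ χ x‖) ∧ ∫ x, ‖fderiv ℝ χ x‖ ≤ δ := by
  classical
  obtain ⟨C, hC, hcov⟩ := hK
  let f : ContDiffBump (0 : E d) := ⟨C, 2 * C, hC, by linarith⟩
  set I : ℝ := ∫ x, ‖fderiv ℝ f x‖ with hI
  have hI0 : 0 ≤ I := integral_nonneg fun _ => norm_nonneg _
  -- The bumps have support radius 2C/N around centres closer than C/N to K, so 3C/δ < N keeps them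
  -- within distance δ of K. The bound C I/δ < N makes the L¹ norm of the gradient at most δ.
  obtain ⟨N, hN⟩ := exists_nat_gt (max 1 (max (3 * C / δ) (C * I / δ)))
  have hN1 : (1 : ℝ) < N := (le_max_left _ _).trans_lt hN
  have hN2 : 3 * C / δ < N := ((le_max_left _ _).trans (le_max_right _ _)).trans_lt hN
  have hN3 : C * I / δ < N := ((le_max_right _ _).trans (le_max_right _ _)).trans_lt hN
  have hN0 : (0 : ℝ) < N := one_pos.trans hN1
  obtain ⟨F₀, hF₀, hKF₀⟩ := hcov N (by exact_mod_cast hN1.le)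
  -- Balls that miss K are discarded; without this the cutoff could differ from 1 far away from K.
  set F := F₀.filter fun x => (Metric.ball x (C / N) ∩ K).Nonempty with hF
  have hFcard : (F.card : ℝ) ≤ C * (N : ℝ) ^ (d - 2) :=
    le_trans (by exact_mod_cast Finset.card_filter_le _ _) hF₀
  set b : E d → E d → ℝ := fun a x => f ((N : ℝ) • (x - a)) with hb
  have hbs : ∀ a, ContDiff ℝ (⊤ : ℕ∞) (b a) := fun a =>
    f.contDiff.comp (by fun_prop)
  have hfd : Continuous (fun x => ‖fderiv ℝ f x‖) :=
    (f.contDiff (n := 1).continuous_fderiv one_ne_zero).norm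
  have hfi : Integrable (fun x => ‖fderiv ℝ f x‖) :=
    hfd.integrable_of_hasCompactSupport (f.hasCompactSupport.fderiv ℝ).norm
  have hbfd : ∀ a x, ‖fderiv ℝ (b a) x‖ = N * ‖fderiv ℝ f ((N : ℝ) • (x - a))‖ := by
    intro a x
    have h1 : HasFDerivAt (fun x : E d => (N : ℝ) • (x - a)) ((N : ℝ) • ContinuousLinearMap.id ℝ (E d)) x :=
      ((hasFDerivAt_id x).sub_const a).const_smul (N : ℝ)
    have h2 := ((f.contDiff (n := 1).differentiable one_ne_zero) ((N : ℝ) • (x - a))).hasFDerivAt.comp x h1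
    have h3 : fderiv ℝ (b a) x = _ := h2.fderiv
    rw [h3, ContinuousLinearMap.comp_smul, norm_smul, ContinuousLinearMap.comp_id]
    simp
  have hbi : ∀ a, Integrable (fun x => ‖fderiv ℝ (b a) x‖) := by
    intro a
    simp only [hbfd]
    exact ((hfi.comp_smul hN0.ne').comp_sub_right a).const_mul _
  have hbint : ∀ a, ∫ x, ‖fderiv ℝ (b a) x‖ = N * ((N : ℝ) ^ d)⁻¹ * I := by
    intro a
    simp only [hbfd]
    rw [integral_const_mul, integral_sub_right_eq_self (fun x => ‖fderiv ℝ f ((N : ℝ) • x)‖) a,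
      Measure.integral_comp_smul volume (fun x => ‖fderiv ℝ f x‖)]
    simp [hI, abs_of_nonneg, mul_assoc]
  set χ : E d → ℝ := fun x => ∏ a ∈ F, (1 - b a x) with hχ
  have h0 : ∀ a x, 0 ≤ 1 - b a x := fun a x => by
    have := f.le_one (x := (N : ℝ) • (x - a)); simp only [hb]; linarith
  have h1 : ∀ a x, 1 - b a x ≤ 1 := fun a x => by
    have := f.nonneg (x := (N : ℝ) • (x - a)); simp only [hb]; linarith
  have hχs : ContDiff ℝ (⊤ : ℕ∞) χ := contDiff_prod fun a _ => contDiff_const.sub (hbs a)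
  have hbound : ∀ x, ‖fderiv ℝ χ x‖ ≤ ∑ a ∈ F, ‖fderiv ℝ (b a) x‖ := by
    intro x
    have := norm_fderiv_prod_le F (g := fun a y => 1 - b a y) x
      (fun a _ => (contDiff_const.sub (hbs a)).differentiable (by simp)) (fun a _ => h0 a x)
      (fun a _ => h1 a x)
    simpa only [fderiv_const_sub, norm_neg] using this
  have hsumi : Integrable (fun x => ∑ a ∈ F, ‖fderiv ℝ (b a) x‖) :=
    integrable_finsetSum _ fun a _ => hbi a
  have hχi : Integrable (fun x => ‖fderiv ℝ χ x‖) := by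
    refine hsumi.mono' ((hχs.continuous_fderiv (by simp)).norm.aestronglyMeasurable)
      (Eventually.of_forall fun x => ?_)
    simpa using hbound x
  refine ⟨χ, hχs, fun x => Finset.prod_nonneg fun a _ => h0 a x,
    fun x => Finset.prod_le_one (fun a _ => h0 a x) fun a _ => h1 a x,
    ⟨⋃ a ∈ F, Metric.ball a (C / N), isOpen_biUnion fun _ _ => Metric.isOpen_ball, ?_, ?_⟩, ?_,
    hχi, ?_⟩
  · intro x hx
    obtain ⟨a, ha, hxa⟩ := Set.mem_iUnion₂.1 (hKF₀ hx)
    exact Set.mem_iUnion₂.2 ⟨a, Finset.mem_filter.2 ⟨ha, x, hxa, hx⟩, hxa⟩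
  · intro x hx
    obtain ⟨a, ha, hxa⟩ := Set.mem_iUnion₂.1 hx
    refine Finset.prod_eq_zero ha ?_
    have : f ((N : ℝ) • (x - a)) = 1 := by
      apply f.one_of_mem_closedBall
      rw [mem_closedBall_zero_iff, norm_smul, Real.norm_of_nonneg hN0.le, ← dist_eq_norm]
      rw [Metric.mem_ball, lt_div_iff₀ hN0] at hxa
      change _ ≤ C
      linarith
    simp [hb, this]
  · intro x hx
    refine Finset.prod_eq_one fun a ha => ?_
    obtain ⟨-, y, hya, hyK⟩ := Finset.mem_filter.1 ha
    have : f ((N : ℝ) • (x - a)) = 0 := by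
      apply f.zero_of_le_dist
      rw [dist_zero_right, norm_smul, Real.norm_of_nonneg hN0.le, ← dist_eq_norm]
      change 2 * C ≤ _
      have h4 := hx y hyK
      have h5 := dist_triangle x a y
      rw [Metric.mem_ball, lt_div_iff₀ hN0] at hya
      rw [div_lt_iff₀ hδ] at hN2
      rw [dist_comm a y] at h5
      nlinarith
    simp [hb, this]
  · calc ∫ x, ‖fderiv ℝ χ x‖ ≤ ∫ x, ∑ a ∈ F, ‖fderiv ℝ (b a) x‖ :=
          integral_mono hχi hsumi hbound
      _ = F.card * (N * ((N : ℝ) ^ d)⁻¹ * I) := by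
          rw [integral_finsetSum _ fun a _ => hbi a]
          simp [hbint]
      _ ≤ (C * (N : ℝ) ^ (d - 2)) * (N * ((N : ℝ) ^ d)⁻¹ * I) := by gcongr
      _ = C * I / N := by
          obtain ⟨m, rfl⟩ := Nat.exists_eq_add_of_le hd
          rw [show 2 + m - 2 = m by omega, pow_add]
          field_simp
      _ ≤ δ := by
          rw [div_lt_iff₀ hδ] at hN3
          rw [div_le_iff₀ hN0]
          linarith

end Cutoff

/-! ### Local geometry of elements and faces -/

namespace Mesh

variable {d : ℕ} {Ω : Set (E d)} {ι κ : Type*} [Fintype ι] [Fintype κ] (M : Mesh d Ω ι κ)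

theorem mem_faces {i : ι} {e : κ} : e ∈ M.faces i ↔ M.face e ⊆ frontier (M.elem i) := by
  simp [faces]

theorem owner_mem (e : κ) : e ∈ M.faces (M.owner e) :=
  M.mem_faces.2 (M.face_elem e).choose_spec

theorem face_nonempty (hd : 2 ≤ d) (e : κ) : (M.face e).Nonempty := by
  by_contra h
  have := M.face_dim e
  rw [Set.not_nonempty_iff_eq_empty.1 h, AffineSubspace.span_empty, AffineSubspace.direction_bot,
    finrank_bot] at this
  omega

theorem affineSpan_closure_face (e : κ) :
    affineSpan ℝ (closure (M.face e)) = affineSpan ℝ (M.face e) := by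
  apply le_antisymm
  · rw [affineSpan_le]
    exact closure_minimal (subset_affineSpan ℝ _) (AffineSubspace.closed_of_finiteDimensional _)
  · exact affineSpan_mono ℝ subset_closure

theorem exists_ball_subset_face {e : κ} {x : E d} (hx : x ∈ M.face e) :
    ∃ r > 0, ∀ y ∈ affineSpan ℝ (M.face e), dist y x < r → y ∈ M.face e := by
  have h := hx
  rw [← M.face_relint e, mem_intrinsicInterior_iff_ball, M.affineSpan_closure_face] at h
  obtain ⟨-, r, hr, h⟩ := h
  refine ⟨r / 2, by positivity, fun y hy hyx => ?_⟩
  rw [← M.face_relint e, mem_intrinsicInterior_iff_ball, M.affineSpan_closure_face]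
  refine ⟨hy, r / 2, by positivity, fun z hz hzy => h z hz ?_⟩
  have := dist_triangle z y x
  linarith

theorem exists_isOpen_face_eq (e : κ) :
    ∃ U, IsOpen U ∧ M.face e = (affineSpan ℝ (M.face e) : Set (E d)) ∩ U := by
  choose r hr h using fun x : M.face e => M.exists_ball_subset_face x.2
  refine ⟨⋃ x : M.face e, Metric.ball (x : E d) (r x), isOpen_iUnion fun _ => Metric.isOpen_ball, ?_⟩
  ext y
  constructor
  · intro hy
    exact ⟨subset_affineSpan ℝ _ hy, Set.mem_iUnion.2 ⟨⟨y, hy⟩, Metric.mem_ball_self (hr _)⟩⟩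
  · rintro ⟨hy, hy'⟩
    obtain ⟨x, hx⟩ := Set.mem_iUnion.1 hy'
    exact h x y hy hx

theorem measurableSet_face (e : κ) : MeasurableSet (M.face e) := by
  obtain ⟨U, hU, h⟩ := M.exists_isOpen_face_eq e
  rw [h]
  exact (AffineSubspace.closed_of_finiteDimensional _).measurableSet.inter hU.measurableSet

/-- In the ball the element is an open half-ball. A point strictly on the outer side has a
neighbourhood that misses it, and a point strictly on the inner side belongs to the open element. -/
theorem inner_eq_zero_of_mem_frontier {i : ι} {x n : E d} {r : ℝ}
    (h : ∀ y ∈ Metric.ball x r, y ∈ M.elem i ↔ inner ℝ (y - x) n < 0) {y : E d}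
    (hy : y ∈ Metric.ball x r) (hyf : y ∈ frontier (M.elem i)) : inner ℝ (y - x) n = 0 := by
  rw [(M.elem_open i).frontier_eq] at hyf
  have hc : Continuous fun y : E d => inner ℝ (y - x) n := by fun_prop
  apply le_antisymm
  · by_contra hlt
    push Not at hlt
    have hopen : IsOpen ({y | 0 < inner ℝ (y - x) n} ∩ Metric.ball x r) :=
      (isOpen_lt continuous_const hc).inter Metric.isOpen_ball
    obtain ⟨z, hz, hzT⟩ := mem_closure_iff.1 hyf.1 _ hopen ⟨hlt, hy⟩
    exact lt_asymm hz.1 ((h z hz.2).1 hzT)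
  · by_contra hlt
    push Not at hlt
    exact hyf.2 ((h y hy).2 hlt)

/-- Small displacements within the span of the face stay on the frontier and are therefore
orthogonal to the normal. Both spaces have dimension d - 1, so the inclusion is an equality. -/
theorem direction_face {i : ι} {e : κ} (he : e ∈ M.faces i) (hd : 2 ≤ d) :
    (affineSpan ℝ (M.face e)).direction = (ℝ ∙ M.normal i e)ᗮ := by
  obtain ⟨x, hx⟩ := M.face_nonempty hd e
  obtain ⟨r, hr, h⟩ := M.normal_outward i e (M.mem_faces.1 he) x hx
  obtain ⟨r', hr', h'⟩ := M.exists_ball_subset_face hx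
  have hn := M.normal_unit i e (M.mem_faces.1 he)
  have hle : (affineSpan ℝ (M.face e)).direction ≤ (ℝ ∙ M.normal i e)ᗮ := by
    intro v hv
    rw [Submodule.mem_orthogonal_singleton_iff_inner_left]
    obtain ⟨t, ht, htr⟩ : ∃ t : ℝ, 0 < t ∧ t * ‖v‖ < min r r' := by
      have : 0 < min r r' := lt_min hr hr'
      refine ⟨min r r' / (‖v‖ + 1), by positivity, ?_⟩
      rw [div_mul_eq_mul_div, div_lt_iff₀ (by positivity)]
      nlinarith [norm_nonneg v]
    have hd' : dist (t • v + x) x = t * ‖v‖ := by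
      rw [dist_eq_norm]; simp [norm_smul, abs_of_pos ht]
    have hmem : t • v + x ∈ M.face e := by
      refine h' _ ?_ (by rw [hd']; exact htr.trans_le (min_le_right _ _))
      exact AffineSubspace.vadd_mem_of_mem_direction (Submodule.smul_mem _ t hv)
        (subset_affineSpan ℝ _ hx)
    have := M.inner_eq_zero_of_mem_frontier h
      (y := t • v + x) (by rw [Metric.mem_ball, hd']; exact htr.trans_le (min_le_left _ _))
      (M.mem_faces.1 he hmem)
    rw [add_sub_cancel_right, inner_smul_left] at this
    simpa [ht.ne'] using this
  apply Submodule.eq_of_le_of_finrank_eq hle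
  have h1 := (ℝ ∙ M.normal i e).finrank_add_finrank_orthogonal
  have h2 : Module.finrank ℝ (ℝ ∙ M.normal i e) = 1 :=
    finrank_span_singleton (by rintro h0; rw [h0] at hn; simp at hn)
  have h3 := M.face_dim e
  rw [finrank_euclideanSpace_fin] at h1
  omega

theorem mem_affineSpan_face_iff {i : ι} {e : κ} (he : e ∈ M.faces i) (hd : 2 ≤ d) {x : E d}
    (hx : x ∈ M.face e) (y : E d) :
    y ∈ affineSpan ℝ (M.face e) ↔ inner ℝ (y - x) (M.normal i e) = 0 := by
  rw [← AffineSubspace.vsub_right_mem_direction_iff_mem (subset_affineSpan ℝ _ hx),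
    M.direction_face he hd, Submodule.mem_orthogonal_singleton_iff_inner_left, vsub_eq_sub]

/-- Near x the frontier lies in one hyperplane, which the face already fills; another face of the
element would have to meet it there, against disjointness. This is the flat picture in which the
half-space formula applies. -/
theorem exists_face_chart {i : ι} {e : κ} (he : e ∈ M.faces i) (hd : 2 ≤ d) {x : E d}
    (hx : x ∈ M.face e) : ∃ r > 0, ∀ y ∈ Metric.ball x r,
      (y ∈ M.elem i ↔ inner ℝ (y - x) (M.normal i e) < 0) ∧
      (y ∈ M.face e ↔ inner ℝ (y - x) (M.normal i e) = 0) ∧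
      ∀ f ∈ M.faces i, f ≠ e → y ∉ M.face f := by
  obtain ⟨r, hr, h⟩ := M.normal_outward i e (M.mem_faces.1 he) x hx
  obtain ⟨r', hr', h'⟩ := M.exists_ball_subset_face hx
  have key : ∀ y ∈ Metric.ball x (min r r'), inner ℝ (y - x) (M.normal i e) = 0 → y ∈ M.face e :=
    fun y hy h0 => h' y ((M.mem_affineSpan_face_iff he hd hx y).2 h0)
      (lt_of_lt_of_le hy (min_le_right _ _))
  refine ⟨min r r', lt_min hr hr', fun y hy => ?_⟩
  have hy1 : y ∈ Metric.ball x r := Metric.ball_subset_ball (min_le_left _ _) hy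
  refine ⟨h y hy1, ⟨fun hye => ?_, key y hy⟩, fun f hf hfe hyf => ?_⟩
  · exact M.inner_eq_zero_of_mem_frontier h hy1 (M.mem_faces.1 he hye)
  · have := key y hy (M.inner_eq_zero_of_mem_frontier h hy1 (M.mem_faces.1 hf hyf))
    exact Set.disjoint_left.1 (M.face_disjoint hfe) hyf this

theorem elem_subset (hΩ_reg : interior (closure Ω) = Ω) (i : ι) : M.elem i ⊆ Ω := by
  refine (interior_maximal ?_ (M.elem_open i)).trans hΩ_reg.le
  rw [← M.elem_cover]
  exact subset_closure.trans (Set.subset_iUnion (fun i => closure (M.elem i)) i)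

theorem isBounded_closure_elem (hΩ : Bornology.IsBounded Ω) (i : ι) :
    Bornology.IsBounded (closure (M.elem i)) := by
  refine hΩ.closure.subset ?_
  rw [← M.elem_cover]
  exact Set.subset_iUnion (fun i => closure (M.elem i)) i

theorem isBounded_face (hΩ : Bornology.IsBounded Ω) (e : κ) : Bornology.IsBounded (M.face e) :=
  (M.isBounded_closure_elem hΩ (M.owner e)).subset
    ((M.mem_faces.1 (M.owner_mem e)).trans frontier_subset_closure)

theorem euclideanHausdorff_eq_volume_direction {A : AffineSubspace ℝ (E d)} {p : E d}
    (hd : Module.finrank ℝ A.direction = d - 1) (s : Set (E d)) (hp : p ∈ A) (hs : s ⊆ A) :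
    μHE[d - 1] s = volume {z : A.direction | (z : E d) + p ∈ s} := by
  have hiso : Isometry (fun z : A.direction => (z : E d) + p) :=
    Isometry.of_dist_eq fun a b => by simp [dist_eq_norm]
  have himg : (fun z : A.direction => (z : E d) + p) '' {z : A.direction | (z : E d) + p ∈ s} = s := by
    ext y
    constructor
    · rintro ⟨z, hz, rfl⟩
      exact hz
    · intro hy
      exact ⟨⟨y -ᵥ p, AffineSubspace.vsub_mem_direction (hs hy) hp⟩, by simpa using hy, by simp⟩
  conv_lhs => rw [← himg, hiso.euclideanHausdorffMeasure_image, ← hd,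
    InnerProductSpace.euclideanHausdorffMeasure_eq_volume]

theorem surf_lt_top (hd : 2 ≤ d) (hΩ : Bornology.IsBounded Ω) (e : κ) :
    IsFiniteMeasure (M.surf e) := by
  constructor
  obtain ⟨p, hp⟩ := M.face_nonempty hd e
  rw [surf, Measure.restrict_apply_univ, euclideanHausdorff_eq_volume_direction (A := affineSpan ℝ (M.face e))
    (by have := M.face_dim e; omega) _ (subset_affineSpan ℝ _ hp) (subset_affineSpan ℝ _)]
  refine Bornology.IsBounded.measure_lt_top ?_
  obtain ⟨R, hR⟩ := (M.isBounded_face hΩ e).subset_closedBall p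
  refine Metric.isBounded_closedBall (x := 0) (r := R) |>.subset fun z hz => ?_
  have := hR hz
  simpa [dist_eq_norm] using this

/-- Faces are relatively open. The positivity turns almost-everywhere statements about continuous
functions on a face into pointwise ones and shows that a face is not covered by a null set. -/
theorem surf_ball_pos (hd : 2 ≤ d) {e : κ} {x : E d} (hx : x ∈ M.face e) {r : ℝ} (hr : 0 < r) :
    0 < M.surf e (Metric.ball x r) := by
  have hsub : Metric.ball x r ∩ M.face e ⊆ affineSpan ℝ (M.face e) :=
    Set.inter_subset_right.trans (subset_affineSpan ℝ _)
  rw [surf, Measure.restrict_apply Metric.isOpen_ball.measurableSet,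
    euclideanHausdorff_eq_volume_direction (A := affineSpan ℝ (M.face e))
    (by have := M.face_dim e; omega) _ (subset_affineSpan ℝ _ hx) hsub]
  obtain ⟨r', hr', h'⟩ := M.exists_ball_subset_face hx
  refine lt_of_lt_of_le (Metric.measure_ball_pos volume 0 (lt_min hr hr')) (measure_mono ?_)
  intro z hz
  have hz' : ‖(z : E d)‖ < min r r' := by simpa using hz
  have hdist : dist ((z : E d) + x) x = ‖(z : E d)‖ := by simp [dist_eq_norm]
  refine ⟨?_, h' _ (AffineSubspace.vadd_mem_of_mem_direction z.2 (subset_affineSpan ℝ _ hx)) ?_⟩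
  · rw [Metric.mem_ball, hdist]; exact hz'.trans_le (min_le_left _ _)
  · rw [hdist]; exact hz'.trans_le (min_le_right _ _)

theorem volume_closure_face (hd : 2 ≤ d) (e : κ) : volume (closure (M.face e)) = 0 := by
  rw [← EuclideanSpace.euclideanHausdorffMeasure_eq_volume]
  refine measure_mono_null (t := (affineSpan ℝ (M.face e) : Set (E d)))
    (closure_minimal (subset_affineSpan ℝ _) (AffineSubspace.closed_of_finiteDimensional _)) ?_
  apply euclideanHausdorff_affineSubspace_eq_zero
  have := M.face_dim e
  omega

theorem volume_frontier_elem (hd : 2 ≤ d) (i : ι) : volume (frontier (M.elem i)) = 0 := by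
  rw [M.frontier_elem i]
  exact (measure_biUnion_null_iff (Set.to_countable _)).2 fun e _ => M.volume_closure_face hd e

/-- The relative boundary of a face. -/
theorem exists_relBoundary_cover (e : κ) : ∃ T : Finset (Finset (E d)), (∀ t ∈ T, t.card + 1 ≤ d) ∧
    closure (M.face e) \ M.face e ⊆ ⋃ t ∈ T, convexHull ℝ (t : Set (E d)) := by
  have := (M.face_polytopal e).sdiff_intrinsicInterior_subset (d := d) (by
    rw [M.affineSpan_closure_face]; exact M.face_dim e)
  rwa [M.face_relint e] at this

end Mesh

/-! ### Divergence theorem on a polyhedral element -/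

theorem setIntegral_congr_support {X : Type*} [MeasurableSpace X] {μ : Measure X} {S S' : Set X}
    (hS : MeasurableSet S) (hS' : MeasurableSet S') {f : X → ℂ}
    (h : ∀ y, f y ≠ 0 → (y ∈ S ↔ y ∈ S')) : ∫ y in S, f y ∂μ = ∫ y in S', f y ∂μ := by
  rw [← integral_indicator hS, ← integral_indicator hS']
  congr 1
  ext y
  by_cases hy : f y = 0
  · simp [Set.indicator, hy]
  · by_cases hyS : y ∈ S'
    · rw [Set.indicator_of_mem hyS, Set.indicator_of_mem ((h y hy).2 hyS)]
    · rw [Set.indicator_of_notMem hyS, Set.indicator_of_notMem fun h' => hyS ((h y hy).1 h')]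

namespace Mesh

variable {d : ℕ} {Ω : Set (E d)} {ι κ : Type*} [Fintype ι] [Fintype κ] (M : Mesh d Ω ι κ)

theorem bdInt_add {i : ι} {f g : κ → E d → ℂ} (hf : ∀ e ∈ M.faces i, Integrable (f e) (M.surf e))
    (hg : ∀ e ∈ M.faces i, Integrable (g e) (M.surf e)) :
    M.bdInt i (fun e x => f e x + g e x) = M.bdInt i f + M.bdInt i g := by
  rw [bdInt, bdInt, bdInt, ← Finset.sum_add_distrib]
  exact Finset.sum_congr rfl fun e he => integral_add (hf e he) (hg e he)

theorem bdInt_sub {i : ι} {f g : κ → E d → ℂ} (hf : ∀ e ∈ M.faces i, Integrable (f e) (M.surf e))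
    (hg : ∀ e ∈ M.faces i, Integrable (g e) (M.surf e)) :
    M.bdInt i (fun e x => f e x - g e x) = M.bdInt i f - M.bdInt i g := by
  rw [bdInt, bdInt, bdInt, ← Finset.sum_sub_distrib]
  exact Finset.sum_congr rfl fun e he => integral_sub (hf e he) (hg e he)

theorem bdInt_congr {i : ι} {f g : κ → E d → ℂ}
    (h : ∀ e ∈ M.faces i, ∀ x ∈ M.face e, f e x = g e x) : M.bdInt i f = M.bdInt i g := by
  refine Finset.sum_congr rfl fun e he => ?_
  exact setIntegral_congr_fun (M.measurableSet_face e) fun x hx => h e he x hx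

/-- The divergence theorem on the element `i` for the function `φ` and the constant direction `v`. -/
def GreenOn (i : ι) (φ : E d → ℂ) (v : E d) : Prop :=
  ∫ y in M.elem i, fderiv ℝ φ y v =
    M.bdInt i (fun e y => φ y * (inner ℝ v (M.normal i e) : ℝ))

theorem integrable_surf_of_continuous (hd : 2 ≤ d) (hΩ : Bornology.IsBounded Ω) (e : κ)
    {φ : E d → ℂ} (hφ : Continuous φ) : Integrable φ (M.surf e) := by
  have := M.surf_lt_top hd hΩ e
  obtain ⟨C, hC⟩ := (M.isBounded_face hΩ e).isCompact_closure.exists_bound_of_continuousOn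
    hφ.continuousOn
  refine (memLp_top_of_bound hφ.aestronglyMeasurable C ?_).integrable le_top
  filter_upwards [ae_restrict_mem (M.measurableSet_face e)] with x hx
  exact hC x (subset_closure hx)

theorem integrable_vol_of_continuous (hΩ : Bornology.IsBounded Ω) (i : ι)
    {φ : E d → ℂ} (hφ : Continuous φ) : Integrable φ (M.vol i) :=
  (hφ.continuousOn.integrableOn_compact
    (M.isBounded_closure_elem hΩ i |>.isCompact_closure)).mono_set
      (subset_closure.trans subset_closure)

theorem GreenOn.add (hd : 2 ≤ d) (hΩ : Bornology.IsBounded Ω) {i : ι} {φ ψ : E d → ℂ} {v : E d}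
    (hφ : ContDiff ℝ 1 φ) (hψ : ContDiff ℝ 1 ψ) (h : M.GreenOn i φ v) (h' : M.GreenOn i ψ v) :
    M.GreenOn i (fun y => φ y + ψ y) v := by
  unfold GreenOn at *
  simp only [add_mul]
  rw [M.bdInt_add, ← h, ← h', ← integral_add]
  · refine integral_congr_ae (Eventually.of_forall fun y => ?_)
    beta_reduce
    rw [fderiv_fun_add (hφ.differentiable one_ne_zero y) (hψ.differentiable one_ne_zero y)]
    rfl
  · exact M.integrable_vol_of_continuous hΩ i
      ((hφ.continuous_fderiv one_ne_zero).clm_apply continuous_const)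
  · exact M.integrable_vol_of_continuous hΩ i
      ((hψ.continuous_fderiv one_ne_zero).clm_apply continuous_const)
  · exact fun e _ => M.integrable_surf_of_continuous hd hΩ e (hφ.continuous.mul continuous_const)
  · exact fun e _ => M.integrable_surf_of_continuous hd hΩ e (hψ.continuous.mul continuous_const)

theorem greenOn_zero (i : ι) (v : E d) : M.GreenOn i (fun _ => 0) v := by
  simp [GreenOn, bdInt]

/-- There are three local pictures. Around an inner point both sides vanish, around a point of an
open face the half-space formula applies, and off the closure nothing is seen. The excluded points
are those where faces end and no flat chart is available. -/
theorem exists_greenOn_ball (hd : 2 ≤ d) (i : ι) {x : E d}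
    (hx : ∀ e ∈ M.faces i, x ∉ closure (M.face e) \ M.face e) :
    ∃ r > 0, ∀ φ : E d → ℂ, ContDiff ℝ 1 φ → HasCompactSupport φ → tsupport φ ⊆ Metric.ball x r →
      ∀ v, M.GreenOn i φ v := by
  have hfsupp : ∀ (φ : E d → ℂ) (y v : E d), fderiv ℝ φ y v ≠ 0 → y ∈ tsupport φ :=
    fun φ y v h => support_fderiv_subset ℝ fun h0 => h (by simp [h0])
  have hsupp : ∀ (φ : E d → ℂ) (y : E d), φ y ≠ 0 → y ∈ tsupport φ :=
    fun φ y h => subset_tsupport _ h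
  by_cases hxT : x ∈ M.elem i
  · obtain ⟨r, hr, hrT⟩ := Metric.isOpen_iff.1 (M.elem_open i) x hxT
    refine ⟨r, hr, fun φ hφ hc hs v => ?_⟩
    rw [GreenOn, setIntegral_congr_support (M.elem_open i).measurableSet MeasurableSet.univ
      (fun y hy => by simpa using hrT (hs (hfsupp φ y v hy))), setIntegral_univ,
      integral_fderiv_eq_zero hφ hc, eq_comm]
    refine Finset.sum_eq_zero fun e he => ?_
    refine (setIntegral_congr_fun (M.measurableSet_face e) fun y hy => ?_).trans
      (integral_zero _ _)
    have h0 : φ y = 0 := by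
      by_contra h0
      have h1 := hrT (hs (hsupp φ y h0))
      have h2 := M.mem_faces.1 he hy
      rw [(M.elem_open i).frontier_eq] at h2
      exact h2.2 h1
    simp [h0]
  by_cases hxc : x ∈ closure (M.elem i)
  · have hxf : x ∈ frontier (M.elem i) := by
      rw [(M.elem_open i).frontier_eq]; exact ⟨hxc, hxT⟩
    rw [M.frontier_elem i] at hxf
    obtain ⟨e, he, hxe'⟩ := Set.mem_iUnion₂.1 hxf
    have hei : e ∈ M.faces i := M.mem_faces.2 he
    have hxe : x ∈ M.face e := by
      by_contra h; exact hx e hei ⟨hxe', h⟩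
    obtain ⟨r, hr, h⟩ := M.exists_face_chart hei hd hxe
    refine ⟨r, hr, fun φ hφ hc hs v => ?_⟩
    have hc' : Continuous fun y : E d => inner ℝ (y - x) (M.normal i e) := by fun_prop
    rw [GreenOn, setIntegral_congr_support (M.elem_open i).measurableSet
      (isOpen_lt hc' continuous_const).measurableSet
      (fun y hy => (h y (hs (hfsupp φ y v hy))).1),
      halfSpace_formula hφ hc x (M.normal i e) (M.normal_unit i e he) v, bdInt,
      Finset.sum_eq_single_of_mem e hei]
    · rw [surf, integral_mul_const, mul_comm, finrank_euclideanSpace_fin]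
      congr 1
      exact setIntegral_congr_support (isClosed_eq hc' continuous_const).measurableSet
        (M.measurableSet_face e) fun y hy => (h y (hs (hsupp φ y hy))).2.1.symm
    · intro f hf hfe
      refine (setIntegral_congr_fun (M.measurableSet_face f) fun y hy => ?_).trans
        (integral_zero _ _)
      have h0 : φ y = 0 := by
        by_contra h0
        exact (h y (hs (hsupp φ y h0))).2.2 f hf hfe hy
      simp [h0]
  · obtain ⟨r, hr, hrT⟩ := Metric.isOpen_iff.1 (isClosed_closure (s := M.elem i)).isOpen_compl x hxc
    refine ⟨r, hr, fun φ hφ hc hs v => ?_⟩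
    rw [GreenOn, setIntegral_congr_support (S' := ∅) (M.elem_open i).measurableSet MeasurableSet.empty
      (fun y hy => iff_of_false (fun h => hrT (hs (hfsupp φ y v hy)) (subset_closure h)) (by simp))]
    rw [Measure.restrict_empty, integral_zero_measure, eq_comm]
    refine Finset.sum_eq_zero fun e he => ?_
    refine (setIntegral_congr_fun (M.measurableSet_face e) fun y hy => ?_).trans
      (integral_zero _ _)
    have h0 : φ y = 0 := by
      by_contra h0
      exact hrT (hs (hsupp φ y h0)) (frontier_subset_closure (M.mem_faces.1 he hy))
    simp [h0]

/-- A partition of unity in product form: multiplying φ successively by 1 - ρ a ends at zero,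
because the sets where some ρ a equals 1 cover the support. Each piece split off is supported in a
ball where the formula is known. -/
theorem greenOn_of_tsupport (hd : 2 ≤ d) (hΩ : Bornology.IsBounded Ω) (i : ι) {φ : E d → ℂ}
    (hφ : ContDiff ℝ 1 φ) (hc : HasCompactSupport φ)
    (hs : ∀ e ∈ M.faces i, ∀ x ∈ tsupport φ, x ∉ closure (M.face e) \ M.face e) (v : E d) :
    M.GreenOn i φ v := by
  classical
  choose r hr hG using fun x : tsupport φ => M.exists_greenOn_ball hd i
    (fun e he => hs e he x x.2)
  have hrpos : ∀ x, 0 < r x / 2 := fun x => half_pos (hr x)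
  let ρ : ∀ x : tsupport φ, ContDiffBump (x : E d) := fun x =>
    ⟨r x / 4, r x / 2, by linarith [hr x], by linarith [hr x]⟩
  obtain ⟨F, hF⟩ := hc.isCompact.elim_finite_subcover
    (fun x : tsupport φ => Metric.ball (x : E d) (r x / 4)) (fun _ => Metric.isOpen_ball)
    (fun x hx => Set.mem_iUnion.2 ⟨⟨x, hx⟩, Metric.mem_ball_self (by linarith [hr ⟨x, hx⟩])⟩)
  set P : Finset (tsupport φ) → E d → ℂ := fun F' y => φ y * ∏ a ∈ F', (1 - (ρ a y : ℂ)) with hP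
  have hρ : ∀ a, ContDiff ℝ 1 (fun y => (ρ a y : ℂ)) := fun a =>
    Complex.ofRealCLM.contDiff.comp (ρ a).contDiff
  have hPs : ∀ F', ContDiff ℝ 1 (P F') := fun F' =>
    hφ.mul (contDiff_prod fun a _ => contDiff_const.sub (hρ a))
  have hstep : ∀ F' : Finset (tsupport φ), M.GreenOn i (P F') v → M.GreenOn i φ v := by
    intro F'
    induction F' using Finset.induction_on with
    | empty => intro h; simpa [hP] using h
    | insert a F' ha ih =>
      intro h
      apply ih
      have hsplit : P F' = fun y => P (insert a F') y + P F' y * ρ a y := by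
        ext y
        simp only [hP, Finset.prod_insert ha]
        ring
      rw [hsplit]
      refine GreenOn.add M hd hΩ (hPs _) ((hPs _).mul (hρ a)) h ?_
      have hcomp : HasCompactSupport (fun y => P F' y * ρ a y) :=
        ((hc.mul_right (f' := fun y => ∏ a ∈ F', (1 - (ρ a y : ℂ)))).mul_right
          (f' := fun y => (ρ a y : ℂ)))
      refine hG a _ ((hPs _).mul (hρ a)) hcomp ?_ v
      have h1 : tsupport (fun y => P F' y * ρ a y) ⊆ tsupport (ρ a) := by
        refine closure_mono fun y hy => ?_
        simp only [Function.mem_support] at hy ⊢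
        intro h0
        apply hy
        simp [h0]
      refine h1.trans ?_
      rw [(ρ a).tsupport_eq]
      exact Metric.closedBall_subset_ball (by change r a / 2 < r a; linarith [hr a])
  refine hstep F ?_
  have h0 : P F = fun _ => 0 := by
    ext y
    by_cases hy : y ∈ tsupport φ
    · obtain ⟨a, ha, hya⟩ := Set.mem_iUnion₂.1 (hF hy)
      have : ρ a y = 1 := (ρ a).one_of_mem_closedBall (Metric.ball_subset_closedBall hya)
      simp only [hP]
      rw [Finset.prod_eq_zero ha (by simp [this]), mul_zero]
    · simp [hP, image_eq_zero_of_notMem_tsupport hy]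
  rw [h0]
  exact M.greenOn_zero i v

end Mesh

theorem tendsto_integral_mul_of_eLpNorm {X : Type*} [MeasurableSpace X] {μ : Measure X}
    {a : ℕ → X → ℂ} {f b : X → ℂ} (ha : ∀ n, MemLp (a n) 2 μ) (hf : MemLp f 2 μ)
    (hb : MemLp b 2 μ) (h : Tendsto (fun n => eLpNorm (fun x => a n x - f x) 2 μ) atTop (𝓝 0)) :
    Tendsto (fun n => ∫ x, a n x * b x ∂μ) atTop (𝓝 (∫ x, f x * b x ∂μ)) := by
  refine tendsto_integral_of_L1' _ (hf.integrable_mul hb).1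
    (Eventually.of_forall fun n => (ha n).integrable_mul hb) ?_
  have hle : ∀ n, eLpNorm ((fun x => a n x * b x) - fun x => f x * b x) 1 μ ≤
      eLpNorm (fun x => a n x - f x) 2 μ * eLpNorm b 2 μ := by
    intro n
    have := eLpNorm_smul_le_mul_eLpNorm (p := 2) (q := 2) (r := 1) hb.1
      ((ha n).sub hf).1
    refine le_trans (le_of_eq ?_) this
    congr 1
    ext x
    simp [sub_mul]
  refine tendsto_of_tendsto_of_tendsto_of_le_of_le tendsto_const_nhds ?_ (fun _ => zero_le) hle
  simpa using ENNReal.Tendsto.mul_const h (Or.inr hb.2.ne)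

namespace Mesh

variable {d : ℕ} {Ω : Set (E d)} {ι κ : Type*} [Fintype ι] [Fintype κ] (M : Mesh d Ω ι κ)

/-- The formula holds for χ_n φ, where χ_n vanishes near the union K of the relative boundaries of
the faces. The term φ ∂_v χ_n tends to 0 in L¹, and χ_n tends to 1 off K, so dominated convergence
handles the other integrals. -/
theorem greenOn_of_hasCompactSupport (hd : d = 2 ∨ d = 3) (hΩ : Bornology.IsBounded Ω) (i : ι)
    {φ : E d → ℂ} (hφ : ContDiff ℝ 1 φ) (hc : HasCompactSupport φ) (v : E d) :
    M.GreenOn i φ v := by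
  have hd2 : 2 ≤ d := by omega
  choose T hT hcov using M.exists_relBoundary_cover
  set K : Set (E d) := ⋃ e ∈ M.faces i, ⋃ t ∈ T e, convexHull ℝ (t : Set (E d)) with hK
  have hKcov : CodimTwoCover K := CodimTwoCover.biUnion _ fun e _ =>
    CodimTwoCover.biUnion _ fun t ht => codimTwoCover_convexHull hd (hT e t ht)
  have hKclosed : IsClosed K := by
    refine Set.Finite.isClosed_biUnion (Finset.finite_toSet _) fun e _ => ?_
    refine Set.Finite.isClosed_biUnion (Finset.finite_toSet _) fun t _ => ?_
    exact (t.finite_toSet.isCompact_convexHull ℝ).isClosed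
  -- Used for m = d, the volume, and for m = d - 1, the surface measure.
  have hKnull : ∀ m, d ≤ m + 1 → μHE[m] K = 0 := by
    intro m hm
    refine (measure_biUnion_null_iff (Finset.countable_toSet _)).2 fun e _ => ?_
    refine (measure_biUnion_null_iff (Finset.countable_toSet _)).2 fun t ht => ?_
    exact euclideanHausdorff_convexHull_eq_zero (by have := hT e t ht; omega)
  choose χ hχs hχ0 hχ1 hχK hχout hχi hχb using fun n : ℕ =>
    exists_cutoff hd2 hKcov (Nat.one_div_pos_of_nat (α := ℝ) (n := n))
  have hlim : ∀ x, x ∉ K → ∀ᶠ n in atTop, χ n x = 1 := by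
    intro x hx
    obtain ⟨r, hr, hrK⟩ := Metric.isOpen_iff.1 hKclosed.isOpen_compl x hx
    have := (tendsto_one_div_add_atTop_nhds_zero_nat (𝕜 := ℝ)).eventually (gt_mem_nhds hr)
    filter_upwards [this] with n hn
    refine hχout n x fun y hy => ?_
    by_contra hlt
    push Not at hlt
    refine hrK (Metric.mem_ball.2 ?_) hy
    rw [dist_comm]
    exact hlt.trans hn
  have hχC : ∀ n, ContDiff ℝ 1 (fun y => (χ n y : ℂ)) := fun n =>
    Complex.ofRealCLM.contDiff.comp ((hχs n).of_le (by exact_mod_cast le_top))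
  have hχnorm : ∀ n y, ‖(χ n y : ℂ)‖ ≤ 1 := fun n y => by
    rw [Complex.norm_real, Real.norm_of_nonneg (hχ0 n y)]; exact hχ1 n y
  have hfd : Continuous fun y => fderiv ℝ φ y v :=
    (hφ.continuous_fderiv one_ne_zero).clm_apply continuous_const
  have hG : ∀ n, M.GreenOn i (fun y => χ n y * φ y) v := by
    intro n
    refine M.greenOn_of_tsupport hd2 hΩ i ((hχC n).mul hφ) hc.mul_left ?_ v
    rintro e he x hx hxS
    obtain ⟨U, hU, hKU, hU0⟩ := hχK n
    have hxU : x ∈ U := hKU (Set.mem_iUnion₂.2 ⟨e, he, hcov e hxS⟩)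
    refine (mem_closure_iff.1 hx U hU hxU).elim fun y hy => hy.2 ?_
    simp [hU0 y hy.1]
  have hder : ∀ n y, fderiv ℝ (fun y => χ n y * φ y) y v =
      χ n y * fderiv ℝ φ y v + φ y * (fderiv ℝ (χ n) y v : ℝ) := by
    intro n y
    have h1 : HasFDerivAt (fun y => (χ n y : ℂ)) (Complex.ofRealCLM.comp (fderiv ℝ (χ n) y)) y :=
      Complex.ofRealCLM.hasFDerivAt.comp y
        (((hχs n).differentiable (by simp)) y).hasFDerivAt
    have h2 := (h1.mul (hφ.differentiable one_ne_zero y).hasFDerivAt).fderiv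
    rw [show (fun y => (χ n y : ℂ) * φ y) = (fun y => (χ n y : ℂ)) * φ from rfl, h2]
    simp
  obtain ⟨C, hC⟩ := hc.exists_bound_of_continuous hφ.continuous
  have hC0 : 0 ≤ C := (norm_nonneg _).trans (hC 0)
  have hLint : ∀ n, ∫ y in M.elem i, fderiv ℝ (fun y => χ n y * φ y) y v =
      (∫ y in M.elem i, χ n y * fderiv ℝ φ y v) +
        ∫ y in M.elem i, φ y * (fderiv ℝ (χ n) y v : ℝ) := by
    intro n
    simp only [hder]
    refine integral_add ?_ ?_
    · exact M.integrable_vol_of_continuous hΩ i ((hχC n).continuous.mul hfd)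
    · refine M.integrable_vol_of_continuous hΩ i (hφ.continuous.mul ?_)
      exact Complex.continuous_ofReal.comp
        (((hχs n).continuous_fderiv (by simp)).clm_apply continuous_const)
  have hA : Tendsto (fun n => ∫ y in M.elem i, χ n y * fderiv ℝ φ y v) atTop
      (𝓝 (∫ y in M.elem i, fderiv ℝ φ y v)) := by
    refine tendsto_integral_of_dominated_convergence (fun y => ‖fderiv ℝ φ y v‖)
      (fun n => ((hχC n).continuous.mul hfd).aestronglyMeasurable)
      (M.integrable_vol_of_continuous hΩ i hfd).norm
      (fun n => Eventually.of_forall fun y => ?_) ?_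
    · rw [norm_mul]
      exact mul_le_of_le_one_left (norm_nonneg _) (hχnorm n y)
    · have hvol : volume K = 0 := by
        rw [← EuclideanSpace.euclideanHausdorffMeasure_eq_volume]
        exact hKnull d (by omega)
      have : ∀ᵐ y ∂(volume.restrict (M.elem i)), y ∉ K :=
        ae_restrict_of_ae (measure_eq_zero_iff_ae_notMem.1 hvol)
      filter_upwards [this] with y hy
      refine tendsto_const_nhds.congr' ?_
      filter_upwards [hlim y hy] with n hn
      simp [hn]
  have hB : Tendsto (fun n => ∫ y in M.elem i, φ y * (fderiv ℝ (χ n) y v : ℝ)) atTop (𝓝 0) := by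
    refine squeeze_zero_norm (a := fun n : ℕ => C * ‖v‖ * (1 / ((n : ℝ) + 1))) (fun n => ?_) ?_
    · calc ‖∫ y in M.elem i, φ y * (fderiv ℝ (χ n) y v : ℝ)‖
          ≤ ∫ y in M.elem i, C * ‖v‖ * ‖fderiv ℝ (χ n) y‖ := by
            refine norm_integral_le_of_norm_le ((hχi n).const_mul _).integrableOn
              (Eventually.of_forall fun y => ?_)
            rw [norm_mul, Complex.norm_real, mul_assoc]
            refine mul_le_mul (hC y) ?_ (norm_nonneg _) hC0
            rw [mul_comm]
            exact (fderiv ℝ (χ n) y).le_opNorm v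
        _ ≤ ∫ y, C * ‖v‖ * ‖fderiv ℝ (χ n) y‖ :=
            setIntegral_le_integral ((hχi n).const_mul _)
              (Eventually.of_forall fun y => by positivity)
        _ ≤ C * ‖v‖ * (1 / ((n : ℝ) + 1)) := by
            rw [integral_const_mul]
            gcongr
            exact hχb n
    · simpa using (tendsto_one_div_add_atTop_nhds_zero_nat (𝕜 := ℝ)).const_mul (C * ‖v‖)
  have hR : Tendsto (fun n => M.bdInt i
      (fun e y => (χ n y * φ y) * (inner ℝ v (M.normal i e) : ℝ))) atTop
      (𝓝 (M.bdInt i (fun e y => φ y * (inner ℝ v (M.normal i e) : ℝ)))) := by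
    refine tendsto_finsetSum _ fun e _ => ?_
    refine tendsto_integral_of_dominated_convergence
      (fun y => ‖φ y * (inner ℝ v (M.normal i e) : ℝ)‖)
      (fun n => (((hχC n).mul hφ).continuous.mul continuous_const).aestronglyMeasurable)
      (M.integrable_surf_of_continuous hd2 hΩ e (hφ.continuous.mul continuous_const)).norm
      (fun n => Eventually.of_forall fun y => ?_) ?_
    · beta_reduce
      rw [mul_assoc, norm_mul]
      exact mul_le_of_le_one_left (norm_nonneg _) (hχnorm n y)
    · have : ∀ᵐ y ∂(M.surf e), y ∉ K :=
        ae_restrict_of_ae (measure_eq_zero_iff_ae_notMem.1 (hKnull (d - 1) (by omega)))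
      filter_upwards [this] with y hy
      refine tendsto_const_nhds.congr' ?_
      filter_upwards [hlim y hy] with n hn
      simp [hn]
  have hAB := hA.add hB
  rw [add_zero] at hAB
  refine tendsto_nhds_unique (hAB.congr fun n => ?_) hR
  rw [← hLint]
  exact hG n

/-- The divergence theorem on an element. -/
theorem green (hd : d = 2 ∨ d = 3) (hΩ : Bornology.IsBounded Ω) (i : ι)
    {φ : E d → ℂ} (hφ : ContDiff ℝ 1 φ) (v : E d) : M.GreenOn i φ v := by
  -- A bump that equals 1 on a ball around the closed element makes φ compactly supported without
  -- changing either side.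
  obtain ⟨R, hR, hsub⟩ := (M.isBounded_closure_elem hΩ i).subset_ball_lt 0 0
  let b : ContDiffBump (0 : E d) := ⟨R, R + 1, hR, by linarith⟩
  have hb : ContDiff ℝ 1 (fun y => (b y : ℂ)) := Complex.ofRealCLM.contDiff.comp b.contDiff
  have hb1 : ∀ y ∈ Metric.ball (0 : E d) R, b y = 1 := fun y hy =>
    b.one_of_mem_closedBall (Metric.ball_subset_closedBall hy)
  have hbc : HasCompactSupport (fun y => (b y : ℂ)) :=
    b.hasCompactSupport.comp_left (g := fun t : ℝ => (t : ℂ)) Complex.ofReal_zero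
  have := M.greenOn_of_hasCompactSupport hd hΩ i (hb.mul hφ) hbc.mul_right v
  unfold GreenOn at this ⊢
  rw [M.bdInt_congr (g := fun e y => b y * φ y * (inner ℝ v (M.normal i e) : ℝ)), ← this]
  · refine setIntegral_congr_fun (M.elem_open i).measurableSet fun y hy => ?_
    have hy' := hsub (subset_closure hy)
    have heq : φ =ᶠ[𝓝 y] fun y => (b y : ℂ) * φ y := by
      filter_upwards [Metric.isOpen_ball.mem_nhds hy'] with z hz
      simp [hb1 z hz]
    beta_reduce
    rw [heq.fderiv_eq]
  · intro e he y hy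
    have hy' := hsub (frontier_subset_closure (M.mem_faces.1 he hy))
    simp [hb1 y hy']

theorem green_pd (hd : d = 2 ∨ d = 3) (hΩ : Bornology.IsBounded Ω) (i : ι)
    {φ : E d → ℂ} (hφ : ContDiff ℝ 1 φ) (j : Fin d) :
    ∫ y, pd j φ y ∂(M.vol i) = M.bdInt i (fun e y => φ y * cvec (M.normal i e) j) := by
  have := M.green hd hΩ i hφ (EuclideanSpace.single j 1)
  simpa [GreenOn, EuclideanSpace.inner_single_left, pd, vol, cvec] using this

/-! ### Integration by parts for functions with a trace -/

theorem memLp_vol_of_continuous (hΩ : Bornology.IsBounded Ω) (i : ι)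
    {φ : E d → ℂ} (hφ : Continuous φ) : MemLp φ 2 (M.vol i) := by
  obtain ⟨C, hC⟩ := (M.isBounded_closure_elem hΩ i).isCompact_closure.exists_bound_of_continuousOn
    hφ.continuousOn
  have : IsFiniteMeasure (M.vol i) := ⟨by
    rw [vol, Measure.restrict_apply_univ]
    exact ((M.isBounded_closure_elem hΩ i).subset subset_closure).measure_lt_top⟩
  refine MemLp.of_bound hφ.aestronglyMeasurable C ?_
  filter_upwards [ae_restrict_mem (M.elem_open i).measurableSet] with x hx
  exact hC x (subset_closure (subset_closure hx))

theorem memLp_surf_of_continuous (hd : 2 ≤ d) (hΩ : Bornology.IsBounded Ω) (e : κ)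
    {φ : E d → ℂ} (hφ : Continuous φ) : MemLp φ 2 (M.surf e) := by
  have := M.surf_lt_top hd hΩ e
  obtain ⟨C, hC⟩ := (M.isBounded_face hΩ e).isCompact_closure.exists_bound_of_continuousOn
    hφ.continuousOn
  refine MemLp.of_bound hφ.aestronglyMeasurable C ?_
  filter_upwards [ae_restrict_mem (M.measurableSet_face e)] with x hx
  exact hC x (subset_closure hx)

theorem pd_mul {f g : E d → ℂ} (hf : ContDiff ℝ 1 f) (hg : ContDiff ℝ 1 g) (j : Fin d) (y : E d) :
    pd j (fun y => f y * g y) y = pd j f y * g y + f y * pd j g y := by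
  unfold pd
  rw [fderiv_fun_mul (hf.differentiable one_ne_zero y) (hg.differentiable one_ne_zero y)]
  simp
  ring

theorem continuous_pd {f : E d → ℂ} (hf : ContDiff ℝ 1 f) (j : Fin d) : Continuous (pd j f) :=
  (hf.continuous_fderiv one_ne_zero).clm_apply continuous_const

/-- Integration by parts on an element for functions with a trace. -/
theorem HasTrace.integral_by_parts (hd : d = 2 ∨ d = 3) (hΩ : Bornology.IsBounded Ω) {i : ι}
    {f g : E d → ℂ} (h : M.HasTrace i f g) :
    ∃ G : Fin d → E d → ℂ, (∀ j, MemLp (G j) 2 (M.vol i)) ∧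
      ∀ ψ : E d → ℂ, ContDiff ℝ 1 ψ → ∀ j,
        ∫ y, G j y * ψ y ∂(M.vol i) + ∫ y, f y * pd j ψ y ∂(M.vol i) =
          M.bdInt i (fun e y => g y * (ψ y * cvec (M.normal i e) j)) := by
  have hd2 : 2 ≤ d := by omega
  obtain ⟨hf, hg, G, φ, hG, hφ, hφf, hφG, hφg⟩ := h
  refine ⟨G, hG, fun ψ hψ j => ?_⟩
  have hφ1 : ∀ n, ContDiff ℝ 1 (φ n) := fun n => (hφ n).of_le (by exact_mod_cast le_top)
  have h1 := tendsto_integral_mul_of_eLpNorm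
    (fun n => M.memLp_vol_of_continuous hΩ i (continuous_pd (hφ1 n) j)) (hG j)
    (M.memLp_vol_of_continuous hΩ i hψ.continuous) (hφG j)
  have h2 := tendsto_integral_mul_of_eLpNorm
    (fun n => M.memLp_vol_of_continuous hΩ i (hφ1 n).continuous) hf
    (M.memLp_vol_of_continuous hΩ i (continuous_pd hψ j)) hφf
  have h3 : Tendsto (fun n => M.bdInt i (fun e y => φ n y * (ψ y * cvec (M.normal i e) j))) atTop
      (𝓝 (M.bdInt i (fun e y => g y * (ψ y * cvec (M.normal i e) j)))) :=
    tendsto_finsetSum _ fun e he => tendsto_integral_mul_of_eLpNorm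
      (fun n => M.memLp_surf_of_continuous hd2 hΩ e (hφ1 n).continuous) (hg e he)
      (M.memLp_surf_of_continuous hd2 hΩ e (hψ.continuous.mul continuous_const)) (hφg e he)
  refine tendsto_nhds_unique ((h1.add h2).congr fun n => ?_) h3
  -- Each smooth approximant satisfies the product form of the divergence theorem; every term is a
  -- pairing that is continuous under the L² convergences in the definition of the trace.
  have := M.green_pd hd hΩ i ((hφ1 n).mul hψ) j
  simp only [pd_mul (hφ1 n) hψ, mul_assoc] at this
  rw [← this, integral_add]
  · exact M.integrable_vol_of_continuous hΩ i
      ((continuous_pd (hφ1 n) j).mul hψ.continuous)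
  · exact M.integrable_vol_of_continuous hΩ i
      ((hφ1 n).continuous.mul (continuous_pd hψ j))

end Mesh

/-! ### Elements adjacent to a face, and jumps across it -/

namespace Mesh

variable {d : ℕ} {Ω : Set (E d)} {ι κ : Type*} [Fintype ι] [Fintype κ] (M : Mesh d Ω ι κ)

/-- Both are unit vectors spanning the orthogonal complement of the direction of the face. -/
theorem normal_eq_or_neg (hd : 2 ≤ d) {i j : ι} {e : κ} (hi : e ∈ M.faces i) (hj : e ∈ M.faces j) :
    M.normal j e = M.normal i e ∨ M.normal j e = -M.normal i e := by
  have h : (ℝ ∙ M.normal i e)ᗮ = (ℝ ∙ M.normal j e)ᗮ := by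
    rw [← M.direction_face hi hd, M.direction_face hj hd]
  have h2 : (ℝ ∙ M.normal i e) = ℝ ∙ M.normal j e := by
    rw [← Submodule.orthogonal_orthogonal (ℝ ∙ M.normal i e), h, Submodule.orthogonal_orthogonal]
  have hmem : M.normal j e ∈ (ℝ ∙ M.normal i e) := h2 ▸ Submodule.mem_span_singleton_self _
  obtain ⟨c, hc⟩ := Submodule.mem_span_singleton.1 hmem
  have h1 := M.normal_unit j e (M.mem_faces.1 hj)
  rw [← hc, norm_smul, M.normal_unit i e (M.mem_faces.1 hi), mul_one, Real.norm_eq_abs] at h1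
  rcases eq_or_eq_neg_of_abs_eq h1 with rfl | rfl
  · left; simpa using hc.symm
  · right; simpa using hc.symm

/-- With equal normals the points x - t n for small t > 0 would belong to two disjoint elements. -/
theorem normal_neg_of_ne (hd : 2 ≤ d) {i j : ι} {e : κ} (hi : e ∈ M.faces i) (hj : e ∈ M.faces j)
    (hij : i ≠ j) : M.normal j e = -M.normal i e := by
  refine (M.normal_eq_or_neg hd hi hj).resolve_left fun h => ?_
  obtain ⟨x, hx⟩ := M.face_nonempty hd e
  obtain ⟨r, hr, hT⟩ := M.normal_outward i e (M.mem_faces.1 hi) x hx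
  obtain ⟨r', hr', hT'⟩ := M.normal_outward j e (M.mem_faces.1 hj) x hx
  have hn := M.normal_unit i e (M.mem_faces.1 hi)
  have hm : 0 < min r r' := lt_min hr hr'
  set y := x - (min r r' / 2) • M.normal i e with hy
  have hdist : dist y x = min r r' / 2 := by
    rw [dist_eq_norm, hy]
    simp [norm_smul, hn, abs_of_pos hm]
  have hin : inner ℝ (y - x) (M.normal i e) < 0 := by
    rw [hy]
    simp [inner_smul_left, hn, hm]
  have hyi := (hT y (by rw [Metric.mem_ball, hdist]; linarith [min_le_left r r'])).2 hin
  have hyj := (hT' y (by rw [Metric.mem_ball, hdist]; linarith [min_le_right r r'])).2 (h ▸ hin)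
  exact Set.disjoint_left.1 (M.elem_disjoint hij) hyi hyj

open Classical in
/-- The elements that have the face `e` on their boundary. -/
noncomputable def owners (e : κ) : Finset ι := Finset.univ.filter fun i => e ∈ M.faces i

theorem mem_owners {i : ι} {e : κ} : i ∈ M.owners e ↔ e ∈ M.faces i := by simp [owners]

/-- A third element would have a normal opposite to each of two opposite vectors, forcing the unit
normal to be zero. -/
theorem owners_eq_pair [DecidableEq ι] (hd : 2 ≤ d) {i j : ι} {e : κ} (hi : e ∈ M.faces i)
    (hj : e ∈ M.faces j) (hij : i ≠ j) : M.owners e = {i, j} := by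
  ext l
  rw [mem_owners, Finset.mem_insert, Finset.mem_singleton]
  constructor
  · intro hl
    by_contra h
    push Not at h
    have h1 := M.normal_neg_of_ne hd hi hj hij
    have h2 := M.normal_neg_of_ne hd hi hl (Ne.symm h.1)
    have h3 := M.normal_neg_of_ne hd hj hl (Ne.symm h.2)
    have hn := M.normal_unit i e (M.mem_faces.1 hi)
    rw [h1, h2, neg_neg, neg_eq_iff_add_eq_zero, ← two_smul ℝ] at h3
    rw [smul_eq_zero] at h3
    rcases h3 with h3 | h3
    · norm_num at h3
    · rw [h3] at hn; simp at hn
  · rintro (rfl | rfl) <;> assumption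

/-- Two elements on opposite sides, together with the face, fill a ball around a face point. That
point would then be interior to the closure of Ω, hence in Ω by regularity, although it lies on the
boundary. -/
theorem owners_eq_singleton (hd : 2 ≤ d) (hΩ_open : IsOpen Ω) (hΩ_reg : interior (closure Ω) = Ω)
    {i : ι} {e : κ} (hi : e ∈ M.faces i) (he : M.face e ⊆ frontier Ω) : M.owners e = {i} := by
  classical
  by_contra hne
  obtain ⟨j, hj, hij⟩ : ∃ j, e ∈ M.faces j ∧ i ≠ j := by
    by_contra h
    push Not at h
    apply hne
    ext l
    rw [mem_owners, Finset.mem_singleton]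
    exact ⟨fun hl => (h l hl).symm, fun hl => hl ▸ hi⟩
  obtain ⟨x, hx⟩ := M.face_nonempty hd e
  obtain ⟨r, hr, hT⟩ := M.exists_face_chart hi hd hx
  obtain ⟨r', hr', hT'⟩ := M.exists_face_chart hj hd hx
  have hxf := he hx
  rw [hΩ_open.frontier_eq, ← hΩ_reg] at hxf
  rw [hΩ_reg] at hxf
  apply hxf.2
  refine hΩ_reg.le (mem_interior.2 ⟨Metric.ball x (min r r'), fun y hy => ?_, Metric.isOpen_ball,
    Metric.mem_ball_self (lt_min hr hr')⟩)
  have hcl : ∀ l, closure (M.elem l) ⊆ closure Ω := fun l =>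
    (Set.subset_iUnion (fun i => closure (M.elem i)) l).trans M.elem_cover.le
  have h1 := hT y (Metric.ball_subset_ball (min_le_left _ _) hy)
  have h2 := hT' y (Metric.ball_subset_ball (min_le_right _ _) hy)
  rw [M.normal_neg_of_ne hd hi hj hij, inner_neg_right] at h2
  rcases lt_trichotomy (inner ℝ (y - x) (M.normal i e)) 0 with h | h | h
  · exact hcl i (subset_closure (h1.1.2 h))
  · exact hcl i (frontier_subset_closure (M.mem_faces.1 hi (h1.2.1.2 h)))
  · exact hcl j (subset_closure (h2.1.2 (by linarith)))

/-- The union of all faces other than `e`. -/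
def otherFaces (e : κ) : Set (E d) := ⋃ f ∈ {f | f ≠ e}, closure (M.face f)

theorem isClosed_otherFaces (e : κ) : IsClosed (M.otherFaces e) :=
  (Set.toFinite _).isClosed_biUnion fun _ _ => isClosed_closure

/-- A face with the same affine span, being disjoint from e, can meet e only in its relative
boundary. A face with another span meets that of e, if at all, in an affine subspace of dimension
below d - 1. -/
theorem surf_otherFaces (hd : 2 ≤ d) (e : κ) : M.surf e (M.otherFaces e) = 0 := by
  refine (measure_biUnion_null_iff (Set.to_countable _)).2 fun f hf => ?_
  rw [surf, Measure.restrict_apply isClosed_closure.measurableSet]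
  obtain ⟨T, hT, hcov⟩ := M.exists_relBoundary_cover f
  have hcl : closure (M.face f) ⊆ affineSpan ℝ (M.face f) :=
    closure_minimal (subset_affineSpan ℝ _) (AffineSubspace.closed_of_finiteDimensional _)
  by_cases hA : affineSpan ℝ (M.face f) = affineSpan ℝ (M.face e)
  · refine measure_mono_null (t := ⋃ t ∈ T, convexHull ℝ (t : Set (E d))) ?_ ?_
    · rintro x ⟨hxf, hxe⟩
      exact hcov ⟨hxf, fun h => Set.disjoint_left.1 (M.face_disjoint hf) h hxe⟩
    · refine (measure_biUnion_null_iff (Finset.countable_toSet _)).2 fun t ht => ?_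
      exact euclideanHausdorff_convexHull_eq_zero (by have := hT t ht; omega)
  · rcases (closure (M.face f) ∩ M.face e).eq_empty_or_nonempty with hemp | ⟨p, hpf, hpe⟩
    · rw [hemp]; simp
    refine measure_mono_null (t := ((affineSpan ℝ (M.face f) ⊓ affineSpan ℝ (M.face e) :
      AffineSubspace ℝ (E d)) : Set (E d)))
      (fun x hx => ⟨hcl hx.1, subset_affineSpan ℝ _ hx.2⟩) ?_
    apply euclideanHausdorff_affineSubspace_eq_zero
    have hpf' : p ∈ affineSpan ℝ (M.face f) := hcl hpf
    have hpe' : p ∈ affineSpan ℝ (M.face e) := subset_affineSpan ℝ _ hpe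
    rw [AffineSubspace.direction_inf_of_mem hpf' hpe']
    have h1 := M.face_dim e
    have h2 := M.face_dim f
    by_contra hlt
    push Not at hlt
    apply hA
    refine AffineSubspace.ext_of_direction_eq ?_ ⟨p, hpf', hpe'⟩
    have e1 := Submodule.eq_of_le_of_finrank_le
      (inf_le_left : (affineSpan ℝ (M.face f)).direction ⊓ (affineSpan ℝ (M.face e)).direction ≤ _)
      (by omega)
    have e2 := Submodule.eq_of_le_of_finrank_le
      (inf_le_right : (affineSpan ℝ (M.face f)).direction ⊓ (affineSpan ℝ (M.face e)).direction ≤ _)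
      (by omega)
    exact e1.symm.trans e2

/-- Take a point of the face that lies on no other closed face. Just outside the element there are
points of Ω, which are covered by the closures of the other elements, so the chosen point is in the
closure of some element j. It lies on the frontier of j, hence on a closed face of j, and by its
choice this face is e. -/
theorem exists_owners_eq_pair [DecidableEq ι] (hd : 2 ≤ d) (hΩ_open : IsOpen Ω)
    {i : ι} {e : κ} (hi : e ∈ M.faces i) (he : M.face e ⊆ Ω) :
    ∃ j, i ≠ j ∧ e ∈ M.faces j ∧ M.owners e = {i, j} := by
  suffices ∃ j, i ≠ j ∧ e ∈ M.faces j by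
    obtain ⟨j, hij, hj⟩ := this
    exact ⟨j, hij, hj, M.owners_eq_pair hd hi hj hij⟩
  obtain ⟨x, hx, hxS⟩ : ∃ x ∈ M.face e, x ∉ M.otherFaces e := by
    by_contra! hall
    obtain ⟨x, hx⟩ := M.face_nonempty hd e
    have h1 := M.surf_ball_pos hd hx one_pos
    have h2 : M.surf e (Metric.ball x 1) ≤ M.surf e (M.otherFaces e) := by
      rw [surf, Measure.restrict_apply Metric.isOpen_ball.measurableSet,
        Measure.restrict_apply (M.isClosed_otherFaces e).measurableSet]
      exact measure_mono fun y hy => ⟨hall y hy.2, hy.2⟩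
    rw [M.surf_otherFaces hd] at h2
    exact absurd h1 (not_lt.2 h2)
  obtain ⟨r, hr, hT⟩ := M.normal_outward i e (M.mem_faces.1 hi) x hx
  have hn := M.normal_unit i e (M.mem_faces.1 hi)
  have hc : Continuous fun y : E d => inner ℝ (y - x) (M.normal i e) := by fun_prop
  set H : Set (E d) := {y | 0 < inner ℝ (y - x) (M.normal i e)} ∩ (Metric.ball x r ∩ Ω) with hH
  have hHo : IsOpen H :=
    (isOpen_lt continuous_const hc).inter (Metric.isOpen_ball.inter hΩ_open)
  have hHi : Disjoint H (closure (M.elem i)) := by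
    refine Disjoint.closure_right (Set.disjoint_left.2 fun y hy hyT => ?_) hHo
    exact lt_asymm hy.1 ((hT y hy.2.1).1 hyT)
  have hxH : x ∈ closure H := by
    rw [Metric.mem_closure_iff]
    intro δ hδ
    obtain ⟨r', hr', hΩ'⟩ := Metric.isOpen_iff.1 hΩ_open x (he hx)
    have hm : 0 < min δ (min r r') := lt_min hδ (lt_min hr hr')
    refine ⟨x + (min δ (min r r') / 2) • M.normal i e, ?_, ?_⟩
    · have hdist : dist (x + (min δ (min r r') / 2) • M.normal i e) x = min δ (min r r') / 2 := by
        rw [dist_eq_norm]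
        simp [norm_smul, hn, abs_of_pos hm]
      have h1 : min δ (min r r') ≤ r := (min_le_right _ _).trans (min_le_left _ _)
      have h2 : min δ (min r r') ≤ r' := (min_le_right _ _).trans (min_le_right _ _)
      refine ⟨?_, ?_, hΩ' ?_⟩
      · simp [inner_smul_left, hn, hm]
      · rw [Metric.mem_ball, hdist]; linarith
      · rw [Metric.mem_ball, hdist]; linarith
    · rw [dist_comm, dist_eq_norm]
      simp only [add_sub_cancel_left, norm_smul, hn, mul_one, Real.norm_eq_abs]
      rw [abs_of_pos (by linarith)]
      linarith [min_le_left δ (min r r')]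
  have hsub : closure H ⊆ ⋃ j ∈ {j | j ≠ i}, closure (M.elem j) := by
    refine closure_minimal (fun y hy => ?_)
      ((Set.toFinite _).isClosed_biUnion fun _ _ => isClosed_closure)
    have hyΩ : y ∈ closure Ω := subset_closure hy.2.2
    rw [← M.elem_cover] at hyΩ
    obtain ⟨j, hj⟩ := Set.mem_iUnion.1 hyΩ
    refine Set.mem_iUnion₂.2 ⟨j, ?_, hj⟩
    rintro rfl
    exact Set.disjoint_left.1 hHi hy hj
  obtain ⟨j, hji, hxj⟩ := Set.mem_iUnion₂.1 (hsub hxH)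
  refine ⟨j, Ne.symm hji, ?_⟩
  have hxf : x ∈ frontier (M.elem j) := by
    rw [(M.elem_open j).frontier_eq]
    refine ⟨hxj, fun hxT => ?_⟩
    have hxi : x ∈ closure (M.elem i) := frontier_subset_closure (M.mem_faces.1 hi hx)
    obtain ⟨z, hz, hz'⟩ := mem_closure_iff.1 hxi _ (M.elem_open j) hxT
    exact Set.disjoint_left.1 (M.elem_disjoint hji) hz hz'
  rw [M.frontier_elem j] at hxf
  obtain ⟨f, hf, hxf⟩ := Set.mem_iUnion₂.1 hxf
  by_cases hfe : f = e
  · exact hfe ▸ M.mem_faces.2 hf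
  · exact absurd (Set.mem_iUnion₂.2 ⟨f, hfe, hxf⟩) hxS

theorem sum_bdInt (g : ι → κ → E d → ℂ) :
    ∑ i, M.bdInt i (g i) = ∑ e, ∑ i ∈ M.owners e, ∫ x, g i e x ∂(M.surf e) := by
  simp only [bdInt]
  exact Finset.sum_comm' fun i e => by simp [mem_owners]

theorem sum_bdInt_eq_single {e : κ} (g : ι → κ → E d → ℂ)
    (hg : ∀ i f, f ≠ e → ∀ x ∈ M.face f, g i f x = 0) :
    ∑ i, M.bdInt i (g i) = ∑ i ∈ M.owners e, ∫ x, g i e x ∂(M.surf e) := by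
  rw [sum_bdInt]
  refine Finset.sum_eq_single e (fun f _ hf => Finset.sum_eq_zero fun i _ => ?_) (by simp)
  exact (setIntegral_congr_fun (M.measurableSet_face f) fun y hy => hg i f hf y hy).trans
    (integral_zero _ _)

theorem IsTest_eq_zero_of_mem_otherFaces {e f : κ} (hf : f ≠ e) {V : Set (E d)} {η : E d → ℂ}
    (hη : IsTest (V ∩ (M.otherFaces e)ᶜ) η) {x : E d} (hx : x ∈ M.face f) : η x = 0 := by
  by_contra h
  exact (hη.2.2 (subset_tsupport _ h)).2 (Set.mem_iUnion₂.2 ⟨f, hf, subset_closure hx⟩)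

/-- The fundamental lemma of the calculus of variations for the surface measure. Test functions that
avoid all other faces isolate e, and the part of e removed in this way is null. V is Ω if only test
functions vanishing near Γ are available, and the whole space otherwise. -/
theorem jump_eq_zero (hd : 2 ≤ d) {e : κ} {g : ι → E d → ℂ}
    (hg : ∀ i, e ∈ M.faces i → Integrable (g i) (M.surf e)) {V : Set (E d)} (hV : IsOpen V)
    (heV : M.face e ⊆ V)
    (h : ∀ η, IsTest (V ∩ (M.otherFaces e)ᶜ) η →
      ∑ i ∈ M.owners e, ∫ x, g i x * η x ∂(M.surf e) = 0) :
    ∀ᵐ x ∂(M.surf e), ∑ i ∈ M.owners e, g i x = 0 := by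
  have hint : Integrable (fun x => ∑ i ∈ M.owners e, g i x) (M.surf e) :=
    integrable_finsetSum _ fun i hi => hg i (M.mem_owners.1 hi)
  have key := (hV.inter (M.isClosed_otherFaces e).isOpen_compl).ae_eq_zero_of_integral_contDiff_smul_eq_zero
    (μ := M.surf e) (f := fun x => ∑ i ∈ M.owners e, g i x)
    (hint.locallyIntegrable.locallyIntegrableOn _) (fun η hη hηc hηs => by
      have hη' : IsTest (V ∩ (M.otherFaces e)ᶜ) (fun x => (η x : ℂ)) := by
        refine ⟨Complex.ofRealCLM.contDiff.comp hη,
          hηc.comp_left (g := fun t : ℝ => (t : ℂ)) Complex.ofReal_zero, ?_⟩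
        refine (closure_mono fun y hy => ?_).trans hηs
        simpa using hy
      rw [← h _ hη', ← integral_finsetSum]
      · refine integral_congr_ae (Eventually.of_forall fun x => ?_)
        simp [Finset.mul_sum, mul_comm]
      · intro i hi
        obtain ⟨C, hC⟩ := hηc.exists_bound_of_continuous hη.continuous
        refine (hg i (M.mem_owners.1 hi)).mul_bdd (c := C)
          (Complex.continuous_ofReal.comp hη.continuous).aestronglyMeasurable
          (Eventually.of_forall fun x => by simpa using hC x))
  have hnull : ∀ᵐ x ∂(M.surf e), x ∉ M.otherFaces e :=
    measure_eq_zero_iff_ae_notMem.1 (M.surf_otherFaces hd e)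
  filter_upwards [key, hnull, ae_restrict_mem (M.measurableSet_face e)] with x h1 h2 h3
  exact h1 ⟨heV h3, h2⟩

end Mesh

/-! ### Polynomial functions and representation of functionals -/

section Polynomials

variable {d : ℕ}

theorem contDiff_ev (P : MvPolynomial (Fin d) ℂ) {n : WithTop ℕ∞} : ContDiff ℝ n (ev P) := by
  have hcoord : ∀ i : Fin d, ContDiff ℝ n (fun x : E d => ((x i : ℝ) : ℂ)) := fun i =>
    Complex.ofRealCLM.contDiff.comp
      (EuclideanSpace.proj i : EuclideanSpace ℝ (Fin d) →L[ℝ] ℝ).contDiff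
  induction P using MvPolynomial.induction_on with
  | C a =>
    have h : ev (MvPolynomial.C a : MvPolynomial (Fin d) ℂ) = fun _ => a := by ext x; simp [ev]
    rw [h]; exact contDiff_const
  | add p q hp hq =>
    have h : ev (p + q) = fun x => ev p x + ev q x := by ext x; simp [ev]
    rw [h]; exact hp.add hq
  | mul_X p i hp =>
    have h : ev (p * MvPolynomial.X i) = fun x => ev p x * ((x i : ℝ) : ℂ) := by ext x; simp [ev]
    rw [h]; exact hp.mul (hcoord i)

theorem continuous_ev (P : MvPolynomial (Fin d) ℂ) : Continuous (ev P) :=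
  (contDiff_ev P (n := 0)).continuous

theorem ev_zero (x : E d) : ev (0 : MvPolynomial (Fin d) ℂ) x = 0 := by simp [ev]
theorem ev_add (P Q : MvPolynomial (Fin d) ℂ) (x : E d) : ev (P + Q) x = ev P x + ev Q x := by
  simp [ev]
theorem ev_sub (P Q : MvPolynomial (Fin d) ℂ) (x : E d) : ev (P - Q) x = ev P x - ev Q x := by
  simp [ev]
theorem ev_mul (P Q : MvPolynomial (Fin d) ℂ) (x : E d) : ev (P * Q) x = ev P x * ev Q x := by
  simp [ev]
theorem ev_smul (c : ℂ) (P : MvPolynomial (Fin d) ℂ) (x : E d) : ev (c • P) x = c * ev P x := by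
  simp [ev, MvPolynomial.smul_eval]
theorem ev_sum {α : Type*} (s : Finset α) (P : α → MvPolynomial (Fin d) ℂ) (x : E d) :
    ev (∑ a ∈ s, P a) x = ∑ a ∈ s, ev (P a) x := by
  simp [ev, map_sum]

theorem ev_conj (P : MvPolynomial (Fin d) ℂ) (x : E d) :
    ev (MvPolynomial.map (starRingEnd ℂ) P) x = starRingEnd ℂ (ev P x) := by
  induction P using MvPolynomial.induction_on with
  | C a => simp [ev]
  | add p q hp hq => rw [map_add, ev_add, ev_add, hp, hq, map_add]
  | mul_X p i hp => rw [map_mul, ev_mul, ev_mul, hp, map_mul]; simp [ev]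

theorem totalDegree_conj_le (P : MvPolynomial (Fin d) ℂ) :
    (MvPolynomial.map (starRingEnd ℂ) P).totalDegree ≤ P.totalDegree :=
  Finset.sup_mono (MvPolynomial.support_map_subset _ _)

theorem pd_ev (P : MvPolynomial (Fin d) ℂ) (j : Fin d) (x : E d) :
    pd j (ev P) x = ev (MvPolynomial.pderiv j P) x := by
  induction P using MvPolynomial.induction_on with
  | C a =>
    have h : ev (MvPolynomial.C a : MvPolynomial (Fin d) ℂ) = fun _ => a := by ext x; simp [ev]
    simp [pd, h, ev]
  | add p q hp hq =>
    have h : ev (p + q) = fun x => ev p x + ev q x := by ext x; simp [ev]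
    rw [map_add, ev_add, ← hp, ← hq, pd, h, fderiv_fun_add]
    · rfl
    · exact (contDiff_ev p (n := 1)).differentiable one_ne_zero x
    · exact (contDiff_ev q (n := 1)).differentiable one_ne_zero x
  | mul_X p i hp =>
    have h : ev (p * MvPolynomial.X i) = fun x => ev p x * ev (MvPolynomial.X i) x := by
      ext x; simp [ev]
    have hX : pd j (ev (MvPolynomial.X i : MvPolynomial (Fin d) ℂ)) x = if i = j then 1 else 0 := by
      have h2 : ev (MvPolynomial.X i : MvPolynomial (Fin d) ℂ) =
          ⇑(Complex.ofRealCLM.comp (EuclideanSpace.proj (𝕜 := ℝ) i)) := by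
        ext x; simp [ev]
      rw [pd, h2, ContinuousLinearMap.fderiv]
      by_cases hij : i = j
      · simp [hij]
      · simp [hij, PiLp.single_apply]
    rw [h, Mesh.pd_mul (contDiff_ev p) (contDiff_ev _), hX, hp, MvPolynomial.pderiv_mul, ev_add,
      ev_mul, ev_mul, MvPolynomial.pderiv_X]
    by_cases hij : i = j
    · subst hij; simp [ev]
    · simp [hij, ev]

theorem totalDegree_pderiv_le (P : MvPolynomial (Fin d) ℂ) (j : Fin d) :
    (MvPolynomial.pderiv j P).totalDegree ≤ P.totalDegree - 1 := by
  rw [← MvPolynomial.mem_restrictTotalDegree]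
  have hsum : MvPolynomial.pderiv j P = ∑ s ∈ P.support,
      MvPolynomial.pderiv j (MvPolynomial.monomial s (P.coeff s)) := by
    conv_lhs => rw [P.as_sum, map_sum]
  rw [hsum]
  refine Submodule.sum_mem _ fun s hs => ?_
  rw [MvPolynomial.pderiv_monomial]
  by_cases h0 : s j = 0
  · simp [h0]
  rw [MvPolynomial.mem_restrictTotalDegree]
  refine (MvPolynomial.totalDegree_monomial_le _ _).trans ?_
  have h1 : s = (s - Finsupp.single j 1) + Finsupp.single j 1 := by
    rw [tsub_add_cancel_of_le]
    rw [Finsupp.single_le_iff]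
    omega
  have h2 : (s.sum fun _ n => n) ≤ P.totalDegree := MvPolynomial.le_totalDegree hs
  rw [h1, Finsupp.sum_add_index' (fun _ => rfl) (fun _ _ _ => rfl),
    Finsupp.sum_single_index rfl] at h2
  change (s - Finsupp.single j 1).sum (fun _ n => n) ≤ _
  omega

end Polynomials

section Repr

variable {d N : ℕ}

/-- The pairing has no conjugation, so the test polynomials are the conjugates of the P j. They have
admissible degree and produce the integral of ∑ |P j|². -/
theorem ae_eq_zero_of_integral_ev_mul_eq_zero {m : Measure (E d)}
    (hm : ∀ f : E d → ℂ, Continuous f → Integrable f m) {r : ℕ}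
    {P : Fin N → MvPolynomial (Fin d) ℂ} (hP : ∀ j, (P j).totalDegree ≤ r)
    (h : ∀ φ : Fin N → MvPolynomial (Fin d) ℂ, (∀ j, (φ j).totalDegree ≤ r) →
      ∫ x, ∑ j, ev (P j) x * ev (φ j) x ∂m = 0) : ∀ᵐ x ∂m, ∀ j, ev (P j) x = 0 := by
  have h1 := h (fun j => MvPolynomial.map (starRingEnd ℂ) (P j))
    fun j => (totalDegree_conj_le _).trans (hP j)
  simp only [ev_conj, Complex.mul_conj] at h1
  have h2 : ∫ x, ∑ j, Complex.normSq (ev (P j) x) ∂m = 0 := by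
    have : ((∫ x, ∑ j, Complex.normSq (ev (P j) x) ∂m : ℝ) : ℂ) = 0 := by
      rw [← h1, ← integral_complex_ofReal]
      simp
    exact_mod_cast this
  have hint : Integrable (fun x => ∑ j, Complex.normSq (ev (P j) x)) m := by
    have hc : Continuous fun x => ((∑ j, Complex.normSq (ev (P j) x) : ℝ) : ℂ) :=
      Complex.continuous_ofReal.comp (continuous_finsetSum _ fun j _ =>
        Complex.continuous_normSq.comp (continuous_ev _))
    exact (hm _ hc).re
  rw [integral_eq_zero_iff_of_nonneg (fun x => Finset.sum_nonneg fun j _ => Complex.normSq_nonneg _)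
    hint] at h2
  filter_upwards [h2] with x hx j
  have := (Finset.sum_eq_zero_iff_of_nonneg fun j _ => Complex.normSq_nonneg _).1 hx j
    (Finset.mem_univ _)
  exact Complex.normSq_eq_zero.1 this

theorem integrable_sum_ev_mul {m : Measure (E d)}
    (hm : ∀ f : E d → ℂ, Continuous f → Integrable f m) (P φ : Fin N → MvPolynomial (Fin d) ℂ) :
    Integrable (fun x => ∑ j, ev (P j) x * ev (φ j) x) m :=
  hm _ (continuous_finsetSum _ fun j _ => (continuous_ev _).mul (continuous_ev _))

/-- The Gram form on polynomials of bounded degree may be degenerate: on a face, multiples of the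
equation of its hyperplane vanish. In finite dimension the range of the Gram map is the annihilator
of its coannihilator. That coannihilator consists of polynomials vanishing almost everywhere, where
ℓ is zero by `h0`. So the value of `polyRepr` is a true representative and not the default 0. -/
theorem exists_polyRepr {m : Measure (E d)} (hm : ∀ f : E d → ℂ, Continuous f → Integrable f m)
    (r : ℕ) {ℓ : (Fin N → MvPolynomial (Fin d) ℂ) → ℂ} (hℓ : IsLinearMap ℂ ℓ)
    (h0 : ∀ φ, (∀ᵐ x ∂m, ∀ j, ev (φ j) x = 0) → ℓ φ = 0) :
    ∃ P : Fin N → MvPolynomial (Fin d) ℂ, (∀ j, (P j).totalDegree ≤ r) ∧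
      (polyRepr m r ℓ = fun x j => ev (P j) x) ∧
      ∀ φ : Fin N → MvPolynomial (Fin d) ℂ, (∀ j, (φ j).totalDegree ≤ r) →
        ∫ x, ∑ j, ev (P j) x * ev (φ j) x ∂m = ℓ φ := by
  suffices h : ∃ P : Fin N → MvPolynomial (Fin d) ℂ, (∀ j, (P j).totalDegree ≤ r) ∧
      ∀ φ : Fin N → MvPolynomial (Fin d) ℂ, (∀ j, (φ j).totalDegree ≤ r) →
        ∫ x, ∑ j, ev (P j) x * ev (φ j) x ∂m = ℓ φ by
    refine ⟨h.choose, h.choose_spec.1, ?_, h.choose_spec.2⟩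
    rw [polyRepr, dif_pos h]
  let W := Fin N → MvPolynomial.restrictTotalDegree (Fin d) ℂ r
  let inc : W →ₗ[ℂ] (Fin N → MvPolynomial (Fin d) ℂ) :=
    LinearMap.pi fun j => (Submodule.subtype _).comp (LinearMap.proj j)
  have hinc : ∀ (w : W) j, inc w j = w j := fun w j => rfl
  have hdeg : ∀ (w : W) j, (inc w j).totalDegree ≤ r := fun w j =>
    (MvPolynomial.mem_restrictTotalDegree _ _ _).1 (w j).2
  have hsurj : ∀ φ : Fin N → MvPolynomial (Fin d) ℂ, (∀ j, (φ j).totalDegree ≤ r) →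
      ∃ w : W, inc w = φ := fun φ hφ =>
    ⟨fun j => ⟨φ j, (MvPolynomial.mem_restrictTotalDegree _ _ _).2 (hφ j)⟩, rfl⟩
  let B : W →ₗ[ℂ] W →ₗ[ℂ] ℂ := LinearMap.mk₂ ℂ
    (fun P φ => ∫ x, ∑ j, ev (inc P j) x * ev (inc φ j) x ∂m)
    (fun P Q φ => by
      rw [← integral_add (integrable_sum_ev_mul hm _ _) (integrable_sum_ev_mul hm _ _)]
      simp only [map_add, Pi.add_apply, ev_add, add_mul, Finset.sum_add_distrib])
    (fun c P φ => by
      rw [smul_eq_mul, ← integral_const_mul]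
      simp only [map_smul, Pi.smul_apply, ev_smul, mul_assoc, Finset.mul_sum])
    (fun P Q φ => by
      rw [← integral_add (integrable_sum_ev_mul hm _ _) (integrable_sum_ev_mul hm _ _)]
      simp only [map_add, Pi.add_apply, ev_add, mul_add, Finset.sum_add_distrib])
    (fun c P φ => by
      rw [smul_eq_mul, ← integral_const_mul]
      simp only [map_smul, Pi.smul_apply, ev_smul, mul_left_comm, Finset.mul_sum])
  have hB : ∀ P φ, B P φ = ∫ x, ∑ j, ev (inc P j) x * ev (inc φ j) x ∂m := fun _ _ => rfl
  let ℓ' : W →ₗ[ℂ] ℂ := (hℓ.mk' ℓ).comp inc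
  have hmem : ℓ' ∈ LinearMap.range B := by
    rw [← Subspace.dualCoannihilator_dualAnnihilator_eq (W := LinearMap.range B),
      Submodule.mem_dualAnnihilator]
    intro w hw
    rw [Submodule.mem_dualCoannihilator] at hw
    apply h0
    refine ae_eq_zero_of_integral_ev_mul_eq_zero hm (hdeg w) fun φ hφ => ?_
    obtain ⟨v, rfl⟩ := hsurj φ hφ
    have := hw (B v) ⟨v, rfl⟩
    rw [hB] at this
    rw [← this]
    simp only [mul_comm]
  obtain ⟨P, hP⟩ := hmem
  refine ⟨inc P, hdeg P, fun φ hφ => ?_⟩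
  obtain ⟨w, rfl⟩ := hsurj φ hφ
  rw [← hB, hP]
  rfl

theorem exists_projVec {m : Measure (E d)} (hm : ∀ f : E d → ℂ, Continuous f → Integrable f m)
    (r : ℕ) {f : E d → Fin N → ℂ}
    (hf : ∀ j, ∀ g : E d → ℂ, Continuous g → Integrable (fun x => f x j * g x) m) :
    ∃ P : Fin N → MvPolynomial (Fin d) ℂ, (∀ j, (P j).totalDegree ≤ r) ∧
      (projVec m r f = fun x j => ev (P j) x) ∧
      ∀ j, ∀ φ : MvPolynomial (Fin d) ℂ, φ.totalDegree ≤ r →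
        ∫ x, ev (P j) x * ev φ x ∂m = ∫ x, f x j * ev φ x ∂m := by
  have hint : ∀ φ : Fin N → MvPolynomial (Fin d) ℂ,
      Integrable (fun x => ∑ j, f x j * ev (φ j) x) m := fun φ =>
    integrable_finsetSum _ fun j _ => hf j _ (continuous_ev _)
  obtain ⟨P, hP, hPe, h⟩ := exists_polyRepr hm r
    (ℓ := fun φ => ∫ x, ∑ j, f x j * ev (φ j) x ∂m)
    ⟨fun φ ψ => by
      rw [← integral_add (hint _) (hint _)]
      simp only [Pi.add_apply, ev_add, mul_add, Finset.sum_add_distrib],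
     fun c φ => by
      rw [smul_eq_mul, ← integral_const_mul]
      simp only [Pi.smul_apply, ev_smul, mul_left_comm, Finset.mul_sum]⟩
    (fun φ hφ => integral_eq_zero_of_ae (by
      filter_upwards [hφ] with x hx
      simp [hx]))
  refine ⟨P, hP, hPe, fun j φ hφ => ?_⟩
  have := h (Pi.single j φ) (fun l => by
    by_cases hl : l = j
    · subst hl; simpa using hφ
    · simp [hl])
  have hsum : ∀ (F : Fin N → ℂ) (x : E d),
      ∑ l, F l * ev ((Pi.single j φ : Fin N → MvPolynomial (Fin d) ℂ) l) x = F j * ev φ x := by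
    intro F x
    rw [Finset.sum_eq_single j]
    · simp
    · intro l _ hl; simp [hl, ev_zero]
    · simp
  simpa only [hsum] using this

theorem exists_proj {m : Measure (E d)} (hm : ∀ f : E d → ℂ, Continuous f → Integrable f m)
    (r : ℕ) {f : E d → ℂ}
    (hf : ∀ g : E d → ℂ, Continuous g → Integrable (fun x => f x * g x) m) :
    ∃ P : MvPolynomial (Fin d) ℂ, P.totalDegree ≤ r ∧ (proj m r f = ev P) ∧
      ∀ φ : MvPolynomial (Fin d) ℂ, φ.totalDegree ≤ r →
        ∫ x, ev P x * ev φ x ∂m = ∫ x, f x * ev φ x ∂m := by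
  obtain ⟨P, hP, hPe, h⟩ := exists_projVec (N := 1) hm r (f := fun x _ => f x) (fun _ => hf)
  exact ⟨P 0, hP 0, by ext x; rw [proj, hPe], h 0⟩

end Repr

/-! ### Cross products and constant coefficients -/

section VectorFields

variable {d N : ℕ} {m : Measure (E d)}

theorem cross_add_left (a b c : Fin d → ℂ) : cross (a + b) c = cross a c + cross b c := by
  ext m
  simp only [cross, Pi.add_apply, mul_add, add_mul, Finset.sum_add_distrib]

theorem cross_smul_left (t : ℂ) (a c : Fin d → ℂ) : cross (t • a) c = t • cross a c := by
  ext m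
  simp only [cross, Pi.smul_apply, smul_eq_mul, Finset.mul_sum]
  exact Finset.sum_congr rfl fun i _ => Finset.sum_congr rfl fun j _ => by ring

/-- The map `a ↦ a × c`. -/
noncomputable def crossLin (c : Fin d → ℂ) : (Fin d → ℂ) →L[ℂ] (Fin (curlDim d) → ℂ) :=
  LinearMap.toContinuousLinearMap
    { toFun := fun a => cross a c
      map_add' := fun a b => cross_add_left a b c
      map_smul' := fun t a => cross_smul_left t a c }

theorem crossLin_apply (a c : Fin d → ℂ) : crossLin c a = cross a c := rfl

theorem cross_sub_left (a b c : Fin d → ℂ) : cross (a - b) c = cross a c - cross b c :=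
  (crossLin c).map_sub a b

theorem cross_neg_right (a c : Fin d → ℂ) : cross a (-c) = -cross a c := by
  ext m
  simp [cross]

theorem crossCoeff_swap (hd : d = 2 ∨ d = 3) (m : Fin (curlDim d)) (i j : Fin d) :
    crossCoeff d m j i = -crossCoeff d m i j := by
  unfold crossCoeff
  by_cases h : d = 2
  · simp [h]
  · have hd3 : d = 3 := by omega
    subst hd3
    have hm : (m : ℕ) < 3 := m.2
    simp only [h, if_false]
    split_ifs <;> first | omega | simp

theorem cross_self (hd : d = 2 ∨ d = 3) (c : Fin d → ℂ) : cross c c = 0 := by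
  ext m
  have h : cross c c m = -cross c c m := by
    conv_lhs => rw [cross, Finset.sum_comm]
    rw [cross, ← Finset.sum_neg_distrib]
    refine Finset.sum_congr rfl fun j _ => ?_
    rw [← Finset.sum_neg_distrib]
    refine Finset.sum_congr rfl fun i _ => ?_
    rw [crossCoeff_swap hd m j i]
    ring
  have := add_eq_zero_iff_eq_neg.2 h
  rw [← two_mul] at this
  simpa using this

theorem cvec_neg (n : E d) : cvec (-n) = -cvec n := by
  ext i; simp [cvec]

theorem cvec_dotProduct_cvec {n : E d} (hn : ‖n‖ = 1) : cvec n ⬝ᵥ cvec n = 1 := by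
  have h : ∑ i, n i * n i = 1 := by
    have := EuclideanSpace.real_norm_sq_eq n
    rw [hn] at this
    simpa [sq] using this.symm
  simp only [cvec, dotProduct]
  exact_mod_cast h

theorem rmul_add (A : Matrix (Fin N) (Fin N) ℝ) (a b : Fin N → ℂ) :
    rmul A (a + b) = rmul A a + rmul A b := Matrix.mulVec_add _ _ _

theorem rmul_sub (A : Matrix (Fin N) (Fin N) ℝ) (a b : Fin N → ℂ) :
    rmul A (a - b) = rmul A a - rmul A b := Matrix.mulVec_sub _ _ _

theorem rmul_smul (A : Matrix (Fin N) (Fin N) ℝ) (t : ℂ) (a : Fin N → ℂ) :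
    rmul A (t • a) = t • rmul A a := Matrix.mulVec_smul _ _ _

theorem rmul_apply (A : Matrix (Fin N) (Fin N) ℝ) (a : Fin N → ℂ) (i : Fin N) :
    rmul A a i = ∑ j, (A i j : ℂ) * a j := rfl

theorem rmul_dotProduct {A : Matrix (Fin N) (Fin N) ℝ} (hA : A.IsHermitian) (a b : Fin N → ℂ) :
    rmul A a ⬝ᵥ b = a ⬝ᵥ rmul A b := by
  have h : (A.map (fun t : ℝ => (t : ℂ)))ᵀ = A.map (fun t : ℝ => (t : ℂ)) := by
    ext i j
    have := hA.apply i j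
    simp only [star_trivial] at this
    simp [Matrix.transpose_apply, this]
  rw [rmul, rmul, Matrix.dotProduct_mulVec, ← Matrix.mulVec_transpose, h]

theorem memLp_rmul (A : Matrix (Fin N) (Fin N) ℝ) {f : E d → Fin N → ℂ} (hf : MemLp f 2 m) :
    MemLp (fun x => rmul A (f x)) 2 m :=
  (Matrix.mulVecLin (A.map (fun t : ℝ => (t : ℂ)))).toContinuousLinearMap.comp_memLp' hf

theorem memLp_cross {f : E d → Fin d → ℂ} (hf : MemLp f 2 m) (c : Fin d → ℂ) :
    MemLp (fun x => cross (f x) c) 2 m := (crossLin c).comp_memLp' hf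

theorem memLp_dotProduct_const {f : E d → Fin N → ℂ} (hf : MemLp f 2 m) (c : Fin N → ℂ) :
    MemLp (fun x => f x ⬝ᵥ c) 2 m := by
  simp only [dotProduct]
  exact memLp_finsetSum _ fun j _ => (hf.eval j).mul_const (c j)

theorem integrable_mul_of_memLp {f g : E d → ℂ} (hf : MemLp f 2 m) (hg : MemLp g 2 m) :
    Integrable (fun x => f x * g x) m := hf.integrable_mul hg

theorem integrable_dotProduct {f g : E d → Fin N → ℂ} (hf : MemLp f 2 m) (hg : MemLp g 2 m) :
    Integrable (fun x => f x ⬝ᵥ g x) m := by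
  simp only [dotProduct]
  exact integrable_finsetSum _ fun j _ => (hf.eval j).integrable_mul (hg.eval j)

end VectorFields

/-! ### Elementwise integration by parts for curl and divergence -/

namespace Mesh

variable {d : ℕ} {Ω : Set (E d)} {ι κ : Type*} [Fintype ι] [Fintype κ] (M : Mesh d Ω ι κ)

theorem bdInt_sum {α : Type*} (s : Finset α) {i : ι} {f : α → κ → E d → ℂ}
    (hf : ∀ a ∈ s, ∀ e ∈ M.faces i, Integrable (f a e) (M.surf e)) :
    M.bdInt i (fun e x => ∑ a ∈ s, f a e x) = ∑ a ∈ s, M.bdInt i (f a) := by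
  simp only [bdInt]
  rw [Finset.sum_comm]
  exact Finset.sum_congr rfl fun e he => integral_finsetSum _ fun a ha => hf a ha e he

theorem bdInt_const_mul {i : ι} (c : ℂ) (f : κ → E d → ℂ) :
    M.bdInt i (fun e x => c * f e x) = c * M.bdInt i f := by
  simp only [bdInt, integral_const_mul, Finset.mul_sum]

/-- `f` has on the element `i` the weak gradient `G` and on its boundary the trace `t`. -/
structure IsWeakDiff (i : ι) (f t : E d → ℂ) (G : Fin d → E d → ℂ) : Prop where
  memLp : MemLp f 2 (M.vol i)
  memLp_trace : ∀ e ∈ M.faces i, MemLp t 2 (M.surf e)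
  memLp_grad : ∀ j, MemLp (G j) 2 (M.vol i)
  by_parts : ∀ ψ : E d → ℂ, ContDiff ℝ 1 ψ → ∀ j,
    ∫ y, f y * pd j ψ y ∂(M.vol i) =
      M.bdInt i (fun e y => t y * (ψ y * cvec (M.normal i e) j)) - ∫ y, G j y * ψ y ∂(M.vol i)

theorem HasTrace.isWeakDiff (hd : d = 2 ∨ d = 3) (hΩ : Bornology.IsBounded Ω) {i : ι}
    {f g : E d → ℂ} (h : M.HasTrace i f g) : ∃ G, M.IsWeakDiff i f g G := by
  obtain ⟨G, hG, hib⟩ := HasTrace.integral_by_parts M hd hΩ h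
  exact ⟨G, h.1, h.2.1, hG, fun ψ hψ j => by rw [← hib ψ hψ j]; ring⟩

theorem MemH1.isWeakDiff (hd : d = 2 ∨ d = 3) (hΩ : Bornology.IsBounded Ω) {i : ι}
    {f : E d → ℂ} (h : M.MemH1 i f) : ∃ G, M.IsWeakDiff i f (M.trace i f) G := by
  rw [trace, dif_pos h]
  exact HasTrace.isWeakDiff M hd hΩ h.choose_spec

theorem isWeakDiff_of_contDiff (hd : d = 2 ∨ d = 3) (hΩ : Bornology.IsBounded Ω) (i : ι)
    {f : E d → ℂ} (hf : ContDiff ℝ 1 f) : M.IsWeakDiff i f f (fun j => pd j f) where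
  memLp := M.memLp_vol_of_continuous hΩ i hf.continuous
  memLp_trace e _ := M.memLp_surf_of_continuous (by omega) hΩ e hf.continuous
  memLp_grad j := M.memLp_vol_of_continuous hΩ i (continuous_pd hf j)
  by_parts ψ hψ j := by
    have := M.green_pd hd hΩ i (hf.mul hψ) j
    simp only [pd_mul hf hψ, mul_assoc] at this
    rw [← this, integral_add]
    · ring
    · exact M.integrable_vol_of_continuous hΩ i ((continuous_pd hf j).mul hψ.continuous)
    · exact M.integrable_vol_of_continuous hΩ i (hf.continuous.mul (continuous_pd hψ j))

theorem IsWeakDiff.sum (hd : d = 2 ∨ d = 3) (hΩ : Bornology.IsBounded Ω) {i : ι} {N : ℕ}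
    {f t : Fin N → E d → ℂ} {G : Fin N → Fin d → E d → ℂ}
    (h : ∀ l, M.IsWeakDiff i (f l) (t l) (G l)) (a : Fin N → ℂ) :
    M.IsWeakDiff i (fun y => ∑ l, a l * f l y) (fun y => ∑ l, a l * t l y)
      (fun j y => ∑ l, a l * G l j y) where
  memLp := memLp_finsetSum _ fun l _ => (h l).memLp.const_mul (a l)
  memLp_trace e he := memLp_finsetSum _ fun l _ => ((h l).memLp_trace e he).const_mul (a l)
  memLp_grad j := memLp_finsetSum _ fun l _ => ((h l).memLp_grad j).const_mul (a l)
  by_parts ψ hψ j := by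
    have hψv := M.memLp_vol_of_continuous hΩ i hψ.continuous
    have hψd := M.memLp_vol_of_continuous hΩ i (continuous_pd hψ j)
    simp only [Finset.sum_mul, mul_assoc]
    rw [integral_finsetSum _ fun l _ => (integrable_mul_of_memLp (h l).memLp hψd).const_mul (a l),
      integral_finsetSum _ fun l _ => (integrable_mul_of_memLp ((h l).memLp_grad j) hψv).const_mul (a l),
      M.bdInt_sum, ← Finset.sum_sub_distrib]
    · refine Finset.sum_congr rfl fun l _ => ?_
      rw [bdInt_const_mul]
      simp only [integral_const_mul]
      rw [(h l).by_parts ψ hψ j]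
      ring
    · exact fun l _ e he => (((h l).memLp_trace e he).integrable_mul
        (M.memLp_surf_of_continuous (by omega) hΩ e
          (hψ.continuous.mul continuous_const))).const_mul (a l)

/-- The vector field with components `f j` has the weak derivatives `G j` and the trace `t`. -/
def IsWeakDiffVec {N : ℕ} (i : ι) (f t : E d → Fin N → ℂ) (G : Fin N → Fin d → E d → ℂ) : Prop :=
  ∀ j, M.IsWeakDiff i (fun y => f y j) (fun y => t y j) (G j)

/-- The curl of a vector field with the derivatives `G`. -/
noncomputable def curlOf (G : Fin d → Fin d → E d → ℂ) (y : E d) : Fin (curlDim d) → ℂ :=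
  fun m => -∑ j, ∑ l, crossCoeff d m j l * G j l y

/-- The adjoint curl of a field with the derivatives `G`. -/
noncomputable def adjCurlOf (G : Fin (curlDim d) → Fin d → E d → ℂ) (y : E d) : Fin d → ℂ :=
  fun j => ∑ m, ∑ l, crossCoeff d m j l * G m l y

/-- The pairing that defines the weak curl of `{a, b}` on the element `i`. -/
noncomputable def curlPair (i : ι) (a : E d → Fin d → ℂ) (b : κ → E d → Fin d → ℂ)
    (ψ : E d → Fin (curlDim d) → ℂ) : ℂ :=
  ∫ y, a y ⬝ᵥ testCurl ψ y ∂(M.vol i) -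
    M.bdInt i (fun e y => cross (b e y) (cvec (M.normal i e)) ⬝ᵥ ψ y)

/-- The pairing that defines the weak divergence of `{a, b}` on the element `i`. -/
noncomputable def divPair (i : ι) (a : E d → Fin d → ℂ) (b : κ → E d → Fin d → ℂ)
    (φ : E d → ℂ) : ℂ :=
  -(∫ y, ∑ j, a y j * pd j φ y ∂(M.vol i)) +
    M.bdInt i (fun e y => (b e y ⬝ᵥ cvec (M.normal i e)) * φ y)

theorem IsWeakDiffVec.memLp {N : ℕ} {i : ι} {f t : E d → Fin N → ℂ}
    {G : Fin N → Fin d → E d → ℂ} (h : M.IsWeakDiffVec i f t G) : MemLp f 2 (M.vol i) :=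
  MemLp.of_eval fun j => (h j).memLp

theorem IsWeakDiffVec.memLp_trace {N : ℕ} {i : ι} {f t : E d → Fin N → ℂ}
    {G : Fin N → Fin d → E d → ℂ} (h : M.IsWeakDiffVec i f t G) {e : κ} (he : e ∈ M.faces i) :
    MemLp t 2 (M.surf e) :=
  MemLp.of_eval fun j => (h j).memLp_trace e he

theorem IsWeakDiffVec.memLp_curlOf {i : ι} {f t : E d → Fin d → ℂ}
    {G : Fin d → Fin d → E d → ℂ} (h : M.IsWeakDiffVec i f t G) :
    MemLp (curlOf G) 2 (M.vol i) :=
  MemLp.of_eval fun _ => (memLp_finsetSum _ fun j _ => memLp_finsetSum _ fun l _ =>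
    ((h j).memLp_grad l).const_mul _).neg

theorem IsWeakDiffVec.memLp_adjCurlOf {i : ι} {f t : E d → Fin (curlDim d) → ℂ}
    {G : Fin (curlDim d) → Fin d → E d → ℂ} (h : M.IsWeakDiffVec i f t G) :
    MemLp (adjCurlOf G) 2 (M.vol i) :=
  MemLp.of_eval fun _ => memLp_finsetSum _ fun m _ => memLp_finsetSum _ fun l _ =>
    ((h m).memLp_grad l).const_mul _

/-- Both sides expand with the coefficients `crossCoeff d m j l`, and ∂_l moves from ψ to component
j of the field. In this order of indices the sum is minus the curl, which explains the sign in
`curlOf`. -/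
theorem integral_curlOf (hd : d = 2 ∨ d = 3) (hΩ : Bornology.IsBounded Ω) {i : ι}
    {f t : E d → Fin d → ℂ} {G : Fin d → Fin d → E d → ℂ} (h : M.IsWeakDiffVec i f t G)
    {ψ : E d → Fin (curlDim d) → ℂ} (hψ : ∀ m, ContDiff ℝ 1 (fun y => ψ y m)) :
    ∫ y, curlOf G y ⬝ᵥ ψ y ∂(M.vol i) = M.curlPair i f (fun _ => t) ψ := by
  have hd2 : 2 ≤ d := by omega
  have hψv := fun m => M.memLp_vol_of_continuous hΩ i (hψ m).continuous
  have hψd := fun m l => M.memLp_vol_of_continuous hΩ i (continuous_pd (hψ m) l)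
  have hA : ∫ y, f y ⬝ᵥ testCurl ψ y ∂(M.vol i) =
      ∑ m, ∑ j, ∑ l, crossCoeff d m j l * ∫ y, f y j * pd l (fun y => ψ y m) y ∂(M.vol i) := by
    have : ∀ y, f y ⬝ᵥ testCurl ψ y =
        ∑ m, ∑ j, ∑ l, crossCoeff d m j l * (f y j * pd l (fun y => ψ y m) y) := by
      intro y
      simp only [dotProduct, testCurl, Finset.mul_sum]
      rw [Finset.sum_comm]
      exact Finset.sum_congr rfl fun _ _ => Finset.sum_congr rfl fun _ _ =>
        Finset.sum_congr rfl fun _ _ => by ring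
    have hint : ∀ m j l, Integrable
        (fun y => crossCoeff d m j l * (f y j * pd l (fun y => ψ y m) y)) (M.vol i) :=
      fun m j l => ((h j).memLp.integrable_mul (hψd m l)).const_mul _
    simp only [this]
    rw [integral_finsetSum _ fun m _ => integrable_finsetSum _ fun j _ =>
      integrable_finsetSum _ fun l _ => hint m j l]
    refine Finset.sum_congr rfl fun m _ => ?_
    rw [integral_finsetSum _ fun j _ => integrable_finsetSum _ fun l _ => hint m j l]
    refine Finset.sum_congr rfl fun j _ => ?_
    rw [integral_finsetSum _ fun l _ => hint m j l]
    exact Finset.sum_congr rfl fun l _ => integral_const_mul _ _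
  have hB : ∫ y, curlOf G y ⬝ᵥ ψ y ∂(M.vol i) =
      ∑ m, ∑ j, ∑ l, crossCoeff d m j l * -∫ y, G j l y * ψ y m ∂(M.vol i) := by
    have : ∀ y, curlOf G y ⬝ᵥ ψ y =
        ∑ m, ∑ j, ∑ l, crossCoeff d m j l * -(G j l y * ψ y m) := by
      intro y
      simp only [dotProduct, curlOf, neg_mul, Finset.sum_mul, ← Finset.sum_neg_distrib]
      exact Finset.sum_congr rfl fun _ _ => Finset.sum_congr rfl fun _ _ =>
        Finset.sum_congr rfl fun _ _ => by ring
    have hint : ∀ m j l, Integrable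
        (fun y => crossCoeff d m j l * -(G j l y * ψ y m)) (M.vol i) :=
      fun m j l => (((h j).memLp_grad l).integrable_mul (hψv m)).neg.const_mul _
    simp only [this]
    rw [integral_finsetSum _ fun m _ => integrable_finsetSum _ fun j _ =>
      integrable_finsetSum _ fun l _ => hint m j l]
    refine Finset.sum_congr rfl fun m _ => ?_
    rw [integral_finsetSum _ fun j _ => integrable_finsetSum _ fun l _ => hint m j l]
    refine Finset.sum_congr rfl fun j _ => ?_
    rw [integral_finsetSum _ fun l _ => hint m j l]
    exact Finset.sum_congr rfl fun l _ => by rw [integral_const_mul, integral_neg]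
  have hC : M.bdInt i (fun e y => cross (t y) (cvec (M.normal i e)) ⬝ᵥ ψ y) =
      ∑ m, ∑ j, ∑ l, crossCoeff d m j l *
        M.bdInt i (fun e y => t y j * (ψ y m * cvec (M.normal i e) l)) := by
    have : ∀ e y, cross (t y) (cvec (M.normal i e)) ⬝ᵥ ψ y =
        ∑ m, ∑ j, ∑ l, crossCoeff d m j l * (t y j * (ψ y m * cvec (M.normal i e) l)) := by
      intro e y
      simp only [dotProduct, cross, Finset.sum_mul]
      exact Finset.sum_congr rfl fun _ _ => Finset.sum_congr rfl fun _ _ =>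
        Finset.sum_congr rfl fun _ _ => by ring
    have hint : ∀ m j l, ∀ e ∈ M.faces i, Integrable
        (fun y => crossCoeff d m j l * (t y j * (ψ y m * cvec (M.normal i e) l))) (M.surf e) :=
      fun m j l e he => (((h j).memLp_trace e he).integrable_mul
        (M.memLp_surf_of_continuous hd2 hΩ e ((hψ m).continuous.mul continuous_const))).const_mul _
    simp only [this]
    rw [M.bdInt_sum _ fun m _ e he => integrable_finsetSum _ fun j _ =>
      integrable_finsetSum _ fun l _ => hint m j l e he]
    refine Finset.sum_congr rfl fun m _ => ?_
    rw [M.bdInt_sum _ fun j _ e he => integrable_finsetSum _ fun l _ => hint m j l e he]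
    refine Finset.sum_congr rfl fun j _ => ?_
    rw [M.bdInt_sum _ fun l _ e he => hint m j l e he]
    exact Finset.sum_congr rfl fun l _ => M.bdInt_const_mul _ _
  rw [curlPair, hA, hB, hC]
  simp only [← Finset.sum_sub_distrib, ← mul_sub]
  refine Finset.sum_congr rfl fun m _ => Finset.sum_congr rfl fun j _ =>
    Finset.sum_congr rfl fun l _ => ?_
  rw [(h j).by_parts _ (hψ m) l]
  ring

/-- Here the rough factor is c and the smooth one is v, so the derivatives move onto c; the adjoint
curl is the vector curl of a scalar when d = 2. -/
theorem integral_dotProduct_curl (hd : d = 2 ∨ d = 3) (hΩ : Bornology.IsBounded Ω) {i : ι}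
    {c t : E d → Fin (curlDim d) → ℂ} {G : Fin (curlDim d) → Fin d → E d → ℂ}
    (h : M.IsWeakDiffVec i c t G) {v : E d → Fin d → ℂ}
    (hv : ∀ j, ContDiff ℝ 1 (fun y => v y j)) :
    ∫ y, c y ⬝ᵥ curlOf (fun j l => pd l (fun z => v z j)) y ∂(M.vol i) =
      ∫ y, adjCurlOf G y ⬝ᵥ v y ∂(M.vol i) -
      M.bdInt i (fun e y => t y ⬝ᵥ cross (v y) (cvec (M.normal i e))) := by
  have hd2 : 2 ≤ d := by omega
  have hvv := fun j => M.memLp_vol_of_continuous hΩ i (hv j).continuous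
  have hvd := fun j l => M.memLp_vol_of_continuous hΩ i (continuous_pd (hv j) l)
  have hA : ∫ y, c y ⬝ᵥ curlOf (fun j l => pd l (fun z => v z j)) y ∂(M.vol i) =
      ∑ m, ∑ j, ∑ l, crossCoeff d m j l *
        -∫ y, c y m * pd l (fun y => v y j) y ∂(M.vol i) := by
    have : ∀ y, c y ⬝ᵥ curlOf (fun j l => pd l (fun z => v z j)) y =
        ∑ m, ∑ j, ∑ l, crossCoeff d m j l * -(c y m * pd l (fun y => v y j) y) := by
      intro y
      simp only [dotProduct, curlOf, Finset.mul_sum, mul_neg, ← Finset.sum_neg_distrib]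
      exact Finset.sum_congr rfl fun _ _ => Finset.sum_congr rfl fun _ _ =>
        Finset.sum_congr rfl fun _ _ => by ring
    have hint : ∀ m j l, Integrable
        (fun y => crossCoeff d m j l * -(c y m * pd l (fun y => v y j) y)) (M.vol i) :=
      fun m j l => ((h m).memLp.integrable_mul (hvd j l)).neg.const_mul _
    simp only [this]
    rw [integral_finsetSum _ fun m _ => integrable_finsetSum _ fun j _ =>
      integrable_finsetSum _ fun l _ => hint m j l]
    refine Finset.sum_congr rfl fun m _ => ?_
    rw [integral_finsetSum _ fun j _ => integrable_finsetSum _ fun l _ => hint m j l]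
    refine Finset.sum_congr rfl fun j _ => ?_
    rw [integral_finsetSum _ fun l _ => hint m j l]
    exact Finset.sum_congr rfl fun l _ => by rw [integral_const_mul, integral_neg]
  have hB : ∫ y, adjCurlOf G y ⬝ᵥ v y ∂(M.vol i) =
      ∑ m, ∑ j, ∑ l, crossCoeff d m j l * ∫ y, G m l y * v y j ∂(M.vol i) := by
    have : ∀ y, adjCurlOf G y ⬝ᵥ v y =
        ∑ m, ∑ j, ∑ l, crossCoeff d m j l * (G m l y * v y j) := by
      intro y
      simp only [dotProduct, adjCurlOf, Finset.sum_mul]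
      rw [Finset.sum_comm]
      exact Finset.sum_congr rfl fun _ _ => Finset.sum_congr rfl fun _ _ =>
        Finset.sum_congr rfl fun _ _ => by ring
    have hint : ∀ m j l, Integrable
        (fun y => crossCoeff d m j l * (G m l y * v y j)) (M.vol i) :=
      fun m j l => (((h m).memLp_grad l).integrable_mul (hvv j)).const_mul _
    simp only [this]
    rw [integral_finsetSum _ fun m _ => integrable_finsetSum _ fun j _ =>
      integrable_finsetSum _ fun l _ => hint m j l]
    refine Finset.sum_congr rfl fun m _ => ?_
    rw [integral_finsetSum _ fun j _ => integrable_finsetSum _ fun l _ => hint m j l]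
    refine Finset.sum_congr rfl fun j _ => ?_
    rw [integral_finsetSum _ fun l _ => hint m j l]
    exact Finset.sum_congr rfl fun l _ => integral_const_mul _ _
  have hC : M.bdInt i (fun e y => t y ⬝ᵥ cross (v y) (cvec (M.normal i e))) =
      ∑ m, ∑ j, ∑ l, crossCoeff d m j l *
        M.bdInt i (fun e y => t y m * (v y j * cvec (M.normal i e) l)) := by
    have : ∀ e y, t y ⬝ᵥ cross (v y) (cvec (M.normal i e)) =
        ∑ m, ∑ j, ∑ l, crossCoeff d m j l * (t y m * (v y j * cvec (M.normal i e) l)) := by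
      intro e y
      simp only [dotProduct, cross, Finset.mul_sum]
      exact Finset.sum_congr rfl fun _ _ => Finset.sum_congr rfl fun _ _ =>
        Finset.sum_congr rfl fun _ _ => by ring
    have hint : ∀ m j l, ∀ e ∈ M.faces i, Integrable
        (fun y => crossCoeff d m j l * (t y m * (v y j * cvec (M.normal i e) l))) (M.surf e) :=
      fun m j l e he => (((h m).memLp_trace e he).integrable_mul
        (M.memLp_surf_of_continuous hd2 hΩ e ((hv j).continuous.mul continuous_const))).const_mul _
    simp only [this]
    rw [M.bdInt_sum _ fun m _ e he => integrable_finsetSum _ fun j _ =>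
      integrable_finsetSum _ fun l _ => hint m j l e he]
    refine Finset.sum_congr rfl fun m _ => ?_
    rw [M.bdInt_sum _ fun j _ e he => integrable_finsetSum _ fun l _ => hint m j l e he]
    refine Finset.sum_congr rfl fun j _ => ?_
    rw [M.bdInt_sum _ fun l _ e he => hint m j l e he]
    exact Finset.sum_congr rfl fun l _ => M.bdInt_const_mul _ _
  rw [hA, hB, hC]
  simp only [← Finset.sum_sub_distrib, ← mul_sub]
  refine Finset.sum_congr rfl fun m _ => Finset.sum_congr rfl fun j _ =>
    Finset.sum_congr rfl fun l _ => ?_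
  rw [(h m).by_parts _ (hv j) l]
  ring

theorem integral_divOf (hd : d = 2 ∨ d = 3) (hΩ : Bornology.IsBounded Ω) {i : ι}
    {f t : E d → Fin d → ℂ} {G : Fin d → Fin d → E d → ℂ} (h : M.IsWeakDiffVec i f t G)
    {φ : E d → ℂ} (hφ : ContDiff ℝ 1 φ) :
    ∫ y, (∑ j, G j j y) * φ y ∂(M.vol i) = M.divPair i f (fun _ => t) φ := by
  have hφv := M.memLp_vol_of_continuous hΩ i hφ.continuous
  have hφd := fun l => M.memLp_vol_of_continuous hΩ i (continuous_pd hφ l)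
  simp only [divPair, dotProduct, Finset.sum_mul]
  rw [integral_finsetSum _ fun j _ => integrable_mul_of_memLp ((h j).memLp_grad j) hφv,
    integral_finsetSum _ fun j _ => integrable_mul_of_memLp (h j).memLp (hφd j), M.bdInt_sum,
    ← Finset.sum_neg_distrib, ← Finset.sum_add_distrib]
  · refine Finset.sum_congr rfl fun j _ => ?_
    rw [show (fun (e : κ) (x : E d) => t x j * cvec (M.normal i e) j * φ x) =
      fun e x => t x j * (φ x * cvec (M.normal i e) j) from by ext e x; ring]
    have := (h j).by_parts φ hφ j
    rw [this]
    ring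
  · intro j _ e he
    exact (((h j).memLp_trace e he).mul_const _).integrable_mul
      (M.memLp_surf_of_continuous (by omega) hΩ e hφ.continuous)

theorem IsWeakDiff.integral_mul_div (hd : d = 2 ∨ d = 3) (hΩ : Bornology.IsBounded Ω) {i : ι}
    {p t : E d → ℂ} {G : Fin d → E d → ℂ} (h : M.IsWeakDiff i p t G) {a : E d → Fin d → ℂ}
    (ha : ∀ j, ContDiff ℝ 1 (fun y => a y j)) :
    ∫ y, (∑ j, pd j (fun z => a z j) y) * p y ∂(M.vol i) =
      M.bdInt i (fun e y => t y * (a y ⬝ᵥ cvec (M.normal i e))) -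
      ∫ y, (fun j => G j y) ⬝ᵥ a y ∂(M.vol i) := by
  have hav := fun j => M.memLp_vol_of_continuous hΩ i (ha j).continuous
  have had := fun l => M.memLp_vol_of_continuous hΩ i (continuous_pd (ha l) l)
  simp only [dotProduct, Finset.sum_mul, Finset.mul_sum]
  rw [integral_finsetSum _ fun j _ => integrable_mul_of_memLp (had j) h.memLp,
    integral_finsetSum _ fun j _ => integrable_mul_of_memLp (h.memLp_grad j) (hav j), M.bdInt_sum,
    ← Finset.sum_sub_distrib]
  · refine Finset.sum_congr rfl fun j _ => ?_
    rw [← h.by_parts _ (ha j) j]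
    simp only [mul_comm]
  · intro j _ e he
    exact (h.memLp_trace e he).integrable_mul
      (M.memLp_surf_of_continuous (by omega) hΩ e ((ha j).continuous.mul continuous_const))

end Mesh

/-! ### Test functions and uniqueness of weak derivatives -/

section TestFunctions

variable {d : ℕ}

theorem IsTest.mono {U V : Set (E d)} {φ : E d → ℂ} (h : IsTest U φ) (hUV : U ⊆ V) : IsTest V φ :=
  ⟨h.1, h.2.1, h.2.2.trans hUV⟩

theorem IsTest.contDiff {U : Set (E d)} {φ : E d → ℂ} (h : IsTest U φ) : ContDiff ℝ 1 φ :=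
  h.1.of_le (by exact_mod_cast le_top)

theorem IsTest.eq_zero {U : Set (E d)} {φ : E d → ℂ} (h : IsTest U φ) {x : E d} (hx : x ∉ U) :
    φ x = 0 := image_eq_zero_of_notMem_tsupport fun h' => hx (h.2.2 h')

theorem IsTest.pd_eq_zero {U : Set (E d)} {φ : E d → ℂ} (h : IsTest U φ) {x : E d} (hx : x ∉ U)
    (j : Fin d) : pd j φ x = 0 := by
  by_contra h0
  exact hx (h.2.2 (support_fderiv_subset ℝ fun h1 => h0 (by simp [pd, h1])))

theorem isTest_zero (U : Set (E d)) : IsTest U (fun _ => 0) := by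
  refine ⟨contDiff_const, HasCompactSupport.zero, ?_⟩
  have : tsupport (fun _ : E d => (0 : ℂ)) = ∅ := by simp [tsupport]
  simp [this]

theorem isTest_single {N : ℕ} {U : Set (E d)} {η : E d → ℂ} (h : IsTest U η) (m l : Fin N) :
    IsTest U (fun x => (Pi.single m (η x) : Fin N → ℂ) l) := by
  by_cases hl : l = m
  · subst hl; simpa using h
  · simpa [hl] using isTest_zero U

theorem isTest_ofReal {U : Set (E d)} {η : E d → ℝ} (hη : ContDiff ℝ (⊤ : ℕ∞) η)
    (hc : HasCompactSupport η) (hs : tsupport η ⊆ U) : IsTest U (fun x => (η x : ℂ)) := by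
  refine ⟨Complex.ofRealCLM.contDiff.comp hη,
    hc.comp_left (g := fun t : ℝ => (t : ℂ)) Complex.ofReal_zero, ?_⟩
  refine (closure_mono fun y hy => ?_).trans hs
  simpa using hy

theorem IsTest.memLp {U : Set (E d)} {φ : E d → ℂ} (h : IsTest U φ) (S : Set (E d)) :
    MemLp φ 2 (volume.restrict S) :=
  (h.contDiff.continuous.memLp_of_hasCompactSupport h.2.1).restrict S

theorem IsTest.memLp_pd {U : Set (E d)} {φ : E d → ℂ} (h : IsTest U φ) (j : Fin d)
    (S : Set (E d)) : MemLp (pd j φ) 2 (volume.restrict S) :=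
  ((Mesh.continuous_pd h.contDiff j).memLp_of_hasCompactSupport
    (h.2.1.fderiv_apply ℝ (EuclideanSpace.single j 1))).restrict S

theorem ae_eq_zero_of_isTest {U : Set (E d)} (hU : IsOpen U) {f : E d → ℂ}
    (hf : MemLp f 2 (volume.restrict U)) (h : ∀ η, IsTest U η → ∫ x in U, f x * η x = 0) :
    ∀ᵐ x ∂(volume.restrict U), f x = 0 := by
  have hloc : LocallyIntegrableOn f U (volume.restrict U) :=
    (hf.locallyIntegrable one_le_two).locallyIntegrableOn U
  have := hU.ae_eq_zero_of_integral_contDiff_smul_eq_zero hloc (fun η hη hc hs => by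
    rw [← h _ (isTest_ofReal hη hc hs)]
    refine integral_congr_ae (Eventually.of_forall fun x => ?_)
    simp [mul_comm])
  filter_upwards [this, ae_restrict_mem hU.measurableSet] with x h1 h2 using h1 h2

/-- The choice made in `weakDiv` is harmless: two weak divergences have the same integrals against
all test functions. -/
theorem weakDiv_ae_eq {Ω : Set (E d)} (hΩ : IsOpen Ω) {w : E d → Fin d → ℂ} {g : E d → ℂ}
    (h : HasWeakDiv Ω w g) : ∀ᵐ x ∂(volume.restrict Ω), weakDiv Ω w x = g x := by
  have hm : MemHdiv Ω w := ⟨g, h⟩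
  rw [weakDiv, dif_pos hm]
  have h' := hm.choose_spec
  have := ae_eq_zero_of_isTest hΩ (h'.2.1.sub h.2.1) fun η hη => by
    simp only [Pi.sub_apply, sub_mul]
    rw [integral_sub (integrable_mul_of_memLp h'.2.1 (hη.memLp Ω))
      (integrable_mul_of_memLp h.2.1 (hη.memLp Ω)), h'.2.2 η hη, h.2.2 η hη, sub_self]
  filter_upwards [this] with x hx using sub_eq_zero.1 hx

theorem weakCurl_ae_eq {Ω : Set (E d)} (hΩ : IsOpen Ω) {v : E d → Fin d → ℂ}
    {c : E d → Fin (curlDim d) → ℂ} (h : HasWeakCurl Ω v c) :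
    ∀ᵐ x ∂(volume.restrict Ω), weakCurl Ω v x = c x := by
  have hm : MemHcurl Ω v := ⟨c, h⟩
  rw [weakCurl, dif_pos hm]
  have h' := hm.choose_spec
  have : ∀ m, ∀ᵐ x ∂(volume.restrict Ω), (hm.choose x - c x) m = 0 := fun m =>
    ae_eq_zero_of_isTest hΩ ((h'.2.1.sub h.2.1).eval m) fun η hη => by
      have e1 := h'.2.2 (fun x => Pi.single m (η x)) (isTest_single hη m)
      have e2 := h.2.2 (fun x => Pi.single m (η x)) (isTest_single hη m)
      simp only [dotProduct_single] at e1 e2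
      simp only [Pi.sub_apply, sub_mul]
      rw [integral_sub (integrable_mul_of_memLp (h'.2.1.eval m) (hη.memLp Ω))
        (integrable_mul_of_memLp (h.2.1.eval m) (hη.memLp Ω)), e1, e2, sub_self]
  filter_upwards [ae_all_iff.2 this] with x hx
  ext m
  exact sub_eq_zero.1 (hx m)

end TestFunctions

/-! ### Splitting over the partition, and jump relations of conforming fields -/

namespace Mesh

variable {d : ℕ} {Ω : Set (E d)} {ι κ : Type*} [Fintype ι] [Fintype κ] (M : Mesh d Ω ι κ)

section Partition

/-- A point of Ω in no element lies on the frontier of one, and frontiers are null because they are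
finite unions of flat pieces. This allows integrals over Ω to be split. -/
theorem iUnion_elem_ae_eq (hd : 2 ≤ d) (hΩ_reg : interior (closure Ω) = Ω) :
    (⋃ i, M.elem i : Set (E d)) =ᵐ[volume] Ω := by
  refine Filter.EventuallyLE.antisymm
    (Set.iUnion_subset fun i => M.elem_subset hΩ_reg i).eventuallyLE ?_
  rw [ae_le_set]
  refine measure_mono_null (t := ⋃ i, frontier (M.elem i)) ?_
    (measure_iUnion_null fun i => M.volume_frontier_elem hd i)
  rintro x ⟨hx, hx'⟩
  have : x ∈ closure Ω := subset_closure hx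
  rw [← M.elem_cover] at this
  obtain ⟨i, hi⟩ := Set.mem_iUnion.1 this
  refine Set.mem_iUnion.2 ⟨i, ?_⟩
  rw [(M.elem_open i).frontier_eq]
  exact ⟨hi, fun h => hx' (Set.mem_iUnion.2 ⟨i, h⟩)⟩

theorem ae_of_elem (hd : 2 ≤ d) (hΩ_reg : interior (closure Ω) = Ω) {P : E d → Prop}
    (h : ∀ i, ∀ᵐ x ∂(M.vol i), P x) : ∀ᵐ x ∂(volume.restrict Ω), P x := by
  rw [← Measure.restrict_congr_set (M.iUnion_elem_ae_eq hd hΩ_reg)]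
  exact ae_restrict_iUnion_iff _ _ |>.2 h

theorem ae_elem_of_ae (hΩ_reg : interior (closure Ω) = Ω) {P : E d → Prop}
    (h : ∀ᵐ x ∂(volume.restrict Ω), P x) (i : ι) : ∀ᵐ x ∂(M.vol i), P x :=
  ae_mono (Measure.restrict_mono (M.elem_subset hΩ_reg i) le_rfl) h

theorem ae_mem_elem (i : ι) : ∀ᵐ x ∂(M.vol i), x ∈ M.elem i :=
  ae_restrict_mem (M.elem_open i).measurableSet

theorem memLp_elem {F : Type*} [NormedAddCommGroup F] {p : ENNReal}
    (hΩ_reg : interior (closure Ω) = Ω) {f : E d → F} (h : MemLp f p (volume.restrict Ω)) (i : ι) :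
    MemLp f p (M.vol i) := h.mono_measure (Measure.restrict_mono (M.elem_subset hΩ_reg i) le_rfl)

theorem memLp_of_elem {F : Type*} [NormedAddCommGroup F] {p : ENNReal} (hd : 2 ≤ d)
    (hΩ_reg : interior (closure Ω) = Ω) {f : E d → F} (h : ∀ i, MemLp f p (M.vol i)) :
    MemLp f p (volume.restrict Ω) := by
  classical
  have h1 : MemLp (fun x => ∑ i, (M.elem i).indicator f x) p (volume.restrict Ω) := by
    refine memLp_finsetSum _ fun i _ => ?_
    refine MemLp.restrict Ω ?_
    exact (memLp_indicator_iff_restrict (M.elem_open i).measurableSet).2 (h i)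
  refine h1.ae_eq (M.ae_of_elem hd hΩ_reg fun i => ?_)
  filter_upwards [M.ae_mem_elem i] with x hx
  rw [Finset.sum_eq_single i]
  · simp [hx]
  · intro j _ hj
    exact Set.indicator_of_notMem (fun h' => Set.disjoint_left.1 (M.elem_disjoint hj) h' hx) _
  · simp

theorem integral_eq_sum (hd : 2 ≤ d) (hΩ_reg : interior (closure Ω) = Ω) {f : E d → ℂ}
    (h : ∀ i, Integrable f (M.vol i)) : ∫ x in Ω, f x = ∑ i, ∫ x, f x ∂(M.vol i) := by
  rw [← setIntegral_congr_set (M.iUnion_elem_ae_eq hd hΩ_reg)]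
  exact integral_iUnion_fintype (fun i => (M.elem_open i).measurableSet) M.elem_disjoint h

theorem pwConst_of_mem {V : Type*} [AddCommMonoid V] (c : ι → V) {i : ι} {x : E d}
    (hx : x ∈ M.elem i) : M.pwConst c x = c i := by
  classical
  rw [pwConst, Finset.sum_eq_single i]
  · simp [hx]
  · intro j _ hj
    exact Set.indicator_of_notMem (fun h' => Set.disjoint_left.1 (M.elem_disjoint hj) h' hx) _
  · simp

/-- The function that coincides with `v i` on the element `i`. -/
noncomputable def pw {V : Type*} [AddCommMonoid V] (v : ι → E d → V) (x : E d) : V :=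
  ∑ i, (M.elem i).indicator (v i) x

theorem pw_of_mem {V : Type*} [AddCommMonoid V] (v : ι → E d → V) {i : ι} {x : E d}
    (hx : x ∈ M.elem i) : M.pw v x = v i x := by
  classical
  rw [pw, Finset.sum_eq_single i]
  · simp [hx]
  · intro j _ hj
    exact Set.indicator_of_notMem (fun h' => Set.disjoint_left.1 (M.elem_disjoint hj) h' hx) _
  · simp

end Partition

section LocalDerivatives

theorem IsWeakDiff.congr {i : ι} {f f' t : E d → ℂ} {G : Fin d → E d → ℂ}
    (h : M.IsWeakDiff i f t G) (hff : ∀ x ∈ M.elem i, f' x = f x) : M.IsWeakDiff i f' t G := by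
  have hae : f =ᵐ[M.vol i] f' := by
    filter_upwards [M.ae_mem_elem i] with x hx using (hff x hx).symm
  refine ⟨h.memLp.ae_eq hae, h.memLp_trace, h.memLp_grad, fun ψ hψ j => ?_⟩
  rw [← h.by_parts ψ hψ j]
  refine integral_congr_ae ?_
  filter_upwards [hae] with x hx
  rw [hx]

theorem setIntegral_elem_of_isTest (hΩ_reg : interior (closure Ω) = Ω) {i : ι} {f : E d → ℂ}
    (hf : ∀ x, x ∉ M.elem i → f x = 0) : ∫ x in Ω, f x = ∫ x, f x ∂(M.vol i) :=
  setIntegral_eq_of_subset_of_forall_sdiff_eq_zero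
    (by rw [← hΩ_reg]; exact isOpen_interior.measurableSet)
    (M.elem_subset hΩ_reg i) fun x hx => hf x hx.2

/-- The face lies in the closure of its owner, and an open element meeting that closure meets the
owner itself. -/
theorem disjoint_elem_face {i : ι} (e : κ) : Disjoint (M.elem i) (M.face e) := by
  rw [Set.disjoint_left]
  intro x hx hxe
  have hj := M.mem_faces.1 (M.owner_mem e) hxe
  rw [(M.elem_open _).frontier_eq] at hj
  by_cases h : i = M.owner e
  · exact hj.2 (h ▸ hx)
  · obtain ⟨z, hz, hz'⟩ := mem_closure_iff.1 hj.1 _ (M.elem_open i) hx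
    exact Set.disjoint_left.1 (M.elem_disjoint h) hz hz'

theorem bdInt_eq_zero_of_isTest {i i' : ι} {η : E d → ℂ} (hη : IsTest (M.elem i) η)
    (g : κ → E d → ℂ) (hg : ∀ e x, η x = 0 → g e x = 0) : M.bdInt i' g = 0 := by
  rw [M.bdInt_congr (g := fun _ _ => 0)]
  · simp [bdInt]
  · exact fun e _ x hx => hg e x (hη.eq_zero fun h =>
      Set.disjoint_left.1 (M.disjoint_elem_face e) h hx)

/-- Test functions supported in the element lose all face terms, so the global weak divergence and
the one built from the local derivatives cannot be distinguished there. -/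
theorem weakDiv_eq_on_elem (hd : d = 2 ∨ d = 3) (hΩ_reg : interior (closure Ω) = Ω)
    (hΩ : Bornology.IsBounded Ω) {w : E d → Fin d → ℂ} {g : E d → ℂ} (h : HasWeakDiv Ω w g)
    {i : ι} {t : E d → Fin d → ℂ} {G : Fin d → Fin d → E d → ℂ} (hw : M.IsWeakDiffVec i w t G) :
    ∀ᵐ x ∂(M.vol i), g x = ∑ j, G j j x := by
  have hgi := M.memLp_elem hΩ_reg h.2.1 i
  have hdiv : MemLp (fun x => ∑ j, G j j x) 2 (M.vol i) :=
    memLp_finsetSum _ fun j _ => (hw j).memLp_grad j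
  have := ae_eq_zero_of_isTest (M.elem_open i) (hgi.sub hdiv) fun η hη => by
    have hηv := hη.memLp (M.elem i)
    have e1 := h.2.2 η (hη.mono (M.elem_subset hΩ_reg i))
    rw [M.setIntegral_elem_of_isTest hΩ_reg (i := i) (fun x hx => by simp [hη.eq_zero hx]),
      M.setIntegral_elem_of_isTest hΩ_reg (i := i) (fun x hx => by simp [hη.pd_eq_zero hx])] at e1
    have e2 := M.integral_divOf hd hΩ hw hη.contDiff
    rw [divPair, M.bdInt_eq_zero_of_isTest hη _ (fun e x h0 => by simp [h0]), add_zero, ← e1] at e2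
    simp only [Pi.sub_apply, sub_mul]
    have := integral_sub (integrable_mul_of_memLp hgi hηv) (integrable_mul_of_memLp hdiv hηv)
    rw [vol] at this e2
    rw [this]
    exact sub_eq_zero.2 e2.symm
  filter_upwards [this] with x hx using sub_eq_zero.1 hx

theorem weakCurl_eq_on_elem (hd : d = 2 ∨ d = 3) (hΩ_reg : interior (closure Ω) = Ω)
    (hΩ : Bornology.IsBounded Ω) {v : E d → Fin d → ℂ} {c : E d → Fin (curlDim d) → ℂ}
    (h : HasWeakCurl Ω v c) {i : ι} {t : E d → Fin d → ℂ} {G : Fin d → Fin d → E d → ℂ}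
    (hv : M.IsWeakDiffVec i v t G) : ∀ᵐ x ∂(M.vol i), c x = curlOf G x := by
  have hci := M.memLp_elem hΩ_reg h.2.1 i
  have hcurl := hv.memLp_curlOf M
  have : ∀ m, ∀ᵐ x ∂(M.vol i), (c x - curlOf G x) m = 0 := fun m =>
    ae_eq_zero_of_isTest (M.elem_open i) ((hci.sub hcurl).eval m) fun η hη => by
      have hηv := hη.memLp (M.elem i)
      have htest := isTest_single (N := curlDim d) hη m
      have e1 := h.2.2 (fun x => Pi.single m (η x))
        fun l => (htest l).mono (M.elem_subset hΩ_reg i)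
      rw [M.setIntegral_elem_of_isTest hΩ_reg (i := i) (fun x hx => by simp [hη.eq_zero hx]),
        M.setIntegral_elem_of_isTest hΩ_reg (i := i) (fun x hx => by
          simp [dotProduct, testCurl, (htest _).pd_eq_zero hx])] at e1
      have e2 := M.integral_curlOf hd hΩ hv (ψ := fun x => Pi.single m (η x))
        fun l => (htest l).contDiff
      rw [curlPair, M.bdInt_eq_zero_of_isTest hη _ (fun e x h0 => by simp [h0]), sub_zero,
        ← e1] at e2
      simp only [dotProduct_single] at e2
      simp only [Pi.sub_apply, sub_mul]
      have := integral_sub (integrable_mul_of_memLp (hci.eval m) hηv)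
        (integrable_mul_of_memLp (hcurl.eval m) hηv)
      rw [vol] at this e2
      rw [this]
      exact sub_eq_zero.2 e2.symm
  filter_upwards [ae_all_iff.2 this] with x hx
  ext m
  exact sub_eq_zero.1 (hx m)

/-- Summing the elementwise formulas and comparing with the weak divergence on Ω leaves only face
terms, which a test function near e isolates. Such a test function must be supported in Ω, hence the
restriction to interior faces. -/
theorem normal_jump (hd : d = 2 ∨ d = 3) (hΩ_open : IsOpen Ω)
    (hΩ_reg : interior (closure Ω) = Ω) (hΩ : Bornology.IsBounded Ω) {w : E d → Fin d → ℂ}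
    {g : E d → ℂ} (h : HasWeakDiv Ω w g) {t : ι → E d → Fin d → ℂ}
    {G : ι → Fin d → Fin d → E d → ℂ} (hw : ∀ i, M.IsWeakDiffVec i w (t i) (G i)) {e : κ}
    (he : M.face e ⊆ Ω) :
    ∀ᵐ x ∂(M.surf e), ∑ i ∈ M.owners e, t i x ⬝ᵥ cvec (M.normal i e) = 0 := by
  have hd2 : 2 ≤ d := by omega
  refine M.jump_eq_zero hd2 (fun i hi => ?_) hΩ_open he fun η hη => ?_
  · have := M.surf_lt_top hd2 hΩ e
    exact (memLp_dotProduct_const ((hw i).memLp_trace M hi) _).integrable one_le_two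
  · have hηΩ := hη.mono (Set.inter_subset_left)
    have hηv : ∀ i, MemLp η 2 (M.vol i) := fun i => hη.memLp (M.elem i)
    have hηd : ∀ i j, MemLp (pd j η) 2 (M.vol i) := fun i j => hη.memLp_pd j (M.elem i)
    have hgi := fun i => M.memLp_elem hΩ_reg h.2.1 i
    have e1 := h.2.2 η hηΩ
    rw [M.integral_eq_sum hd2 hΩ_reg fun i => integrable_mul_of_memLp (hgi i) (hηv i),
      M.integral_eq_sum hd2 hΩ_reg fun i => integrable_finsetSum _ fun j _ =>
        integrable_mul_of_memLp ((hw i j).memLp) (hηd i j)] at e1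
    rw [← M.sum_bdInt_eq_single (fun i e x => (t i x ⬝ᵥ cvec (M.normal i e)) * η x)]
    · have e2 : ∀ i, ∫ x, g x * η x ∂(M.vol i) =
          -(∫ y, ∑ j, w y j * pd j η y ∂(M.vol i)) +
          M.bdInt i (fun e x => (t i x ⬝ᵥ cvec (M.normal i e)) * η x) := by
        intro i
        have e3 := M.integral_divOf hd hΩ (hw i) hη.contDiff
        rw [divPair] at e3
        rw [← e3]
        refine integral_congr_ae ?_
        filter_upwards [M.weakDiv_eq_on_elem hd hΩ_reg hΩ h (hw i)] with x hx
        rw [hx]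
      simp only [e2, Finset.sum_add_distrib, Finset.sum_neg_distrib] at e1
      exact left_eq_add.1 e1.symm
    · intro i f hf x hx
      simp [M.IsTest_eq_zero_of_mem_otherFaces hf hη hx]

/-- The zero trace condition is tested with fields that need not vanish on Γ, so boundary faces are
included. There the sum has one term and expresses u × n = 0. -/
theorem tangential_jump (hd : d = 2 ∨ d = 3) (hΩ_open : IsOpen Ω)
    (hΩ_reg : interior (closure Ω) = Ω) (hΩ : Bornology.IsBounded Ω) {v : E d → Fin d → ℂ}
    (h : MemHcurl0 Ω v) {t : ι → E d → Fin d → ℂ}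
    {G : ι → Fin d → Fin d → E d → ℂ} (hv : ∀ i, M.IsWeakDiffVec i v (t i) (G i)) (e : κ) :
    ∀ᵐ x ∂(M.surf e), ∑ i ∈ M.owners e, cross (t i x) (cvec (M.normal i e)) = 0 := by
  have hd2 : 2 ≤ d := by omega
  have hcurl : HasWeakCurl Ω v (weakCurl Ω v) := by
    rw [weakCurl, dif_pos h.1]
    exact h.1.choose_spec
  suffices hm : ∀ m, ∀ᵐ x ∂(M.surf e),
      ∑ i ∈ M.owners e, cross (t i x) (cvec (M.normal i e)) m = 0 by
    filter_upwards [ae_all_iff.2 hm] with x hx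
    ext m
    simpa using hx m
  intro m
  refine M.jump_eq_zero hd2 (fun i hi => ?_) isOpen_univ (Set.subset_univ _) fun η hη => ?_
  · have := M.surf_lt_top hd2 hΩ e
    exact ((memLp_cross ((hv i).memLp_trace M hi) _).eval m).integrable one_le_two
  · have htest := isTest_single (N := curlDim d) (hη.mono (Set.subset_univ _)) m
    have hηv : ∀ i, MemLp η 2 (M.vol i) := fun i => hη.memLp (M.elem i)
    have hci := fun i => M.memLp_elem hΩ_reg hcurl.2.1 i
    have e1 := h.2 (fun x => Pi.single m (η x)) htest
    have hint : ∀ i, Integrable (fun x => v x ⬝ᵥ testCurl (fun x => Pi.single m (η x)) x)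
        (M.vol i) := fun i => integrable_dotProduct ((hv i).memLp M)
      (MemLp.of_eval fun j => memLp_finsetSum _ fun l _ => memLp_finsetSum _ fun q _ =>
        ((htest l).memLp_pd q (M.elem i)).const_mul _)
    simp only [dotProduct_single] at e1
    rw [M.integral_eq_sum hd2 hΩ_reg fun i => integrable_mul_of_memLp ((hci i).eval m) (hηv i),
      M.integral_eq_sum hd2 hΩ_reg hint] at e1
    rw [← M.sum_bdInt_eq_single (fun i e x => cross (t i x) (cvec (M.normal i e)) m * η x)]
    · have e2 : ∀ i, ∫ x, weakCurl Ω v x m * η x ∂(M.vol i) =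
          ∫ x, v x ⬝ᵥ testCurl (fun x => Pi.single m (η x)) x ∂(M.vol i) -
          M.bdInt i (fun e x => cross (t i x) (cvec (M.normal i e)) m * η x) := by
        intro i
        have e3 := M.integral_curlOf hd hΩ (hv i) (ψ := fun x => Pi.single m (η x))
          fun l => (htest l).contDiff
        rw [curlPair] at e3
        simp only [dotProduct_single] at e3
        rw [← e3]
        refine integral_congr_ae ?_
        filter_upwards [M.weakCurl_eq_on_elem hd hΩ_reg hΩ hcurl (hv i)] with x hx
        rw [hx]
      simp only [e2, Finset.sum_sub_distrib] at e1
      exact sub_eq_self.1 e1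
    · intro i f hf x hx
      simp [M.IsTest_eq_zero_of_mem_otherFaces hf hη hx]

end LocalDerivatives

end Mesh

/-! ### Piecewise smooth conforming fields -/

theorem rmul_zero {N : ℕ} (A : Matrix (Fin N) (Fin N) ℝ) : rmul A 0 = 0 := Matrix.mulVec_zero _

/-- This nonzero number is the divisor when the normal component of εw is prescribed by adding a
multiple of n to w. -/
theorem rmul_cvec_dotProduct_cvec_ne_zero {d : ℕ} {A : Matrix (Fin d) (Fin d) ℝ} (hA : A.PosDef)
    {n : E d} (hn : ‖n‖ = 1) : rmul A (cvec n) ⬝ᵥ cvec n ≠ 0 := by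
  have h0 : (fun i => n i) ≠ 0 := fun h => by
    have : n = 0 := by ext i; exact congrFun h i
    simp [this] at hn
  have h := hA.dotProduct_mulVec_pos h0
  have : rmul A (cvec n) ⬝ᵥ cvec n =
      ((star (fun i => n i) ⬝ᵥ (A *ᵥ fun i => n i) : ℝ) : ℂ) := by
    simp only [dotProduct, rmul_apply, cvec, Matrix.mulVec, star_trivial, Complex.ofReal_sum,
      Complex.ofReal_mul]
    exact Finset.sum_congr rfl fun i _ => mul_comm _ _
  rw [this]
  exact_mod_cast h.ne'

theorem cross_zero_left {d : ℕ} (c : Fin d → ℂ) : cross 0 c = 0 := (crossLin c).map_zero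

namespace Mesh

variable {d : ℕ} {Ω : Set (E d)} {ι κ : Type*} [Fintype ι] [Fintype κ] (M : Mesh d Ω ι κ)

theorem sum_bdInt_eq_zero {g : ι → κ → E d → ℂ}
    (hg : ∀ i, ∀ e ∈ M.faces i, Integrable (g i e) (M.surf e))
    (h : ∀ e, ∀ᵐ x ∂(M.surf e), ∑ i ∈ M.owners e, g i e x = 0) : ∑ i, M.bdInt i (g i) = 0 := by
  rw [sum_bdInt]
  refine Finset.sum_eq_zero fun e _ => ?_
  rw [← integral_finsetSum _ fun i hi => hg i e (M.mem_owners.1 hi)]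
  exact integral_eq_zero_of_ae (h e)

theorem ae_mem_face (e : κ) : ∀ᵐ x ∂(M.surf e), x ∈ M.face e :=
  ae_restrict_mem (M.measurableSet_face e)

theorem pw_of_notMem {V : Type*} [AddCommMonoid V] (v : ι → E d → V) {x : E d}
    (hx : ∀ i, x ∉ M.elem i) : M.pw v x = 0 :=
  Finset.sum_eq_zero fun i _ => Set.indicator_of_notMem (hx i) _

theorem rmul_pwConst_pw {N : ℕ} (A : ι → Matrix (Fin N) (Fin N) ℝ) (v : ι → E d → Fin N → ℂ) :
    (fun x => rmul (M.pwConst A x) (M.pw v x)) = M.pw fun i x => rmul (A i) (v i x) := by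
  ext1 x
  by_cases h : ∃ i, x ∈ M.elem i
  · obtain ⟨i, hi⟩ := h
    rw [M.pw_of_mem v hi, M.pw_of_mem _ hi, M.pwConst_of_mem A hi]
  · push Not at h
    rw [M.pw_of_notMem v h, M.pw_of_notMem _ h, rmul_zero]

section PiecewiseSmooth

variable {V : ι → E d → Fin d → ℂ}

theorem isWeakDiffVec_pw (hd : d = 2 ∨ d = 3) (hΩ : Bornology.IsBounded Ω)
    (hV : ∀ i j, ContDiff ℝ 1 (fun x => V i x j)) (i : ι) :
    M.IsWeakDiffVec i (V i) (V i) (fun j l => pd l (fun z => V i z j)) :=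
  fun j => M.isWeakDiff_of_contDiff hd hΩ i (hV i j)

theorem memLp_pw (hd : 2 ≤ d) (hΩ_reg : interior (closure Ω) = Ω) {F : Type*}
    [NormedAddCommGroup F] {f : ι → E d → F} (hf : ∀ i, MemLp (f i) 2 (M.vol i)) :
    MemLp (M.pw f) 2 (volume.restrict Ω) :=
  M.memLp_of_elem hd hΩ_reg fun i => (hf i).ae_eq <| by
    filter_upwards [M.ae_mem_elem i] with x hx using (M.pw_of_mem f hx).symm

/-- After regrouping face by face the boundary terms cancel by `hj`. As `hj` covers the faces on Γ
too, φ need not vanish there, so one identity gives both the weak curl and the zero tangential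
trace. -/
theorem integral_curl_pw (hd : d = 2 ∨ d = 3) (hΩ_reg : interior (closure Ω) = Ω)
    (hΩ : Bornology.IsBounded Ω) (hV : ∀ i j, ContDiff ℝ 1 (fun x => V i x j))
    (hj : ∀ e, ∀ x ∈ M.face e, ∑ i ∈ M.owners e, cross (V i x) (cvec (M.normal i e)) = 0)
    {φ : E d → Fin (curlDim d) → ℂ} (hφ : ∀ m, ContDiff ℝ 1 (fun x => φ x m)) :
    ∫ x in Ω, M.pw (fun i => curlOf fun j l => pd l (fun z => V i z j)) x ⬝ᵥ φ x =
      ∫ x in Ω, M.pw V x ⬝ᵥ testCurl φ x := by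
  have hd2 : 2 ≤ d := by omega
  have hW := fun i => M.isWeakDiffVec_pw hd hΩ hV i
  have hφv := fun i m => M.memLp_vol_of_continuous hΩ i (hφ m).continuous
  have hcurl : ∀ i, MemLp (fun x => testCurl φ x) 2 (M.vol i) := fun i =>
    MemLp.of_eval fun j => memLp_finsetSum _ fun l _ => memLp_finsetSum _ fun q _ =>
      (M.memLp_vol_of_continuous hΩ i (continuous_pd (hφ l) q)).const_mul _
  have hae : ∀ {F : Type _} [AddCommMonoid F] (f : ι → E d → F) i,
      ∀ᵐ x ∂(M.vol i), f i x = M.pw f x := fun f i => by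
    filter_upwards [M.ae_mem_elem i] with x hx using (M.pw_of_mem f hx).symm
  rw [M.integral_eq_sum hd2 hΩ_reg fun i => integrable_dotProduct
      (((hW i).memLp_curlOf M).ae_eq (hae _ i)) (MemLp.of_eval (hφv i)),
    M.integral_eq_sum hd2 hΩ_reg fun i => integrable_dotProduct
      (((hW i).memLp M).ae_eq (hae _ i)) (hcurl i)]
  have h1 : ∀ i, ∫ x, M.pw (fun i => curlOf fun j l => pd l (fun z => V i z j)) x ⬝ᵥ φ x
        ∂(M.vol i) = ∫ x, M.pw V x ⬝ᵥ testCurl φ x ∂(M.vol i) -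
        M.bdInt i (fun e x => cross (V i x) (cvec (M.normal i e)) ⬝ᵥ φ x) := fun i => by
    have e1 := M.integral_curlOf hd hΩ (hW i) hφ
    rw [curlPair] at e1
    convert e1 using 1
    · refine integral_congr_ae ?_
      filter_upwards [hae (fun i => curlOf fun j l => pd l (fun z => V i z j)) i] with x hx
      rw [← hx]
    · congr 1
      refine integral_congr_ae ?_
      filter_upwards [hae V i] with x hx
      rw [← hx]
  simp only [h1, Finset.sum_sub_distrib]
  rw [M.sum_bdInt_eq_zero, sub_zero]
  · exact fun i e he => integrable_dotProduct (memLp_cross ((hW i).memLp_trace M he) _)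
      (MemLp.of_eval fun m => M.memLp_surf_of_continuous hd2 hΩ e (hφ m).continuous)
  · intro e
    filter_upwards [M.ae_mem_face e] with x hx
    rw [← sum_dotProduct, hj e x hx, zero_dotProduct]

theorem hasWeakCurl_pw (hd : d = 2 ∨ d = 3) (hΩ_reg : interior (closure Ω) = Ω)
    (hΩ : Bornology.IsBounded Ω) (hV : ∀ i j, ContDiff ℝ 1 (fun x => V i x j))
    (hj : ∀ e, ∀ x ∈ M.face e, ∑ i ∈ M.owners e, cross (V i x) (cvec (M.normal i e)) = 0) :
    HasWeakCurl Ω (M.pw V) (M.pw fun i => curlOf fun j l => pd l (fun z => V i z j)) :=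
  ⟨M.memLp_pw (by omega) hΩ_reg fun i => (M.isWeakDiffVec_pw hd hΩ hV i).memLp M,
    M.memLp_pw (by omega) hΩ_reg fun i => (M.isWeakDiffVec_pw hd hΩ hV i).memLp_curlOf M,
    fun _ hφ => M.integral_curl_pw hd hΩ_reg hΩ hV hj fun m => (hφ m).contDiff⟩

theorem memHcurl0_pw (hd : d = 2 ∨ d = 3) (hΩ_open : IsOpen Ω)
    (hΩ_reg : interior (closure Ω) = Ω)
    (hΩ : Bornology.IsBounded Ω) (hV : ∀ i j, ContDiff ℝ 1 (fun x => V i x j))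
    (hj : ∀ e, ∀ x ∈ M.face e, ∑ i ∈ M.owners e, cross (V i x) (cvec (M.normal i e)) = 0) :
    MemHcurl0 Ω (M.pw V) := by
  have h := M.hasWeakCurl_pw hd hΩ_reg hΩ hV hj
  refine ⟨⟨_, h⟩, fun φ hφ => ?_⟩
  rw [← M.integral_curl_pw hd hΩ_reg hΩ hV hj fun m => (hφ m).contDiff]
  refine integral_congr_ae ?_
  filter_upwards [weakCurl_ae_eq hΩ_open h] with x hx
  rw [hx]

/-- On interior faces the normal jump is zero; on Γ the test function is zero, so no condition is
needed there. -/
theorem hasWeakDiv_pw (hd : d = 2 ∨ d = 3) (hΩ_open : IsOpen Ω)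
    (hΩ_reg : interior (closure Ω) = Ω)
    (hΩ : Bornology.IsBounded Ω) (hV : ∀ i j, ContDiff ℝ 1 (fun x => V i x j))
    (hj : ∀ e, M.face e ⊆ Ω → ∀ x ∈ M.face e,
      ∑ i ∈ M.owners e, V i x ⬝ᵥ cvec (M.normal i e) = 0) :
    HasWeakDiv Ω (M.pw V) (M.pw fun i x => ∑ j, pd j (fun z => V i z j) x) := by
  have hd2 : 2 ≤ d := by omega
  have hW := fun i => M.isWeakDiffVec_pw hd hΩ hV i
  have hdiv : ∀ i, MemLp (fun x => ∑ j, pd j (fun z => V i z j) x) 2 (M.vol i) := fun i =>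
    memLp_finsetSum _ fun j _ => (hW i j).memLp_grad j
  have hae : ∀ {F : Type _} [AddCommMonoid F] (f : ι → E d → F) i,
      ∀ᵐ x ∂(M.vol i), f i x = M.pw f x := fun f i => by
    filter_upwards [M.ae_mem_elem i] with x hx using (M.pw_of_mem f hx).symm
  refine ⟨M.memLp_pw hd2 hΩ_reg fun i => (hW i).memLp M, M.memLp_pw hd2 hΩ_reg hdiv,
    fun φ hφ => ?_⟩
  rw [M.integral_eq_sum hd2 hΩ_reg fun i => integrable_mul_of_memLp
      ((hdiv i).ae_eq (hae _ i)) (hφ.memLp _),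
    M.integral_eq_sum hd2 hΩ_reg fun i => integrable_finsetSum _ fun j _ =>
      integrable_mul_of_memLp ((((hW i).memLp M).ae_eq (hae _ i)).eval j) (hφ.memLp_pd j _)]
  have h1 : ∀ i, ∫ x, M.pw (fun i x => ∑ j, pd j (fun z => V i z j) x) x * φ x ∂(M.vol i) =
      -∫ x, ∑ j, M.pw V x j * pd j φ x ∂(M.vol i) +
        M.bdInt i (fun e x => (V i x ⬝ᵥ cvec (M.normal i e)) * φ x) := fun i => by
    have e1 := M.integral_divOf hd hΩ (hW i) hφ.contDiff
    rw [divPair] at e1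
    convert e1 using 1
    · refine integral_congr_ae ?_
      filter_upwards [hae (fun i x => ∑ j, pd j (fun z => V i z j) x) i] with x hx
      rw [← hx]
    · congr 2
      refine integral_congr_ae ?_
      filter_upwards [hae V i] with x hx
      rw [← hx]
  simp only [h1, Finset.sum_add_distrib, Finset.sum_neg_distrib]
  rw [M.sum_bdInt_eq_zero, add_zero]
  · exact fun i e he => integrable_mul_of_memLp
      (memLp_dotProduct_const ((hW i).memLp_trace M he) _)
      (M.memLp_surf_of_continuous hd2 hΩ e hφ.contDiff.continuous)
  · intro e
    filter_upwards [M.ae_mem_face e] with x hx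
    rw [← Finset.sum_mul]
    rcases M.face_position e with he | he
    · rw [hj e he x hx, zero_mul]
    · rw [hφ.eq_zero fun hxΩ => ?_, mul_zero]
      have := he hx
      rw [hΩ_open.frontier_eq] at this
      exact this.2 hxΩ

end PiecewiseSmooth

/-- The residual `∇ × c + (iωσ - ω²ε) u + ε ∇ p + iω j` of the strong form of the equation on an
element, for derivatives `Gc` of `c` and `Gp` of `p`. -/
noncomputable def residual (ω s : ℝ) (A : Matrix (Fin d) (Fin d) ℝ) (je u : E d → Fin d → ℂ)
    (Gc : Fin (curlDim d) → Fin d → E d → ℂ) (Gp : Fin d → E d → ℂ) (x : E d) : Fin d → ℂ :=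
  adjCurlOf Gc x + lowCoeff ω s A (u x) + rmul A (fun j => Gp j x) + (Complex.I * ω) • je x

theorem memLp_lowCoeff {m : Measure (E d)} (ω s : ℝ) (A : Matrix (Fin d) (Fin d) ℝ)
    {f : E d → Fin d → ℂ} (hf : MemLp f 2 m) : MemLp (fun x => lowCoeff ω s A (f x)) 2 m :=
  (hf.const_smul (Complex.I * ω * s)).sub ((memLp_rmul A hf).const_smul ((ω : ℂ) ^ 2))

/-! ### The strong equation and the interface conditions -/

section Electric

variable {M} {ω : ℝ} {mu : ι → Matrix (Fin (curlDim d)) (Fin (curlDim d)) ℝ}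
  {eps : ι → Matrix (Fin d) (Fin d) ℝ} {σ : ι → ℝ} {je : E d → Fin d → ℂ} {ρ : E d → ℂ}
  {u : E d → Fin d → ℂ} {p : E d → ℂ} {tc : ι → E d → Fin (curlDim d) → ℂ}
  {Gc : ι → Fin (curlDim d) → Fin d → E d → ℂ} {tp : ι → E d → ℂ} {Gp : ι → Fin d → E d → ℂ}

theorem SolvesElectric.memLp_residual (hΩ_reg : interior (closure Ω) = Ω)
    (hje : MemLp je 2 (volume.restrict Ω))
    (hup : M.SolvesElectric ω mu eps σ je ρ u p)
    (hc : ∀ i, M.IsWeakDiffVec i (fun x => rmul (mu i)⁻¹ (weakCurl Ω u x)) (tc i) (Gc i))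
    (hp : ∀ i, M.IsWeakDiff i p (tp i) (Gp i)) (i : ι) :
    MemLp (residual ω (σ i) (eps i) je u (Gc i) (Gp i)) 2 (M.vol i) :=
  (((((hc i).memLp_adjCurlOf M).add (memLp_lowCoeff _ _ _
    (M.memLp_elem hΩ_reg hup.1.1.choose_spec.1 i))).add
    (memLp_rmul _ (MemLp.of_eval (hp i).memLp_grad))).add
    (show MemLp (fun x => (Complex.I * (ω : ℂ)) • je x) 2 (M.vol i) from
      (M.memLp_elem hΩ_reg hje i).const_smul (Complex.I * (ω : ℂ))))

/-- The variational equation is tested with a piecewise smooth conforming field and all derivatives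
are moved onto c and p. What remains is the strong residual in the elements and the fluxes on the
faces, which later choices of V separate. -/
theorem SolvesElectric.integral_pw (hd : d = 2 ∨ d = 3) (hΩ_open : IsOpen Ω)
    (hΩ_reg : interior (closure Ω) = Ω) (hΩ : Bornology.IsBounded Ω)
    (heps : ∀ i, (eps i).PosDef) (hje : MemLp je 2 (volume.restrict Ω))
    (hup : M.SolvesElectric ω mu eps σ je ρ u p)
    (hc : ∀ i, M.IsWeakDiffVec i (fun x => rmul (mu i)⁻¹ (weakCurl Ω u x)) (tc i) (Gc i))
    (hp : ∀ i, M.IsWeakDiff i p (tp i) (Gp i)) {V : ι → E d → Fin d → ℂ}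
    (hV : ∀ i j, ContDiff ℝ 1 (fun x => V i x j))
    (hj : ∀ e, ∀ x ∈ M.face e, ∑ i ∈ M.owners e, cross (V i x) (cvec (M.normal i e)) = 0)
    (hj' : ∀ e, M.face e ⊆ Ω → ∀ x ∈ M.face e,
      ∑ i ∈ M.owners e, rmul (eps i) (V i x) ⬝ᵥ cvec (M.normal i e) = 0) :
    ∑ i, (∫ x, residual ω (σ i) (eps i) je u (Gc i) (Gp i) x ⬝ᵥ V i x ∂(M.vol i) -
      M.bdInt i (fun e x => tc i x ⬝ᵥ cross (V i x) (cvec (M.normal i e)) +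
        tp i x * (rmul (eps i) (V i x) ⬝ᵥ cvec (M.normal i e)))) = 0 := by
  have hd2 : 2 ≤ d := by omega
  have hεV : ∀ i j, ContDiff ℝ 1 (fun x => rmul (eps i) (V i x) j) := fun i j =>
    show ContDiff ℝ 1 (fun x => ∑ l, (eps i j l : ℂ) * V i x l) from
      ContDiff.sum fun l _ => contDiff_const.mul (hV i l)
  have hW := fun i => M.isWeakDiffVec_pw hd hΩ hV i
  have hεW := fun i => M.isWeakDiffVec_pw hd hΩ hεV i
  have hcurlV := M.hasWeakCurl_pw hd hΩ_reg hΩ hV hj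
  have hdivV := M.hasWeakDiv_pw hd hΩ_open hΩ_reg hΩ hεV hj'
  have hu : ∀ i, MemLp u 2 (M.vol i) := M.memLp_elem hΩ_reg hup.1.1.choose_spec.1
  have hjei := M.memLp_elem hΩ_reg hje
  have hVi := fun i => (hW i).memLp M
  have hdivi : ∀ i, MemLp (fun x => ∑ j, pd j (fun z => rmul (eps i) (V i z) j) x) 2 (M.vol i) :=
    fun i => memLp_finsetSum _ fun j _ => (hεW i j).memLp_grad j
  have main := hup.2.2.2.1 (M.pw V) (M.memHcurl0_pw hd hΩ_open hΩ_reg hΩ hV hj)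
    (by rw [rmul_pwConst_pw]; exact ⟨_, hdivV⟩)
  rw [rmul_pwConst_pw] at main
  have a1 : ∀ i, ∀ᵐ x ∂(M.vol i), rmul (mu i)⁻¹ (weakCurl Ω u x) ⬝ᵥ
      curlOf (fun j l => pd l (fun z => V i z j)) x =
      rmul (M.pwConst mu x)⁻¹ (weakCurl Ω u x) ⬝ᵥ weakCurl Ω (M.pw V) x := fun i => by
    filter_upwards [M.ae_mem_elem i, M.ae_elem_of_ae hΩ_reg (weakCurl_ae_eq hΩ_open hcurlV) i]
      with x hx h1
    rw [h1, M.pw_of_mem _ hx, M.pwConst_of_mem _ hx]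
  have a2 : ∀ i, ∀ᵐ x ∂(M.vol i), lowCoeff ω (σ i) (eps i) (u x) ⬝ᵥ V i x =
      lowCoeff ω (M.pwConst σ x) (M.pwConst eps x) (u x) ⬝ᵥ M.pw V x := fun i => by
    filter_upwards [M.ae_mem_elem i] with x hx
    rw [M.pw_of_mem _ hx, M.pwConst_of_mem _ hx, M.pwConst_of_mem _ hx]
  have a3 : ∀ i, ∀ᵐ x ∂(M.vol i), (∑ j, pd j (fun z => rmul (eps i) (V i z) j) x) * p x =
      weakDiv Ω (M.pw fun i x => rmul (eps i) (V i x)) x * p x := fun i => by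
    filter_upwards [M.ae_mem_elem i, M.ae_elem_of_ae hΩ_reg (weakDiv_ae_eq hΩ_open hdivV) i]
      with x hx h1
    rw [h1, M.pw_of_mem _ hx]
  have a4 : ∀ i, ∀ᵐ x ∂(M.vol i), ((Complex.I * ω) • je x) ⬝ᵥ V i x =
      ((Complex.I * ω) • je x) ⬝ᵥ M.pw V x := fun i => by
    filter_upwards [M.ae_mem_elem i] with x hx
    rw [M.pw_of_mem _ hx]
  have b1 := fun i => integrable_dotProduct ((hc i).memLp M) ((hW i).memLp_curlOf M)
  have b2 := fun i => integrable_dotProduct (memLp_lowCoeff ω (σ i) (eps i) (hu i)) (hVi i)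
  have b3 := fun i => integrable_mul_of_memLp (hdivi i) (hp i).memLp
  have b4 := fun i => integrable_dotProduct ((hjei i).const_smul (Complex.I * ω)) (hVi i)
  rw [M.integral_eq_sum hd2 hΩ_reg fun i => (b1 i).congr (a1 i),
    M.integral_eq_sum hd2 hΩ_reg fun i => (b2 i).congr (a2 i),
    M.integral_eq_sum hd2 hΩ_reg fun i => (b3 i).congr (a3 i),
    M.integral_eq_sum hd2 hΩ_reg fun i => (b4 i).congr (a4 i)] at main
  simp only [← integral_congr_ae (a1 _), ← integral_congr_ae (a2 _), ← integral_congr_ae (a3 _),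
    ← integral_congr_ae (a4 _)] at main
  rw [← sub_eq_zero, sub_neg_eq_add, ← Finset.sum_add_distrib, ← Finset.sum_sub_distrib,
    ← Finset.sum_add_distrib] at main
  rw [← main]
  refine Finset.sum_congr rfl fun i _ => ?_
  have c1 := integrable_dotProduct ((hc i).memLp_adjCurlOf M) (hVi i)
  have c3 := integrable_dotProduct (memLp_rmul (eps i) (MemLp.of_eval (hp i).memLp_grad)) (hVi i)
  have e0 : ∫ x, residual ω (σ i) (eps i) je u (Gc i) (Gp i) x ⬝ᵥ V i x ∂(M.vol i) =
      ∫ x, adjCurlOf (Gc i) x ⬝ᵥ V i x ∂(M.vol i) +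
      ∫ x, lowCoeff ω (σ i) (eps i) (u x) ⬝ᵥ V i x ∂(M.vol i) +
      ∫ x, rmul (eps i) (fun j => Gp i j x) ⬝ᵥ V i x ∂(M.vol i) +
      ∫ x, ((Complex.I * ω) • je x) ⬝ᵥ V i x ∂(M.vol i) := by
    have c2 := c1.add (b2 i)
    have c4 := c2.add c3
    rw [← integral_add c1 (b2 i)]
    erw [← integral_add c2 c3, ← integral_add c4 (b4 i)]
    refine integral_congr_ae (Eventually.of_forall fun x => ?_)
    simp only [residual, add_dotProduct, Pi.add_apply, Pi.smul_apply]
  rw [e0, M.integral_dotProduct_curl hd hΩ (hc i) (hV i),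
    IsWeakDiff.integral_mul_div M hd hΩ (hp i) (hεV i), M.bdInt_add]
  · simp only [rmul_dotProduct (heps i).1]
    ring
  · exact fun e he => integrable_dotProduct ((hc i).memLp_trace M he)
      (memLp_cross ((hW i).memLp_trace M he) _)
  · exact fun e he => integrable_mul_of_memLp ((hp i).memLp_trace e he)
      (memLp_dotProduct_const ((hεW i).memLp_trace M he) _)

theorem contDiff_smul_const {U : Set (E d)} {η : E d → ℂ} (hη : IsTest U η) (w : ι → Fin d → ℂ) (i : ι)
    (j : Fin d) : ContDiff ℝ 1 (fun x => (η x • w i) j) :=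
  hη.contDiff.mul contDiff_const

/-- A bump inside one element times a coordinate vector vanishes on every face. It is therefore
conforming and its flux terms are zero. -/
theorem SolvesElectric.residual_eq_zero (hd : d = 2 ∨ d = 3) (hΩ_open : IsOpen Ω)
    (hΩ_reg : interior (closure Ω) = Ω) (hΩ : Bornology.IsBounded Ω)
    (heps : ∀ i, (eps i).PosDef) (hje : MemLp je 2 (volume.restrict Ω))
    (hup : M.SolvesElectric ω mu eps σ je ρ u p)
    (hc : ∀ i, M.IsWeakDiffVec i (fun x => rmul (mu i)⁻¹ (weakCurl Ω u x)) (tc i) (Gc i))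
    (hp : ∀ i, M.IsWeakDiff i p (tp i) (Gp i)) (i : ι) :
    ∀ᵐ x ∂(M.vol i), residual ω (σ i) (eps i) je u (Gc i) (Gp i) x = 0 := by
  have hR := hup.memLp_residual hΩ_reg hje hc hp
  have : ∀ j, ∀ᵐ x ∂(M.vol i), residual ω (σ i) (eps i) je u (Gc i) (Gp i) x j = 0 := fun j =>
    ae_eq_zero_of_isTest (M.elem_open i) ((hR i).eval j) fun η hη => by
      have h0 : ∀ e, ∀ x ∈ M.face e, η x = 0 := fun e x hx => hη.eq_zero fun h =>
        Set.disjoint_left.1 (M.disjoint_elem_face e) h hx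
      have main := hup.integral_pw hd hΩ_open hΩ_reg hΩ heps hje hc hp
        (V := fun _ x => η x • Pi.single j 1) (fun i => contDiff_smul_const hη (fun _ => Pi.single j 1) i)
        (fun e x hx => Finset.sum_eq_zero fun i _ => by
          rw [h0 e x hx, zero_smul]; ext; simp [cross])
        (fun e _ x hx => Finset.sum_eq_zero fun i _ => by
          rw [h0 e x hx, zero_smul, rmul_zero, zero_dotProduct])
      rw [Finset.sum_eq_single i, M.bdInt_eq_zero_of_isTest hη, sub_zero] at main
      · simp only [dotProduct_smul, dotProduct_single, mul_one, smul_eq_mul] at main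
        rw [← main, vol]
        simp only [mul_comm]
      · intro e x hx
        rw [hx, zero_smul, rmul_zero, zero_dotProduct, mul_zero, add_zero]
        simp [cross, dotProduct]
      · intro l _ hl
        rw [M.bdInt_eq_zero_of_isTest hη, sub_zero]
        · refine integral_eq_zero_of_ae ?_
          filter_upwards [M.ae_mem_elem l] with x hx
          rw [hη.eq_zero fun h => Set.disjoint_left.1 (M.elem_disjoint hl) hx h]
          simp
        · intro e x hx
          rw [hx, zero_smul, rmul_zero, zero_dotProduct, mul_zero, add_zero]
          simp [cross, dotProduct]
      · simp
  filter_upwards [ae_all_iff.2 this] with x hx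
  ext j
  exact hx j

/-- The test field is η w i on the element i, with η supported away from the other faces. The
hypotheses on w are exactly the conformity conditions on e. The volume terms vanish by the strong
equation and only the flux through e survives. -/
theorem SolvesElectric.flux_jump_aux (hd : d = 2 ∨ d = 3) (hΩ_open : IsOpen Ω)
    (hΩ_reg : interior (closure Ω) = Ω) (hΩ : Bornology.IsBounded Ω)
    (heps : ∀ i, (eps i).PosDef) (hje : MemLp je 2 (volume.restrict Ω))
    (hup : M.SolvesElectric ω mu eps σ je ρ u p)
    (hc : ∀ i, M.IsWeakDiffVec i (fun x => rmul (mu i)⁻¹ (weakCurl Ω u x)) (tc i) (Gc i))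
    (hp : ∀ i, M.IsWeakDiff i p (tp i) (Gp i)) (e : κ) (w : ι → Fin d → ℂ)
    (hw : ∑ i ∈ M.owners e, cross (w i) (cvec (M.normal i e)) = 0)
    (hw' : M.face e ⊆ Ω → ∑ i ∈ M.owners e, rmul (eps i) (w i) ⬝ᵥ cvec (M.normal i e) = 0) :
    ∀ᵐ x ∂(M.surf e), ∑ i ∈ M.owners e, (tc i x ⬝ᵥ cross (w i) (cvec (M.normal i e)) +
      tp i x * (rmul (eps i) (w i) ⬝ᵥ cvec (M.normal i e))) = 0 := by
  have hd2 : 2 ≤ d := by omega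
  have := M.surf_lt_top hd2 hΩ e
  refine M.jump_eq_zero hd2 (fun i hi => ?_) isOpen_univ (Set.subset_univ _) fun η hη => ?_
  · exact ((memLp_dotProduct_const ((hc i).memLp_trace M hi) _).add
      (((hp i).memLp_trace e hi).mul_const _)).integrable one_le_two
  have h0 : ∀ f, f ≠ e → ∀ x ∈ M.face f, η x = 0 := fun f hf x hx =>
    M.IsTest_eq_zero_of_mem_otherFaces hf hη hx
  have hres := hup.residual_eq_zero hd hΩ_open hΩ_reg hΩ heps hje hc hp
  have main := hup.integral_pw hd hΩ_open hΩ_reg hΩ heps hje hc hp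
    (V := fun i x => η x • w i) (fun i => contDiff_smul_const hη _ i)
    (fun f x hx => by
      simp only [cross_smul_left, ← Finset.smul_sum]
      by_cases hf : f = e
      · subst hf; rw [hw, smul_zero]
      · rw [h0 f hf x hx, zero_smul])
    (fun f hfΩ x hx => by
      simp only [rmul_smul, smul_dotProduct, ← Finset.smul_sum]
      by_cases hf : f = e
      · subst hf; rw [hw' hfΩ, smul_zero]
      · rw [h0 f hf x hx, zero_smul])
  have hz : ∀ i, ∫ x, residual ω (σ i) (eps i) je u (Gc i) (Gp i) x ⬝ᵥ (η x • w i)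
      ∂(M.vol i) = 0 := fun i => integral_eq_zero_of_ae <| by
    filter_upwards [hres i] with x hx
    rw [hx, zero_dotProduct]; rfl
  simp only [hz, zero_sub, Finset.sum_neg_distrib, neg_eq_zero] at main
  rw [M.sum_bdInt_eq_single (e := e)] at main
  · rw [← main]
    refine Finset.sum_congr rfl fun i _ => ?_
    refine integral_congr_ae (Eventually.of_forall fun x => ?_)
    simp only [cross_smul_left, rmul_smul, smul_dotProduct, dotProduct_smul, smul_eq_mul]
    ring
  · intro i f hf x hx
    simp [h0 f hf x hx, cross_zero_left, rmul_zero]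

/-- The one-sided vectors w i = a + s i n have the tangential part of a, since n × n = 0, and s i
solves ε(a + s n) · n = b · n. Thus tangential data a and normal data b are independent, even where
ε jumps. -/
theorem SolvesElectric.flux_jump_const (hd : d = 2 ∨ d = 3) (hΩ_open : IsOpen Ω)
    (hΩ_reg : interior (closure Ω) = Ω) (hΩ : Bornology.IsBounded Ω)
    (heps : ∀ i, (eps i).PosDef) (hje : MemLp je 2 (volume.restrict Ω))
    (hup : M.SolvesElectric ω mu eps σ je ρ u p)
    (hc : ∀ i, M.IsWeakDiffVec i (fun x => rmul (mu i)⁻¹ (weakCurl Ω u x)) (tc i) (Gc i))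
    (hp : ∀ i, M.IsWeakDiff i p (tp i) (Gp i)) (e : κ) (a b : Fin d → ℂ)
    (ha : ∑ i ∈ M.owners e, cross a (cvec (M.normal i e)) = 0)
    (hb : M.face e ⊆ Ω → ∑ i ∈ M.owners e, b ⬝ᵥ cvec (M.normal i e) = 0) :
    ∀ᵐ x ∂(M.surf e), ∑ i ∈ M.owners e, (tc i x ⬝ᵥ cross a (cvec (M.normal i e)) +
      tp i x * (b ⬝ᵥ cvec (M.normal i e))) = 0 := by
  set s : ι → ℂ := fun i => (b ⬝ᵥ cvec (M.normal i e) - rmul (eps i) a ⬝ᵥ cvec (M.normal i e)) /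
    (rmul (eps i) (cvec (M.normal i e)) ⬝ᵥ cvec (M.normal i e)) with hs
  set w : ι → Fin d → ℂ := fun i => a + s i • cvec (M.normal i e) with hwdef
  have h1 : ∀ i, cross (w i) (cvec (M.normal i e)) = cross a (cvec (M.normal i e)) := fun i => by
    rw [hwdef, cross_add_left, cross_smul_left, cross_self hd, smul_zero, add_zero]
  have h2 : ∀ i ∈ M.owners e,
      rmul (eps i) (w i) ⬝ᵥ cvec (M.normal i e) = b ⬝ᵥ cvec (M.normal i e) := fun i hi => by
    have hn := rmul_cvec_dotProduct_cvec_ne_zero (heps i)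
      (M.normal_unit i e (M.mem_faces.1 (M.mem_owners.1 hi)))
    rw [hwdef, rmul_add, rmul_smul, add_dotProduct, smul_dotProduct, hs, smul_eq_mul,
      div_mul_cancel₀ _ hn]
    ring
  have main := hup.flux_jump_aux hd hΩ_open hΩ_reg hΩ heps hje hc hp e w
    (by simpa only [h1] using ha) (fun h => by rw [Finset.sum_congr rfl h2, hb h])
  filter_upwards [main] with x hx
  rw [← hx]
  exact Finset.sum_congr rfl fun i hi => by rw [h1, h2 i hi]

theorem sum_owners_eq_zero (hd : 2 ≤ d) (hΩ_open : IsOpen Ω) {e : κ} (he : M.face e ⊆ Ω)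
    {A : Type*} [AddCommGroup A] {f : E d → A} (hf : ∀ n, f (-n) = -f n) :
    ∑ i ∈ M.owners e, f (M.normal i e) = 0 := by
  classical
  obtain ⟨j, hij, hj, ho⟩ := M.exists_owners_eq_pair hd hΩ_open (M.owner_mem e) he
  rw [ho, Finset.sum_pair hij, M.normal_neg_of_ne hd (M.owner_mem e) hj hij, hf, add_neg_cancel]

theorem eq_sum_single (a : Fin d → ℂ) : a = ∑ j, a j • Pi.single j (1 : ℂ) := by
  ext l
  simp [Finset.sum_apply, Pi.single_apply]

/-- With a = b a coordinate vector both compatibility conditions hold because the two normals are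
opposite. Finitely many vectors share one null set, and linearity then gives all a outside it, so
that a may depend on the point. -/
theorem SolvesElectric.flux_jump_interior (hd : d = 2 ∨ d = 3) (hΩ_open : IsOpen Ω)
    (hΩ_reg : interior (closure Ω) = Ω) (hΩ : Bornology.IsBounded Ω)
    (heps : ∀ i, (eps i).PosDef) (hje : MemLp je 2 (volume.restrict Ω))
    (hup : M.SolvesElectric ω mu eps σ je ρ u p)
    (hc : ∀ i, M.IsWeakDiffVec i (fun x => rmul (mu i)⁻¹ (weakCurl Ω u x)) (tc i) (Gc i))
    (hp : ∀ i, M.IsWeakDiff i p (tp i) (Gp i)) {e : κ} (he : M.face e ⊆ Ω) :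
    ∀ᵐ x ∂(M.surf e), ∀ a, ∑ i ∈ M.owners e, (tc i x ⬝ᵥ cross a (cvec (M.normal i e)) +
      tp i x * (a ⬝ᵥ cvec (M.normal i e))) = 0 := by
  have hd2 : 2 ≤ d := by omega
  have main := fun j : Fin d => hup.flux_jump_const hd hΩ_open hΩ_reg hΩ heps hje hc hp e
    (Pi.single j 1) (Pi.single j 1)
    (sum_owners_eq_zero hd2 hΩ_open he (f := fun n => cross (Pi.single j 1) (cvec n))
      fun n => by rw [cvec_neg, cross_neg_right])
    (fun _ => sum_owners_eq_zero hd2 hΩ_open he (f := fun n => Pi.single j 1 ⬝ᵥ cvec n)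
      fun n => by rw [cvec_neg, dotProduct_neg])
  filter_upwards [ae_all_iff.2 main] with x hx a
  have h1 : ∀ i, tc i x ⬝ᵥ cross a (cvec (M.normal i e)) + tp i x * (a ⬝ᵥ cvec (M.normal i e)) =
      ∑ j, a j * (tc i x ⬝ᵥ cross (Pi.single j 1) (cvec (M.normal i e)) +
        tp i x * (Pi.single j 1 ⬝ᵥ cvec (M.normal i e))) := fun i => by
    conv_lhs => rw [eq_sum_single a]
    rw [← crossLin_apply, map_sum, dotProduct_sum, sum_dotProduct, Finset.mul_sum,
      ← Finset.sum_add_distrib]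
    refine Finset.sum_congr rfl fun j _ => ?_
    rw [map_smul, crossLin_apply, dotProduct_smul, smul_dotProduct, smul_eq_mul, smul_eq_mul]
    ring
  simp only [h1]
  rw [Finset.sum_comm]
  simp only [← Finset.mul_sum, hx, mul_zero, Finset.sum_const_zero]

/-- On Γ the test space restricts only the tangential part, so a = 0 and b = n are admissible. The
vanishing of p is the natural boundary condition. -/
theorem SolvesElectric.flux_jump_boundary (hd : d = 2 ∨ d = 3) (hΩ_open : IsOpen Ω)
    (hΩ_reg : interior (closure Ω) = Ω) (hΩ : Bornology.IsBounded Ω)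
    (heps : ∀ i, (eps i).PosDef) (hje : MemLp je 2 (volume.restrict Ω))
    (hup : M.SolvesElectric ω mu eps σ je ρ u p)
    (hc : ∀ i, M.IsWeakDiffVec i (fun x => rmul (mu i)⁻¹ (weakCurl Ω u x)) (tc i) (Gc i))
    (hp : ∀ i, M.IsWeakDiff i p (tp i) (Gp i)) {e : κ} (he : M.face e ⊆ frontier Ω) :
    ∀ᵐ x ∂(M.surf e), ∀ i ∈ M.owners e, tp i x = 0 := by
  have hd2 : 2 ≤ d := by omega
  have hn := cvec_dotProduct_cvec (M.normal_unit (M.owner e) e (M.mem_faces.1 (M.owner_mem e)))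
  have main := hup.flux_jump_const hd hΩ_open hΩ_reg hΩ heps hje hc hp e
    0 (cvec (M.normal (M.owner e) e)) (by simp [cross_zero_left])
    (fun h => by
      obtain ⟨x, hx⟩ := M.face_nonempty hd2 e
      have := he hx
      rw [hΩ_open.frontier_eq] at this
      exact absurd (h hx) this.2)
  rw [M.owners_eq_singleton hd2 hΩ_open hΩ_reg (M.owner_mem e) he] at main ⊢
  filter_upwards [main] with x hx i hi
  rw [Finset.mem_singleton] at hi
  subst hi
  simpa [cross_zero_left, hn] using hx

/-- The flux `c × n` and the pressure have no jumps that a conforming boundary field could see. -/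
theorem SolvesElectric.sum_bdInt_flux (hd : d = 2 ∨ d = 3) (hΩ_open : IsOpen Ω)
    (hΩ_reg : interior (closure Ω) = Ω) (hΩ : Bornology.IsBounded Ω)
    (heps : ∀ i, (eps i).PosDef) (hje : MemLp je 2 (volume.restrict Ω))
    (hup : M.SolvesElectric ω mu eps σ je ρ u p)
    (hc : ∀ i, M.IsWeakDiffVec i (fun x => rmul (mu i)⁻¹ (weakCurl Ω u x)) (tc i) (Gc i))
    (hp : ∀ i, M.IsWeakDiff i p (tp i) (Gp i)) {b : κ → E d → Fin d → ℂ}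
    (hb : ∀ e, MemLp (b e) 2 (M.surf e))
    (hb0 : ∀ e, M.face e ⊆ frontier Ω → ∀ i, e ∈ M.faces i →
      ∀ x ∈ M.face e, cross (b e x) (cvec (M.normal i e)) = 0) :
    ∑ i, M.bdInt i (fun e x => tc i x ⬝ᵥ cross (b e x) (cvec (M.normal i e)) +
      tp i x * (b e x ⬝ᵥ cvec (M.normal i e))) = 0 := by
  refine M.sum_bdInt_eq_zero (fun i e he => ?_) fun e => ?_
  · exact (integrable_dotProduct ((hc i).memLp_trace M he) (memLp_cross (hb e) _)).add
      (integrable_mul_of_memLp ((hp i).memLp_trace e he) (memLp_dotProduct_const (hb e) _))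
  rcases M.face_position e with he | he
  · filter_upwards [hup.flux_jump_interior hd hΩ_open hΩ_reg hΩ heps hje hc hp he] with x hx
      using hx _
  · filter_upwards [M.ae_mem_face e,
      hup.flux_jump_boundary hd hΩ_open hΩ_reg hΩ heps hje hc hp he] with x hxe hx
    -- On Γ the two terms vanish separately: the first because b × n = 0 there, the second because
    -- the trace of p is zero.
    refine Finset.sum_eq_zero fun i hi => ?_
    rw [hb0 e he i (M.mem_owners.1 hi) x hxe, hx i hi, dotProduct_zero, zero_mul, add_zero]

end Electric

end Mesh

/-! ### Polynomial fields and orthogonality of the projections -/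

section Polynomials

variable {d N : ℕ} {r : ℕ}

theorem isPolyOn_univ_iff {f : E d → Fin N → ℂ} : IsPolyOn r Set.univ f ↔
    ∃ P : Fin N → MvPolynomial (Fin d) ℂ, (∀ j, (P j).totalDegree ≤ r) ∧
      f = fun x j => ev (P j) x := by
  constructor
  · rintro ⟨P, hP, h⟩
    exact ⟨P, hP, by ext x j; exact h x trivial j⟩
  · rintro ⟨P, hP, rfl⟩
    exact ⟨P, hP, fun _ _ _ => rfl⟩

theorem isPolyOn_iff_mem {S : Set (E d)} {f : E d → Fin N → ℂ} : IsPolyOn r S f ↔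
    ∃ P : Fin N → MvPolynomial (Fin d) ℂ,
      (∀ j, P j ∈ MvPolynomial.restrictTotalDegree (Fin d) ℂ r) ∧
      ∀ x ∈ S, ∀ j, f x j = ev (P j) x := by
  simp only [IsPolyOn, MvPolynomial.mem_restrictTotalDegree]

theorem IsPolyOn.contDiff {f : E d → Fin N → ℂ} (h : IsPolyOn r Set.univ f) (j : Fin N) :
    ContDiff ℝ 1 (fun x => f x j) := by
  obtain ⟨P, -, rfl⟩ := isPolyOn_univ_iff.1 h
  exact (contDiff_ev (P j)).of_le (by exact_mod_cast le_top)

theorem IsPolyOn.mono_deg {S : Set (E d)} {s : ℕ} {f : E d → Fin N → ℂ} (h : IsPolyOn r S f)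
    (hrs : r ≤ s) : IsPolyOn s S f := by
  obtain ⟨P, hP, hf⟩ := h
  exact ⟨P, fun j => (hP j).trans hrs, hf⟩

theorem IsPolyOn.mono_set {S T : Set (E d)} {f : E d → Fin N → ℂ} (h : IsPolyOn r S f)
    (hST : T ⊆ S) : IsPolyOn r T f := by
  obtain ⟨P, hP, hf⟩ := h
  exact ⟨P, hP, fun x hx => hf x (hST hx)⟩

theorem IsPolyOn.comb {S : Set (E d)} {f : E d → Fin N → ℂ} (h : IsPolyOn r S f) {N' : ℕ}
    (A : Fin N' → Fin N → ℂ) : IsPolyOn r S (fun x j => ∑ l, A j l * f x l) := by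
  obtain ⟨P, hP, hf⟩ := isPolyOn_iff_mem.1 h
  refine isPolyOn_iff_mem.2 ⟨fun j => ∑ l, A j l • P l, fun j => Submodule.sum_mem _ fun l _ =>
    Submodule.smul_mem _ _ (hP l), fun x hx j => ?_⟩
  rw [ev_sum]
  exact Finset.sum_congr rfl fun l _ => by rw [ev_smul, hf x hx]

theorem IsPolyOn.add {S : Set (E d)} {f g : E d → Fin N → ℂ} (hf : IsPolyOn r S f)
    (hg : IsPolyOn r S g) : IsPolyOn r S (fun x => f x + g x) := by
  obtain ⟨P, hP, hf⟩ := isPolyOn_iff_mem.1 hf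
  obtain ⟨Q, hQ, hg⟩ := isPolyOn_iff_mem.1 hg
  exact isPolyOn_iff_mem.2 ⟨fun j => P j + Q j, fun j => Submodule.add_mem _ (hP j) (hQ j),
    fun x hx j => by rw [Pi.add_apply, ev_add, hf x hx, hg x hx]⟩

theorem IsPolyOn.sub {S : Set (E d)} {f g : E d → Fin N → ℂ} (hf : IsPolyOn r S f)
    (hg : IsPolyOn r S g) : IsPolyOn r S (fun x => f x - g x) := by
  obtain ⟨P, hP, hf⟩ := isPolyOn_iff_mem.1 hf
  obtain ⟨Q, hQ, hg⟩ := isPolyOn_iff_mem.1 hg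
  exact isPolyOn_iff_mem.2 ⟨fun j => P j - Q j, fun j => Submodule.sub_mem _ (hP j) (hQ j),
    fun x hx j => by rw [Pi.sub_apply, ev_sub, hf x hx, hg x hx]⟩

theorem IsPolyOn.rmul {S : Set (E d)} {f : E d → Fin N → ℂ} (h : IsPolyOn r S f)
    (A : Matrix (Fin N) (Fin N) ℝ) : IsPolyOn r S (fun x => rmul A (f x)) :=
  h.comb fun i j => (A i j : ℂ)

theorem IsPolyOn.const_smul {S : Set (E d)} {f : E d → Fin N → ℂ} (h : IsPolyOn r S f) (c : ℂ) :
    IsPolyOn r S (fun x => c • f x) := by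
  obtain ⟨P, hP, hf⟩ := isPolyOn_iff_mem.1 h
  exact isPolyOn_iff_mem.2 ⟨fun j => c • P j, fun j => Submodule.smul_mem _ _ (hP j),
    fun x hx j => by rw [Pi.smul_apply, ev_smul, hf x hx, smul_eq_mul]⟩

/-- Linear combinations of first derivatives of polynomials. -/
theorem IsPolyOn.comb_pd {f : E d → Fin N → ℂ} (h : IsPolyOn r Set.univ f) {N' : ℕ}
    (A : Fin N' → Fin N → Fin d → ℂ) :
    IsPolyOn (r - 1) Set.univ (fun x j => ∑ m, ∑ l, A j m l * pd l (fun y => f y m) x) := by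
  obtain ⟨P, hP, rfl⟩ := isPolyOn_univ_iff.1 h
  refine isPolyOn_iff_mem.2 ⟨fun j => ∑ m, ∑ l, A j m l • MvPolynomial.pderiv l (P m),
    fun j => Submodule.sum_mem _ fun m _ => Submodule.sum_mem _ fun l _ =>
    Submodule.smul_mem _ _ ?_, fun x _ j => ?_⟩
  · rw [MvPolynomial.mem_restrictTotalDegree]
    exact (totalDegree_pderiv_le (P m) l).trans (Nat.sub_le_sub_right (hP m) 1)
  · rw [ev_sum]
    refine Finset.sum_congr rfl fun m _ => ?_
    rw [ev_sum]
    exact Finset.sum_congr rfl fun l _ => by rw [ev_smul, ← pd_ev]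

theorem IsPolyOn.testCurl {f : E d → Fin (curlDim d) → ℂ} (h : IsPolyOn r Set.univ f) :
    IsPolyOn (r - 1) Set.univ (WG.testCurl f) :=
  h.comb_pd fun j m l => crossCoeff d m j l

theorem IsPolyOn.curlOf {f : E d → Fin d → ℂ} (h : IsPolyOn r Set.univ f) :
    IsPolyOn (r - 1) Set.univ (Mesh.curlOf fun j l => pd l (fun z => f z j)) := by
  have := h.comb_pd fun m j l => -crossCoeff d m j l
  convert this using 3 with x m
  simp only [Mesh.curlOf, neg_mul, Finset.sum_neg_distrib]

theorem IsPolyOn.divergence {f : E d → Fin d → ℂ} (h : IsPolyOn r Set.univ f) :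
    IsPolyOn (N := 1) (r - 1) Set.univ (fun x _ => ∑ j, pd j (fun z => f z j) x) := by
  have := h.comb_pd (N' := 1) fun _ m l => if m = l then 1 else 0
  simpa using this

theorem IsPolyOn.grad {f : E d → ℂ} (h : IsPolyOn (N := 1) r Set.univ (fun x _ => f x)) :
    IsPolyOn (r - 1) Set.univ (fun x (j : Fin d) => pd j f x) := by
  have := h.comb_pd (N' := d) fun j _ l => if j = l then 1 else 0
  simpa using this

theorem IsPolyOn.lowCoeff {S : Set (E d)} {f : E d → Fin d → ℂ} (h : IsPolyOn r S f)
    (ω s : ℝ) (A : Matrix (Fin d) (Fin d) ℝ) :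
    IsPolyOn r S (fun x => Mesh.lowCoeff ω s A (f x)) :=
  (h.const_smul _).sub ((h.rmul A).const_smul _)

theorem projVec_spec {m : Measure (E d)} (hm : ∀ f : E d → ℂ, Continuous f → Integrable f m)
    (hm2 : ∀ f : E d → ℂ, Continuous f → MemLp f 2 m)
    (r : ℕ) {f : E d → Fin N → ℂ} (hf : MemLp f 2 m) :
    IsPolyOn r Set.univ (projVec m r f) ∧ ∀ φ : E d → Fin N → ℂ, IsPolyOn r Set.univ φ →
      ∫ x, projVec m r f x ⬝ᵥ φ x ∂m = ∫ x, f x ⬝ᵥ φ x ∂m := by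
  obtain ⟨P, hP, he, h⟩ := exists_projVec hm r (f := f)
    fun j g hg => integrable_mul_of_memLp (hf.eval j) (hm2 g hg)
  refine ⟨isPolyOn_univ_iff.2 ⟨P, hP, he⟩, fun φ hφ => ?_⟩
  obtain ⟨Q, hQ, rfl⟩ := isPolyOn_univ_iff.1 hφ
  rw [he]
  simp only [dotProduct]
  rw [integral_finsetSum _ fun j _ =>
      hm (fun x => ev (P j) x * ev (Q j) x) ((continuous_ev _).mul (continuous_ev _)),
    integral_finsetSum _ fun j _ =>
      integrable_mul_of_memLp (hf.eval j) (hm2 _ (continuous_ev _))]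
  exact Finset.sum_congr rfl fun j _ => h j _ (hQ j)

theorem proj_spec {m : Measure (E d)} (hm : ∀ f : E d → ℂ, Continuous f → Integrable f m)
    (hm2 : ∀ f : E d → ℂ, Continuous f → MemLp f 2 m)
    (r : ℕ) {f : E d → ℂ} (hf : MemLp f 2 m) :
    IsPolyOn (N := 1) r Set.univ (fun x _ => proj m r f x) ∧
      ∀ φ : E d → ℂ, IsPolyOn (N := 1) r Set.univ (fun x _ => φ x) →
      ∫ x, proj m r f x * φ x ∂m = ∫ x, f x * φ x ∂m := by
  obtain ⟨P, hP, he, h⟩ := exists_proj hm r (f := f)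
    fun g hg => integrable_mul_of_memLp hf (hm2 g hg)
  refine ⟨⟨fun _ => P, fun _ => hP, fun x _ _ => by rw [he]⟩, fun φ hφ => ?_⟩
  obtain ⟨Q, hQ, hφe⟩ := isPolyOn_univ_iff.1 hφ
  have : φ = ev (Q 0) := by ext x; exact congrFun (congrFun hφe x) 0
  rw [he, this]
  exact h _ (hQ 0)

end Polynomials

/-! ### The weak curl and the weak divergence -/

namespace Mesh

variable {d : ℕ} {Ω : Set (E d)} {ι κ : Type*} [Fintype ι] [Fintype κ] (M : Mesh d Ω ι κ)

theorem IsPolyOn.memLp_vol (hΩ : Bornology.IsBounded Ω) {N r : ℕ} {f : E d → Fin N → ℂ}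
    (h : IsPolyOn r Set.univ f) (i : ι) : MemLp f 2 (M.vol i) :=
  MemLp.of_eval fun j => M.memLp_vol_of_continuous hΩ i (h.contDiff j).continuous

theorem IsPolyOn.memLp_surf (hd : 2 ≤ d) (hΩ : Bornology.IsBounded Ω) {N r : ℕ}
    {f : E d → Fin N → ℂ} {e : κ} (h : IsPolyOn r (M.face e) f) : MemLp f 2 (M.surf e) := by
  obtain ⟨P, -, hf⟩ := h
  have : MemLp (fun x j => ev (P j) x) 2 (M.surf e) :=
    MemLp.of_eval fun j => M.memLp_surf_of_continuous hd hΩ e (continuous_ev (P j))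
  refine this.ae_eq ?_
  filter_upwards [M.ae_mem_face e] with x hx
  ext j
  exact (hf x hx j).symm

section Pairings

variable {i : ι} {a a' : E d → Fin d → ℂ} {b b' : κ → E d → Fin d → ℂ}

theorem memLp_testCurl (hΩ : Bornology.IsBounded Ω) (i : ι) {ψ : E d → Fin (curlDim d) → ℂ}
    (hψ : ∀ m, ContDiff ℝ 1 (fun x => ψ x m)) : MemLp (testCurl ψ) 2 (M.vol i) :=
  MemLp.of_eval fun _ => memLp_finsetSum _ fun l _ => memLp_finsetSum _ fun q _ =>
    (M.memLp_vol_of_continuous hΩ i (continuous_pd (hψ l) q)).const_mul _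

theorem pd_add {f g : E d → ℂ} (hf : ContDiff ℝ 1 f) (hg : ContDiff ℝ 1 g) (j : Fin d) (x : E d) :
    pd j (fun y => f y + g y) x = pd j f x + pd j g x := by
  rw [pd, fderiv_fun_add (hf.differentiable one_ne_zero x) (hg.differentiable one_ne_zero x)]
  rfl

theorem pd_const_mul {f : E d → ℂ} (hf : ContDiff ℝ 1 f) (c : ℂ) (j : Fin d) (x : E d) :
    pd j (fun y => c * f y) x = c * pd j f x := by
  rw [pd, fderiv_const_mul (hf.differentiable one_ne_zero x)]
  rfl

theorem testCurl_add {ψ ψ' : E d → Fin (curlDim d) → ℂ}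
    (hψ : ∀ m, ContDiff ℝ 1 (fun x => ψ x m)) (hψ' : ∀ m, ContDiff ℝ 1 (fun x => ψ' x m))
    (x : E d) : testCurl (fun y => ψ y + ψ' y) x = testCurl ψ x + testCurl ψ' x := by
  ext j
  simp only [testCurl, Pi.add_apply, ← Finset.sum_add_distrib]
  exact Finset.sum_congr rfl fun m _ => Finset.sum_congr rfl fun l _ => by
    rw [pd_add (hψ m) (hψ' m), mul_add]

theorem testCurl_const_smul {ψ : E d → Fin (curlDim d) → ℂ}
    (hψ : ∀ m, ContDiff ℝ 1 (fun x => ψ x m)) (c : ℂ)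
    (x : E d) : testCurl (fun y => c • ψ y) x = c • testCurl ψ x := by
  ext j
  simp only [testCurl, Pi.smul_apply, smul_eq_mul, Finset.mul_sum]
  exact Finset.sum_congr rfl fun m _ => Finset.sum_congr rfl fun l _ => by
    rw [pd_const_mul (hψ m)]; ring

theorem curlPair_add_right (hd : 2 ≤ d) (hΩ : Bornology.IsBounded Ω) (ha : MemLp a 2 (M.vol i))
    (hb : ∀ e ∈ M.faces i, MemLp (b e) 2 (M.surf e)) {ψ ψ' : E d → Fin (curlDim d) → ℂ}
    (hψ : ∀ m, ContDiff ℝ 1 (fun x => ψ x m)) (hψ' : ∀ m, ContDiff ℝ 1 (fun x => ψ' x m)) :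
    M.curlPair i a b (fun x => ψ x + ψ' x) = M.curlPair i a b ψ + M.curlPair i a b ψ' := by
  have hs : ∀ {χ : E d → Fin (curlDim d) → ℂ}, (∀ m, ContDiff ℝ 1 (fun x => χ x m)) →
      ∀ e ∈ M.faces i,
      Integrable (fun x => cross (b e x) (cvec (M.normal i e)) ⬝ᵥ χ x) (M.surf e) :=
    fun hχ e he => integrable_dotProduct (memLp_cross (hb e he) _)
      (MemLp.of_eval fun m => M.memLp_surf_of_continuous hd hΩ e (hχ m).continuous)
  simp only [curlPair, testCurl_add hψ hψ', dotProduct_add]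
  rw [integral_add (integrable_dotProduct ha (M.memLp_testCurl hΩ i hψ))
    (integrable_dotProduct ha (M.memLp_testCurl hΩ i hψ')), M.bdInt_add (hs hψ) (hs hψ')]
  ring

theorem curlPair_const_smul_right (c : ℂ) {ψ : E d → Fin (curlDim d) → ℂ}
    (hψ : ∀ m, ContDiff ℝ 1 (fun x => ψ x m)) :
    M.curlPair i a b (fun x => c • ψ x) = c * M.curlPair i a b ψ := by
  simp only [curlPair, testCurl_const_smul hψ, dotProduct_smul, smul_eq_mul, integral_const_mul,
    bdInt_const_mul]
  ring

theorem curlPair_sub_left (hd : 2 ≤ d) (hΩ : Bornology.IsBounded Ω) (ha : MemLp a 2 (M.vol i))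
    (ha' : MemLp a' 2 (M.vol i)) (hb : ∀ e ∈ M.faces i, MemLp (b e) 2 (M.surf e))
    (hb' : ∀ e ∈ M.faces i, MemLp (b' e) 2 (M.surf e)) {ψ : E d → Fin (curlDim d) → ℂ}
    (hψ : ∀ m, ContDiff ℝ 1 (fun x => ψ x m)) :
    M.curlPair i (fun x => a x - a' x) (fun e x => b e x - b' e x) ψ =
      M.curlPair i a b ψ - M.curlPair i a' b' ψ := by
  have hs : ∀ {β : κ → E d → Fin d → ℂ}, (∀ e ∈ M.faces i, MemLp (β e) 2 (M.surf e)) →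
      ∀ e ∈ M.faces i,
      Integrable (fun x => cross (β e x) (cvec (M.normal i e)) ⬝ᵥ ψ x) (M.surf e) :=
    fun hβ e he => integrable_dotProduct (memLp_cross (hβ e he) _)
      (MemLp.of_eval fun m => M.memLp_surf_of_continuous hd hΩ e (hψ m).continuous)
  simp only [curlPair, cross_sub_left, sub_dotProduct]
  rw [integral_sub (integrable_dotProduct ha (M.memLp_testCurl hΩ i hψ))
    (integrable_dotProduct ha' (M.memLp_testCurl hΩ i hψ)), M.bdInt_sub (hs hb) (hs hb')]
  ring

theorem integrable_sum_mul_pd (hΩ : Bornology.IsBounded Ω) (ha : MemLp a 2 (M.vol i)) {φ : E d → ℂ}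
    (hφ : ContDiff ℝ 1 φ) : Integrable (fun x => ∑ j, a x j * pd j φ x) (M.vol i) :=
  integrable_finsetSum _ fun j _ => integrable_mul_of_memLp (ha.eval j)
    (M.memLp_vol_of_continuous hΩ i (continuous_pd hφ j))

theorem divPair_add_right (hd : 2 ≤ d) (hΩ : Bornology.IsBounded Ω) (ha : MemLp a 2 (M.vol i))
    (hb : ∀ e ∈ M.faces i, MemLp (b e) 2 (M.surf e)) {φ φ' : E d → ℂ}
    (hφ : ContDiff ℝ 1 φ) (hφ' : ContDiff ℝ 1 φ') :
    M.divPair i a b (fun x => φ x + φ' x) = M.divPair i a b φ + M.divPair i a b φ' := by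
  have hs : ∀ {χ : E d → ℂ}, ContDiff ℝ 1 χ → ∀ e ∈ M.faces i,
      Integrable (fun x => (b e x ⬝ᵥ cvec (M.normal i e)) * χ x) (M.surf e) :=
    fun hχ e he => integrable_mul_of_memLp (memLp_dotProduct_const (hb e he) _)
      (M.memLp_surf_of_continuous hd hΩ e hχ.continuous)
  simp only [divPair, pd_add hφ hφ', mul_add, Finset.sum_add_distrib]
  rw [integral_add (M.integrable_sum_mul_pd hΩ ha hφ) (M.integrable_sum_mul_pd hΩ ha hφ'),
    M.bdInt_add (hs hφ) (hs hφ')]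
  ring

theorem divPair_const_mul_right (c : ℂ) {φ : E d → ℂ} (hφ : ContDiff ℝ 1 φ) :
    M.divPair i a b (fun x => c * φ x) = c * M.divPair i a b φ := by
  simp only [divPair, pd_const_mul hφ, mul_left_comm _ c, ← Finset.mul_sum, integral_const_mul,
    bdInt_const_mul]
  ring

theorem divPair_sub_left (hd : 2 ≤ d) (hΩ : Bornology.IsBounded Ω) (ha : MemLp a 2 (M.vol i))
    (ha' : MemLp a' 2 (M.vol i)) (hb : ∀ e ∈ M.faces i, MemLp (b e) 2 (M.surf e))
    (hb' : ∀ e ∈ M.faces i, MemLp (b' e) 2 (M.surf e)) {φ : E d → ℂ} (hφ : ContDiff ℝ 1 φ) :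
    M.divPair i (fun x => a x - a' x) (fun e x => b e x - b' e x) φ =
      M.divPair i a b φ - M.divPair i a' b' φ := by
  have hs : ∀ {β : κ → E d → Fin d → ℂ}, (∀ e ∈ M.faces i, MemLp (β e) 2 (M.surf e)) →
      ∀ e ∈ M.faces i,
      Integrable (fun x => (β e x ⬝ᵥ cvec (M.normal i e)) * φ x) (M.surf e) :=
    fun hβ e he => integrable_mul_of_memLp (memLp_dotProduct_const (hβ e he) _)
      (M.memLp_surf_of_continuous hd hΩ e hφ.continuous)
  simp only [divPair, sub_dotProduct, Pi.sub_apply, sub_mul, Finset.sum_sub_distrib]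
  rw [integral_sub (M.integrable_sum_mul_pd hΩ ha hφ) (M.integrable_sum_mul_pd hΩ ha' hφ),
    M.bdInt_sub (hs hb) (hs hb')]
  ring

/-- The element is open and its faces lie in its closure. So a polynomial that is zero almost
everywhere in the element contributes nothing on the boundary either, which is the compatibility
needed in `exists_polyRepr`. -/
theorem eq_zero_of_ae_eq_zero {f : E d → ℂ} (hf : Continuous f) (h : ∀ᵐ x ∂(M.vol i), f x = 0) :
    (∀ x ∈ M.elem i, f x = 0) ∧ ∀ e ∈ M.faces i, ∀ x ∈ M.face e, f x = 0 := by
  have h1 : ∀ x ∈ M.elem i, f x = 0 := fun x hx =>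
    Measure.eqOn_open_of_ae_eq (f := f) (g := fun _ => 0) h (M.elem_open i) hf.continuousOn
      continuousOn_const hx
  refine ⟨h1, fun e he x hx => ?_⟩
  have hx' : x ∈ closure (M.elem i) := frontier_subset_closure (M.mem_faces.1 he hx)
  exact closure_minimal (s := M.elem i) (t := {x | f x = 0}) h1
    (isClosed_eq hf continuous_const) hx'

theorem pd_eq_zero_of_eq_zero {f : E d → ℂ} (h : ∀ x ∈ M.elem i, f x = 0) (j : Fin d) :
    ∀ x ∈ M.elem i, pd j f x = 0 := fun x hx => by
  have : f =ᶠ[𝓝 x] fun _ => 0 := by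
    filter_upwards [(M.elem_open i).mem_nhds hx] with y hy using h y hy
  rw [pd, this.fderiv_eq]
  simp

theorem curlPair_eq_zero {ψ : E d → Fin (curlDim d) → ℂ}
    (hψ : ∀ m, ContDiff ℝ 1 (fun x => ψ x m)) (h : ∀ᵐ x ∂(M.vol i), ∀ m, ψ x m = 0) :
    M.curlPair i a b ψ = 0 := by
  have h' := fun m => M.eq_zero_of_ae_eq_zero (i := i) (hψ m).continuous
    (by filter_upwards [h] with x hx using hx m)
  rw [curlPair, M.bdInt_congr (g := fun _ _ => 0), integral_eq_zero_of_ae]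
  · simp [bdInt]
  · filter_upwards [M.ae_mem_elem i] with x hx
    refine Finset.sum_eq_zero fun j _ => ?_
    rw [testCurl, Finset.sum_eq_zero, mul_zero]
    exact fun m _ => Finset.sum_eq_zero fun l _ => by
      rw [M.pd_eq_zero_of_eq_zero (h' m).1 l x hx, mul_zero]
  · intro e he x hx
    exact Finset.sum_eq_zero fun m _ => by rw [(h' m).2 e he x hx, mul_zero]

theorem divPair_eq_zero {φ : E d → ℂ} (hφ : ContDiff ℝ 1 φ) (h : ∀ᵐ x ∂(M.vol i), φ x = 0) :
    M.divPair i a b φ = 0 := by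
  have h' := M.eq_zero_of_ae_eq_zero (i := i) hφ.continuous h
  rw [divPair, M.bdInt_congr (g := fun _ _ => 0), integral_eq_zero_of_ae]
  · simp [bdInt]
  · filter_upwards [M.ae_mem_elem i] with x hx
    exact Finset.sum_eq_zero fun j _ => by
      rw [M.pd_eq_zero_of_eq_zero h'.1 j x hx, mul_zero]
  · intro e he x hx
    rw [h'.2 e he x hx, mul_zero]

end Pairings

/-- The components of a weak function are square integrable. -/
def MemL2 (v : WeakField d ι κ) : Prop :=
  (∀ i, MemLp (v.1 i) 2 (M.vol i)) ∧ ∀ e, MemLp (v.2 e) 2 (M.surf e)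

variable {M}

theorem memL2_of_mem_Vh (hd : 2 ≤ d) (hΩ : Bornology.IsBounded Ω) {k : ℕ} {v : WeakField d ι κ}
    (hv : v ∈ M.Vh k) : M.MemL2 v :=
  ⟨fun i => IsPolyOn.memLp_vol M hΩ (hv.1 i) i, fun e => IsPolyOn.memLp_surf M hd hΩ (hv.2 e)⟩

/-- The defining functional is linear and kills fields that vanish almost everywhere in the element,
so `exists_polyRepr` applies. Afterwards only the pairing is used, never the chosen polynomial. -/
theorem MemL2.wcurl_spec (hd : 2 ≤ d) (hΩ : Bornology.IsBounded Ω) {v : WeakField d ι κ}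
    (hv : M.MemL2 v) (r : ℕ) (i : ι) :
    IsPolyOn r Set.univ (M.wcurl r v i) ∧ ∀ ψ, IsPolyOn r Set.univ ψ →
      ∫ x, M.wcurl r v i x ⬝ᵥ ψ x ∂(M.vol i) = M.curlPair i (v.1 i) v.2 ψ := by
  have hev : ∀ φ : Fin (curlDim d) → MvPolynomial (Fin d) ℂ,
      ∀ m, ContDiff ℝ 1 (fun x => ev (φ m) x) :=
    fun φ m => (contDiff_ev (φ m)).of_le (by exact_mod_cast le_top)
  obtain ⟨P, hP, he, h⟩ := exists_polyRepr (m := M.vol i)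
    (fun f hf => M.integrable_vol_of_continuous hΩ i hf) r
    (ℓ := fun φ => M.curlPair i (v.1 i) v.2 (fun x m => ev (φ m) x))
    ⟨fun φ φ' => by
      rw [← M.curlPair_add_right hd hΩ (hv.1 i) (fun e _ => hv.2 e) (hev φ) (hev φ')]
      congr 1; ext x m; simp [ev_add],
     fun c φ => by
      rw [smul_eq_mul, ← M.curlPair_const_smul_right c (hev φ)]
      congr 1; ext x m; simp [ev_smul]⟩
    (fun φ hφ => M.curlPair_eq_zero (hev φ) hφ)
  have he' : M.wcurl r v i = fun x j => ev (P j) x := he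
  refine ⟨isPolyOn_univ_iff.2 ⟨P, hP, he'⟩, fun ψ hψ => ?_⟩
  obtain ⟨Q, hQ, rfl⟩ := isPolyOn_univ_iff.1 hψ
  rw [he', ← h Q hQ]
  rfl

theorem MemL2.wdiv_spec (hd : 2 ≤ d) (hΩ : Bornology.IsBounded Ω) {v : WeakField d ι κ}
    (hv : M.MemL2 v) (r : ℕ) (A : ι → Matrix (Fin d) (Fin d) ℝ) (i : ι) :
    IsPolyOn (N := 1) r Set.univ (fun x _ => M.wdiv r A v i x) ∧
      ∀ φ, IsPolyOn (N := 1) r Set.univ (fun x _ => φ x) →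
      ∫ x, M.wdiv r A v i x * φ x ∂(M.vol i) =
        M.divPair i (fun x => rmul (A i) (v.1 i x)) v.2 φ := by
  have hev : ∀ φ : MvPolynomial (Fin d) ℂ, ContDiff ℝ 1 (ev φ) :=
    fun φ => (contDiff_ev φ).of_le (by exact_mod_cast le_top)
  have hav := memLp_rmul (A i) (hv.1 i)
  obtain ⟨P, hP, he, h⟩ := exists_polyRepr (N := 1) (m := M.vol i)
    (fun f hf => M.integrable_vol_of_continuous hΩ i hf) r
    (ℓ := fun φ => M.divPair i (fun x => rmul (A i) (v.1 i x)) v.2 (ev (φ 0)))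
    ⟨fun φ φ' => by
      rw [← M.divPair_add_right hd hΩ hav (fun e _ => hv.2 e) (hev _) (hev _)]
      congr 1; ext x; simp [ev_add],
     fun c φ => by
      rw [smul_eq_mul, ← M.divPair_const_mul_right c (hev _)]
      congr 1; ext x; simp [ev_smul]⟩
    (fun φ hφ => M.divPair_eq_zero (hev _) (by filter_upwards [hφ] with x hx using hx 0))
  -- The definition uses the formal derivative of a polynomial, the pairing the analytic one;
  -- `pd_ev` identifies them.
  have he' : M.wdiv r A v i = ev (P 0) := by
    ext x
    rw [← congrFun (congrFun he x) 0]
    simp only [wdiv, divPair, pd_ev]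
  refine ⟨⟨P, hP, fun x _ j => by rw [he', Subsingleton.elim j 0]⟩, fun φ hφ => ?_⟩
  obtain ⟨Q, hQ, hφe⟩ := isPolyOn_univ_iff.1 hφ
  have : φ = ev (Q 0) := by ext x; exact congrFun (congrFun hφe x) 0
  rw [he', this, ← h Q hQ]
  simp

end Mesh

/-! ### Linearity of the forms -/

namespace Mesh

variable {d : ℕ} {Ω : Set (E d)} {ι κ : Type*} [Fintype ι] [Fintype κ] {M : Mesh d Ω ι κ}

section Bilinearity

variable {k : ℕ} {ω : ℝ} {mu : ι → Matrix (Fin (curlDim d)) (Fin (curlDim d)) ℝ}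
  {eps : ι → Matrix (Fin d) (Fin d) ℝ} {σ : ι → ℝ} {v v' w : WeakField d ι κ}

theorem sub_mem_Vh (hv : v ∈ M.Vh k) (hv' : v' ∈ M.Vh k) : v - v' ∈ M.Vh k :=
  ⟨fun i => (hv.1 i).sub (hv'.1 i), fun e => (hv.2 e).sub (hv'.2 e)⟩

theorem sub_mem_Vh01 (hv : v ∈ M.Vh01 k) (hv' : v' ∈ M.Vh01 k) : v - v' ∈ M.Vh01 k := by
  refine ⟨sub_mem_Vh hv.1 hv'.1, fun e he i hi x hx => ?_⟩
  rw [Prod.snd_sub, Pi.sub_apply, Pi.sub_apply, cross_sub_left, hv.2 e he i hi x hx,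
    hv'.2 e he i hi x hx, sub_zero]

theorem sub_mem_Wh1 {q q' : ι → E d → ℂ} (hq : q ∈ M.Wh1 k) (hq' : q' ∈ M.Wh1 k) :
    q - q' ∈ M.Wh1 k := fun i => (hq i).sub (hq' i)

theorem integrable_jump_dotProduct (hd : 2 ≤ d) (hΩ : Bornology.IsBounded Ω) (hv : v ∈ M.Vh k)
    (hw : w ∈ M.Vh k) (A : Matrix (Fin d) (Fin d) ℝ) (i : ι) (n : Fin d → ℂ) (e : κ) :
    Integrable (fun x => ((rmul A (v.1 i x) - v.2 e x) ⬝ᵥ n) *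
      ((rmul A (w.1 i x) - w.2 e x) ⬝ᵥ n)) (M.surf e) := by
  have h : ∀ {z : WeakField d ι κ}, z ∈ M.Vh k →
      MemLp (fun x => (rmul A (z.1 i x) - z.2 e x) ⬝ᵥ n) 2 (M.surf e) := fun hz =>
    memLp_dotProduct_const ((IsPolyOn.memLp_surf M hd hΩ
      (((hz.1 i).mono_set (Set.subset_univ _)).rmul A)).sub
        (IsPolyOn.memLp_surf M hd hΩ (hz.2 e))) n
  exact integrable_mul_of_memLp (h hv) (h hw)

theorem memLp_jump (hd : 2 ≤ d) (hΩ : Bornology.IsBounded Ω) (hv : v ∈ M.Vh k) (i : ι) (e : κ) :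
    MemLp (fun x => v.1 i x - v.2 e x) 2 (M.surf e) :=
  (IsPolyOn.memLp_surf M hd hΩ ((hv.1 i).mono_set (Set.subset_univ _))).sub
        (IsPolyOn.memLp_surf M hd hΩ (hv.2 e))

theorem s1_sub_left (hd : 2 ≤ d) (hΩ : Bornology.IsBounded Ω) (hv : v ∈ M.Vh k)
    (hv' : v' ∈ M.Vh k) (hw : w ∈ M.Vh k) :
    M.s1 eps (v - v') w = M.s1 eps v w - M.s1 eps v' w := by
  have h1 : ∀ i, M.bdInt i (fun e x =>
        ((rmul (eps i) ((v - v').1 i x) - (v - v').2 e x) ⬝ᵥ cvec (M.normal i e)) *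
        ((rmul (eps i) (w.1 i x) - w.2 e x) ⬝ᵥ cvec (M.normal i e))) =
      M.bdInt i (fun e x =>
        ((rmul (eps i) (v.1 i x) - v.2 e x) ⬝ᵥ cvec (M.normal i e)) *
        ((rmul (eps i) (w.1 i x) - w.2 e x) ⬝ᵥ cvec (M.normal i e))) -
      M.bdInt i (fun e x =>
        ((rmul (eps i) (v'.1 i x) - v'.2 e x) ⬝ᵥ cvec (M.normal i e)) *
        ((rmul (eps i) (w.1 i x) - w.2 e x) ⬝ᵥ cvec (M.normal i e))) := fun i => by
    rw [← M.bdInt_sub (fun e _ => integrable_jump_dotProduct hd hΩ hv hw _ i _ e)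
      (fun e _ => integrable_jump_dotProduct hd hΩ hv' hw _ i _ e)]
    refine M.bdInt_congr fun e _ x _ => ?_
    rw [← sub_mul, ← sub_dotProduct]
    simp only [Prod.fst_sub, Prod.snd_sub, Pi.sub_apply, rmul_sub]
    congr 2
    abel
  have h2 : ∀ i, M.bdInt i (fun e x =>
        cross ((v - v').1 i x - (v - v').2 e x) (cvec (M.normal i e)) ⬝ᵥ
        cross (w.1 i x - w.2 e x) (cvec (M.normal i e))) =
      M.bdInt i (fun e x =>
        cross (v.1 i x - v.2 e x) (cvec (M.normal i e)) ⬝ᵥ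
        cross (w.1 i x - w.2 e x) (cvec (M.normal i e))) -
      M.bdInt i (fun e x =>
        cross (v'.1 i x - v'.2 e x) (cvec (M.normal i e)) ⬝ᵥ
        cross (w.1 i x - w.2 e x) (cvec (M.normal i e))) := fun i => by
    rw [← M.bdInt_sub (fun e _ => integrable_dotProduct (memLp_cross (memLp_jump hd hΩ hv i e) _)
        (memLp_cross (memLp_jump hd hΩ hw i e) _))
      (fun e _ => integrable_dotProduct (memLp_cross (memLp_jump hd hΩ hv' i e) _)
        (memLp_cross (memLp_jump hd hΩ hw i e) _))]
    refine M.bdInt_congr fun e _ x _ => ?_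
    rw [← sub_dotProduct, ← cross_sub_left]
    simp only [Prod.fst_sub, Prod.snd_sub, Pi.sub_apply]
    congr 2
    abel
  simp only [s1, h1, h2, mul_sub, ← Finset.sum_sub_distrib]
  exact Finset.sum_congr rfl fun i _ => by ring

/-- The matrix μ⁻¹ is constant and symmetric, so it can act on the second factor, which remains a
polynomial of degree at most r and is admissible in the definition of the first weak curl. -/
theorem MemL2.integral_wcurl (hd : 2 ≤ d) (hΩ : Bornology.IsBounded Ω)
    (hmu : ∀ i, (mu i).PosDef) (hv : M.MemL2 v) (hw : M.MemL2 w) (r : ℕ) (i : ι) :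
    ∫ x, rmul (mu i)⁻¹ (M.wcurl r v i x) ⬝ᵥ M.wcurl r w i x ∂(M.vol i) =
      M.curlPair i (v.1 i) v.2 (fun x => rmul (mu i)⁻¹ (M.wcurl r w i x)) := by
  rw [← (hv.wcurl_spec hd hΩ r i).2 _ ((hw.wcurl_spec hd hΩ r i).1.rmul _)]
  simp only [rmul_dotProduct (hmu i).1.inv]

/-- Additivity of the weak curl is read off the pairing with a fixed polynomial, so uniqueness of
the representing polynomials is not needed. -/
theorem a1_sub_left (hd : 2 ≤ d) (hΩ : Bornology.IsBounded Ω)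
    (hmu : ∀ i, (mu i).PosDef) (hv : v ∈ M.Vh k) (hv' : v' ∈ M.Vh k) (hw : w ∈ M.Vh k) :
    M.a1 k ω mu eps σ (v - v') w = M.a1 k ω mu eps σ v w - M.a1 k ω mu eps σ v' w := by
  have hs := s1_sub_left (eps := eps) hd hΩ hv hv' hw
  have hvv := memL2_of_mem_Vh hd hΩ (sub_mem_Vh hv hv')
  replace hv := memL2_of_mem_Vh hd hΩ hv
  replace hv' := memL2_of_mem_Vh hd hΩ hv'
  replace hw := memL2_of_mem_Vh hd hΩ hw
  have hc : ∀ i, M.curlPair i ((v - v').1 i) (v - v').2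
        (fun x => rmul (mu i)⁻¹ (M.wcurl (k - 1) w i x)) =
      M.curlPair i (v.1 i) v.2 (fun x => rmul (mu i)⁻¹ (M.wcurl (k - 1) w i x)) -
      M.curlPair i (v'.1 i) v'.2 (fun x => rmul (mu i)⁻¹ (M.wcurl (k - 1) w i x)) := fun i =>
    M.curlPair_sub_left hd hΩ (hv.1 i) (hv'.1 i) (fun e _ => hv.2 e) (fun e _ => hv'.2 e)
      (IsPolyOn.contDiff ((hw.wcurl_spec hd hΩ (k - 1) i).1.rmul _))
  have hl : ∀ i, ∫ x, lowCoeff ω (σ i) (eps i) ((v - v').1 i x) ⬝ᵥ w.1 i x ∂(M.vol i) =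
      ∫ x, lowCoeff ω (σ i) (eps i) (v.1 i x) ⬝ᵥ w.1 i x ∂(M.vol i) -
      ∫ x, lowCoeff ω (σ i) (eps i) (v'.1 i x) ⬝ᵥ w.1 i x ∂(M.vol i) := fun i => by
    rw [← integral_sub (integrable_dotProduct (memLp_lowCoeff ω (σ i) (eps i) (hv.1 i)) (hw.1 i))
      (integrable_dotProduct (memLp_lowCoeff ω (σ i) (eps i) (hv'.1 i)) (hw.1 i))]
    refine integral_congr_ae (Eventually.of_forall fun x => ?_)
    simp only [← sub_dotProduct]
    congr 1
    simp only [lowCoeff, Prod.fst_sub, Pi.sub_apply, rmul_sub, smul_sub]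
    abel
  simp only [a1, hvv.integral_wcurl hd hΩ hmu hw, hv.integral_wcurl hd hΩ hmu hw,
    hv'.integral_wcurl hd hΩ hmu hw, hs, hc, hl, Finset.sum_add_distrib, Finset.sum_sub_distrib]
  ring

theorem b1_eq (hd : 2 ≤ d) (hΩ : Bornology.IsBounded Ω) (hv : v ∈ M.Vh k) {q : ι → E d → ℂ}
    (hq : q ∈ M.Wh1 k) :
    M.b1 k eps v q = ∑ i, M.divPair i (fun x => rmul (eps i) (v.1 i x)) v.2 (q i) :=
  Finset.sum_congr rfl fun i _ =>
    ((memL2_of_mem_Vh hd hΩ hv).wdiv_spec hd hΩ (k - 1) eps i).2 _ (hq i)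

theorem b1_sub_left (hd : 2 ≤ d) (hΩ : Bornology.IsBounded Ω) (hv : v ∈ M.Vh k)
    (hv' : v' ∈ M.Vh k) {q : ι → E d → ℂ} (hq : q ∈ M.Wh1 k) :
    M.b1 k eps (v - v') q = M.b1 k eps v q - M.b1 k eps v' q := by
  rw [b1_eq hd hΩ hv hq, b1_eq hd hΩ hv' hq, b1_eq hd hΩ (sub_mem_Vh hv hv') hq,
    ← Finset.sum_sub_distrib]
  replace hv := memL2_of_mem_Vh hd hΩ hv
  replace hv' := memL2_of_mem_Vh hd hΩ hv'
  refine Finset.sum_congr rfl fun i _ => ?_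
  rw [← M.divPair_sub_left hd hΩ (memLp_rmul _ (hv.1 i)) (memLp_rmul _ (hv'.1 i))
    (fun e _ => hv.2 e) (fun e _ => hv'.2 e) ((hq i).contDiff 0)]
  simp only [Prod.fst_sub, Pi.sub_apply, rmul_sub]
  rfl

theorem b1_sub_right (hd : 2 ≤ d) (hΩ : Bornology.IsBounded Ω) (hv : v ∈ M.Vh k)
    {q q' : ι → E d → ℂ} (hq : q ∈ M.Wh1 k) (hq' : q' ∈ M.Wh1 k) :
    M.b1 k eps v (q - q') = M.b1 k eps v q - M.b1 k eps v q' := by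
  rw [b1, b1, b1, ← Finset.sum_sub_distrib]
  refine Finset.sum_congr rfl fun i _ => ?_
  have hw := ((((memL2_of_mem_Vh hd hΩ hv).wdiv_spec hd hΩ (k - 1) eps i).1).contDiff 0).continuous
  have hint : ∀ {g : ι → E d → ℂ}, g ∈ M.Wh1 k →
      Integrable (fun x => M.wdiv (k - 1) eps v i x * g i x) (M.vol i) := fun hg =>
    M.integrable_vol_of_continuous hΩ i (hw.mul ((hg i).contDiff 0).continuous)
  rw [← integral_sub (hint hq) (hint hq')]
  simp only [Pi.sub_apply, mul_sub]

end Bilinearity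

/-! ### Projections on elements and faces -/

section Projections

variable {k : ℕ} {u : E d → Fin d → ℂ} {eps : ι → Matrix (Fin d) (Fin d) ℝ}

theorem projVec_vol_spec (hΩ : Bornology.IsBounded Ω) {N : ℕ} (i : ι) (r : ℕ)
    {f : E d → Fin N → ℂ} (hf : MemLp f 2 (M.vol i)) :
    IsPolyOn r Set.univ (projVec (M.vol i) r f) ∧ ∀ φ : E d → Fin N → ℂ,
      IsPolyOn r Set.univ φ →
      ∫ x, projVec (M.vol i) r f x ⬝ᵥ φ x ∂(M.vol i) = ∫ x, f x ⬝ᵥ φ x ∂(M.vol i) :=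
  projVec_spec (fun _ hg => M.integrable_vol_of_continuous hΩ i hg)
    (fun _ hg => M.memLp_vol_of_continuous hΩ i hg) r hf

theorem proj_vol_spec (hΩ : Bornology.IsBounded Ω) (i : ι) (r : ℕ) {f : E d → ℂ}
    (hf : MemLp f 2 (M.vol i)) :
    IsPolyOn (N := 1) r Set.univ (fun x _ => proj (M.vol i) r f x) ∧ ∀ φ : E d → ℂ,
      IsPolyOn (N := 1) r Set.univ (fun x _ => φ x) →
      ∫ x, proj (M.vol i) r f x * φ x ∂(M.vol i) = ∫ x, f x * φ x ∂(M.vol i) :=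
  proj_spec (fun _ hg => M.integrable_vol_of_continuous hΩ i hg)
    (fun _ hg => M.memLp_vol_of_continuous hΩ i hg) r hf

theorem projVec_surf_spec (hd : 2 ≤ d) (hΩ : Bornology.IsBounded Ω) {N : ℕ} (e : κ) (r : ℕ)
    {f : E d → Fin N → ℂ} (hf : MemLp f 2 (M.surf e)) :
    IsPolyOn r Set.univ (projVec (M.surf e) r f) ∧ ∀ φ : E d → Fin N → ℂ,
      IsPolyOn r Set.univ φ →
      ∫ x, projVec (M.surf e) r f x ⬝ᵥ φ x ∂(M.surf e) = ∫ x, f x ⬝ᵥ φ x ∂(M.surf e) :=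
  projVec_spec (fun _ hg => M.integrable_surf_of_continuous hd hΩ e hg)
    (fun _ hg => M.memLp_surf_of_continuous hd hΩ e hg) r hf

theorem proj_surf_spec (hd : 2 ≤ d) (hΩ : Bornology.IsBounded Ω) (e : κ) (r : ℕ) {f : E d → ℂ}
    (hf : MemLp f 2 (M.surf e)) :
    IsPolyOn (N := 1) r Set.univ (fun x _ => proj (M.surf e) r f x) ∧ ∀ φ : E d → ℂ,
      IsPolyOn (N := 1) r Set.univ (fun x _ => φ x) →
      ∫ x, proj (M.surf e) r f x * φ x ∂(M.surf e) = ∫ x, f x * φ x ∂(M.surf e) :=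
  proj_spec (fun _ hg => M.integrable_surf_of_continuous hd hΩ e hg)
    (fun _ hg => M.memLp_surf_of_continuous hd hΩ e hg) r hf

theorem memLp_tang {m : Measure (E d)} (n : E d) {f : E d → Fin d → ℂ} (hf : MemLp f 2 m) :
    MemLp (fun x => tang n (f x)) 2 m :=
  hf.sub (MemLp.of_eval fun j => (memLp_dotProduct_const hf (cvec n)).mul_const (cvec n j))

theorem tang_dotProduct {n : E d} (hn : ‖n‖ = 1) (a : Fin d → ℂ) : tang n a ⬝ᵥ cvec n = 0 := by
  rw [tang, sub_dotProduct, smul_dotProduct, cvec_dotProduct_cvec hn, smul_eq_mul, mul_one,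
    sub_self]

/-- The factor · × n is moved to the other side, where for constant n and polynomial ψ it yields a
polynomial field; the orthogonality of the vector projection can then be used. -/
theorem cross_dotProduct (a n : Fin d → ℂ) (ψ : Fin (curlDim d) → ℂ) :
    cross a n ⬝ᵥ ψ = a ⬝ᵥ fun j => ∑ m, (∑ l, crossCoeff d m j l * n l) * ψ m := by
  simp only [dotProduct, cross, Finset.sum_mul, Finset.mul_sum]
  rw [Finset.sum_comm]
  exact Finset.sum_congr rfl fun j _ => Finset.sum_congr rfl fun m _ =>
    Finset.sum_congr rfl fun l _ => by ring

theorem isPolyOn_Qh_face (hd : 2 ≤ d) (hΩ : Bornology.IsBounded Ω) (e : κ)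
    (ht : MemLp (M.traceVec (M.owner e) u) 2 (M.surf e)) :
    IsPolyOn k Set.univ ((M.Qh k eps u).2 e) := by
  have h1 := (M.proj_surf_spec hd hΩ e k (memLp_dotProduct_const (memLp_rmul (eps (M.owner e)) ht)
    (cvec (M.normal (M.owner e) e)))).1
  have h2 := (M.projVec_surf_spec hd hΩ e k (memLp_tang (M.normal (M.owner e) e) ht)).1
  refine IsPolyOn.add ?_ h2
  have := h1.comb (N' := d) fun j _ => cvec (M.normal (M.owner e) e) j
  convert this using 3 with x j
  simp [mul_comm]

/-- The normal part of the face value is killed by × n, as all normals of e are parallel. The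
projection of the tangential part is invisible to polynomials of degree at most k. -/
theorem integral_cross_Qh (hd : d = 2 ∨ d = 3) (hΩ : Bornology.IsBounded Ω) {i : ι} {e : κ}
    (hi : e ∈ M.faces i) (ht : MemLp (M.traceVec (M.owner e) u) 2 (M.surf e))
    {ψ : E d → Fin (curlDim d) → ℂ} (hψ : IsPolyOn k Set.univ ψ) :
    ∫ x, cross ((M.Qh k eps u).2 e x) (cvec (M.normal i e)) ⬝ᵥ ψ x ∂(M.surf e) =
      ∫ x, cross (M.traceVec (M.owner e) u x) (cvec (M.normal i e)) ⬝ᵥ ψ x ∂(M.surf e) := by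
  have hd2 : 2 ≤ d := by omega
  have hn := M.normal_eq_or_neg hd2 (M.owner_mem e) hi
  have h0 : cross (cvec (M.normal (M.owner e) e)) (cvec (M.normal i e)) = 0 := by
    rcases hn with h | h
    · rw [h, cross_self hd]
    · rw [h, cvec_neg, cross_neg_right, cross_self hd, neg_zero]
  have h1 : ∀ a, cross (tang (M.normal (M.owner e) e) a) (cvec (M.normal i e)) =
      cross a (cvec (M.normal i e)) := fun a => by
    rw [tang, cross_sub_left, cross_smul_left, h0, smul_zero, sub_zero]
  have hspec := (M.projVec_surf_spec hd2 hΩ e k (memLp_tang (M.normal (M.owner e) e) ht)).2 _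
    (hψ.comb fun j m => ∑ l, crossCoeff d m j l * cvec (M.normal i e) l)
  simp only [← cross_dotProduct, h1] at hspec
  rw [← hspec]
  simp only [Qh, cross_add_left, cross_smul_left, h0, smul_zero, zero_add]

/-- The projected tangential part need not be shown to be tangential. Paired with the polynomial
field φ n it gives the integral of the unprojected tangential part against φ n, which is zero. -/
theorem integral_normal_Qh (hd : d = 2 ∨ d = 3) (hΩ : Bornology.IsBounded Ω) {i : ι} {e : κ}
    (hi : e ∈ M.faces i) (ht : MemLp (M.traceVec (M.owner e) u) 2 (M.surf e))
    {φ : E d → ℂ} (hφ : IsPolyOn (N := 1) k Set.univ (fun x _ => φ x)) :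
    ∫ x, ((M.Qh k eps u).2 e x ⬝ᵥ cvec (M.normal i e)) * φ x ∂(M.surf e) =
      ∫ x, (rmul (eps (M.owner e)) (M.traceVec (M.owner e) u x) ⬝ᵥ cvec (M.normal i e)) * φ x
        ∂(M.surf e) := by
  have hd2 : 2 ≤ d := by omega
  have hno := M.normal_unit (M.owner e) e (M.mem_faces.1 (M.owner_mem e))
  set n := M.normal (M.owner e) e with hndef
  -- The sign s is 1 or -1, according to whether the normals of i and of the owner agree.
  obtain ⟨s, hs⟩ : ∃ s : ℂ, cvec (M.normal i e) = s • cvec n := by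
    rcases M.normal_eq_or_neg hd2 (M.owner_mem e) hi with h | h
    · exact ⟨1, by rw [h, one_smul]⟩
    · exact ⟨-1, by rw [h, cvec_neg, neg_one_smul]⟩
  have hf := memLp_dotProduct_const (memLp_rmul (eps (M.owner e)) ht) (cvec n)
  have h1 := M.proj_surf_spec hd2 hΩ e k hf
  have h2 := M.projVec_surf_spec hd2 hΩ e k (memLp_tang n ht)
  have e1 := h1.2 φ hφ
  have e2 := h2.2 _ (hφ.comb (N' := d) fun j _ => cvec n j)
  have e3 : ∀ (a : Fin d → ℂ) x, (a ⬝ᵥ fun j => ∑ _l : Fin 1, cvec n j * φ x) =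
      (a ⬝ᵥ cvec n) * φ x := fun a x => by
    simp only [dotProduct, Finset.sum_mul, Finset.univ_unique, Finset.sum_const,
      Finset.card_singleton, one_smul, mul_assoc]
  simp only [e3, tang_dotProduct hno, zero_mul, integral_zero] at e2
  have hcφ := (hφ.contDiff 0).continuous
  have i1 : Integrable (fun x => proj (M.surf e) k (fun y => rmul (eps (M.owner e))
      (M.traceVec (M.owner e) u y) ⬝ᵥ cvec n) x * φ x) (M.surf e) :=
    M.integrable_surf_of_continuous hd2 hΩ e (((h1.1).contDiff 0).continuous.mul hcφ)
  have i2 : Integrable (fun x => (projVec (M.surf e) k (fun y => tang n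
      (M.traceVec (M.owner e) u y)) x ⬝ᵥ cvec n) * φ x) (M.surf e) :=
    M.integrable_surf_of_continuous hd2 hΩ e ((continuous_finsetSum _ fun j _ =>
      (h2.1.contDiff j).continuous.mul continuous_const).mul hcφ)
  have e4 : ∀ x, ((M.Qh k eps u).2 e x ⬝ᵥ cvec (M.normal i e)) * φ x =
      s * (proj (M.surf e) k (fun y => rmul (eps (M.owner e))
        (M.traceVec (M.owner e) u y) ⬝ᵥ cvec n) x * φ x +
      (projVec (M.surf e) k (fun y => tang n (M.traceVec (M.owner e) u y)) x ⬝ᵥ cvec n) * φ x) :=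
    fun x => by
      simp only [Qh, ← hndef, hs, add_dotProduct, smul_dotProduct, dotProduct_smul, smul_eq_mul,
        cvec_dotProduct_cvec hno]
      ring
  have e5 : ∀ x, (rmul (eps (M.owner e)) (M.traceVec (M.owner e) u x) ⬝ᵥ cvec (M.normal i e)) * φ x
      = s * ((rmul (eps (M.owner e)) (M.traceVec (M.owner e) u x) ⬝ᵥ cvec n) * φ x) := fun x => by
    rw [hs, dotProduct_smul, smul_eq_mul, mul_assoc]
  simp only [e4, e5, integral_const_mul]
  rw [integral_add i1 i2, e1, e2, add_zero]

/-- A jump that vanishes expresses every one-sided value by that of the distinguished side. -/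
theorem eq_owner_of_jump {A : Type*} [AddCommGroup A] {F : E d → ι → A} (hd : 2 ≤ d) {e : κ} (hF : ∀ n i, F (-n) i = -F n i)
    (h : ∑ i ∈ M.owners e, F (M.normal i e) i = 0) {i : ι} (hi : e ∈ M.faces i) :
    F (M.normal i e) i = F (M.normal i e) (M.owner e) := by
  classical
  by_cases hio : i = M.owner e
  · rw [← hio]
  · rw [M.owners_eq_pair hd hi (M.owner_mem e) hio, Finset.sum_pair hio,
      M.normal_neg_of_ne hd hi (M.owner_mem e) hio, hF, ← sub_eq_add_neg] at h
    exact sub_eq_zero.1 h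

end Projections

end Mesh

namespace Mesh

variable {d : ℕ} {Ω : Set (E d)} {ι κ : Type*} [Fintype ι] [Fintype κ] {M : Mesh d Ω ι κ}

theorem IsWeakDiffVec.rmul (hd : d = 2 ∨ d = 3) (hΩ : Bornology.IsBounded Ω) {i : ι} {N : ℕ}
    {f t : E d → Fin N → ℂ} {G : Fin N → Fin d → E d → ℂ} (h : M.IsWeakDiffVec i f t G)
    (A : Matrix (Fin N) (Fin N) ℝ) :
    M.IsWeakDiffVec i (fun x => WG.rmul A (f x)) (fun x => WG.rmul A (t x))
      (fun j l y => ∑ q, (A j q : ℂ) * G q l y) :=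
  fun j => IsWeakDiff.sum M hd hΩ h fun q => (A j q : ℂ)

/-! ### The projection commutes with curl and divergence -/

section Commutation

variable {k : ℕ} {u : E d → Fin d → ℂ} {eps : ι → Matrix (Fin d) (Fin d) ℝ}
  {G : ι → Fin d → Fin d → E d → ℂ}

theorem hasWeakCurl_weakCurl {v : E d → Fin d → ℂ} (h : MemHcurl Ω v) :
    HasWeakCurl Ω v (weakCurl Ω v) := by
  rw [weakCurl, dif_pos h]
  exact h.choose_spec

theorem hasWeakDiv_weakDiv {w : E d → Fin d → ℂ} (h : MemHdiv Ω w) :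
    HasWeakDiv Ω w (weakDiv Ω w) := by
  rw [weakDiv, dif_pos h]
  exact h.choose_spec

theorem isWeakDiffVec_pwConst_rmul (hd : d = 2 ∨ d = 3) (hΩ : Bornology.IsBounded Ω)
    (hG : ∀ i, M.IsWeakDiffVec i u (M.traceVec i u) (G i)) (i : ι) :
    M.IsWeakDiffVec i (fun x => WG.rmul (M.pwConst eps x) (u x))
      (fun x => WG.rmul (eps i) (M.traceVec i u x))
      (fun j l y => ∑ q, (eps i j q : ℂ) * G i q l y) := fun j =>
  IsWeakDiff.congr M ((hG i).rmul hd hΩ (eps i) j) fun x hx => by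
    beta_reduce
    rw [M.pwConst_of_mem eps hx]

theorem tangential_eq_owner (hd : d = 2 ∨ d = 3) (hΩ_open : IsOpen Ω)
    (hΩ_reg : interior (closure Ω) = Ω) (hΩ : Bornology.IsBounded Ω) (hu : MemHcurl0 Ω u)
    (hG : ∀ i, M.IsWeakDiffVec i u (M.traceVec i u) (G i)) {i : ι} {e : κ} (hi : e ∈ M.faces i) :
    ∀ᵐ x ∂(M.surf e), cross (M.traceVec i u x) (cvec (M.normal i e)) =
      cross (M.traceVec (M.owner e) u x) (cvec (M.normal i e)) := by
  filter_upwards [M.tangential_jump hd hΩ_open hΩ_reg hΩ hu hG e] with x hx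
  exact eq_owner_of_jump (F := fun n i => cross (M.traceVec i u x) (cvec n)) (by omega)
    (fun n i => by rw [cvec_neg, cross_neg_right]) hx hi

/-- Across interior faces this is the vanishing normal jump of εu. On Γ the element i is itself the
owner, so no information about εu · n is required. -/
theorem normal_eq_owner (hd : d = 2 ∨ d = 3) (hΩ_open : IsOpen Ω)
    (hΩ_reg : interior (closure Ω) = Ω) (hΩ : Bornology.IsBounded Ω)
    (hu : MemHdiv Ω (fun x => rmul (M.pwConst eps x) (u x)))
    (hG : ∀ i, M.IsWeakDiffVec i u (M.traceVec i u) (G i)) {i : ι} {e : κ} (hi : e ∈ M.faces i) :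
    ∀ᵐ x ∂(M.surf e), rmul (eps i) (M.traceVec i u x) ⬝ᵥ cvec (M.normal i e) =
      rmul (eps (M.owner e)) (M.traceVec (M.owner e) u x) ⬝ᵥ cvec (M.normal i e) := by
  have hd2 : 2 ≤ d := by omega
  rcases M.face_position e with he | he
  · filter_upwards [M.normal_jump hd hΩ_open hΩ_reg hΩ (hasWeakDiv_weakDiv hu)
      (isWeakDiffVec_pwConst_rmul hd hΩ hG) he] with x hx
    exact eq_owner_of_jump (F := fun n i => rmul (eps i) (M.traceVec i u x) ⬝ᵥ cvec n) hd2
      (fun n i => by rw [cvec_neg, dotProduct_neg]) hx hi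
  · have h := M.mem_owners.2 hi
    rw [M.owners_eq_singleton hd2 hΩ_open hΩ_reg (M.owner_mem e) he, Finset.mem_singleton] at h
    exact Eventually.of_forall fun x => by rw [← h]

/-- The projection commutes with the curl. -/
theorem curlPair_Qh (hd : d = 2 ∨ d = 3) (hΩ_open : IsOpen Ω)
    (hΩ_reg : interior (closure Ω) = Ω) (hΩ : Bornology.IsBounded Ω) (hu : MemHcurl0 Ω u)
    (hG : ∀ i, M.IsWeakDiffVec i u (M.traceVec i u) (G i)) (i : ι)
    {ψ : E d → Fin (curlDim d) → ℂ} (hψ : IsPolyOn k Set.univ ψ) :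
    M.curlPair i ((M.Qh k eps u).1 i) (M.Qh k eps u).2 ψ =
      ∫ x, weakCurl Ω u x ⬝ᵥ ψ x ∂(M.vol i) := by
  have h1 : ∫ x, weakCurl Ω u x ⬝ᵥ ψ x ∂(M.vol i) = ∫ x, curlOf (G i) x ⬝ᵥ ψ x ∂(M.vol i) := by
    refine integral_congr_ae ?_
    filter_upwards [M.weakCurl_eq_on_elem hd hΩ_reg hΩ (hasWeakCurl_weakCurl hu.1) (hG i)] with x hx
    rw [hx]
  rw [h1, M.integral_curlOf hd hΩ (hG i) hψ.contDiff, curlPair, curlPair]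
  congr 1
  -- The curl of ψ has degree at most k - 1, so Q₀ can be dropped.
  · exact (M.projVec_vol_spec hΩ i k ((hG i).memLp M)).2 _ (hψ.testCurl.mono_deg (Nat.sub_le k 1))
  · refine Finset.sum_congr rfl fun e he => ?_
    rw [integral_cross_Qh hd hΩ he ((hG _).memLp_trace M (M.owner_mem e)) hψ]
    refine integral_congr_ae ?_
    filter_upwards [tangential_eq_owner hd hΩ_open hΩ_reg hΩ hu hG he] with x hx
    rw [hx]

/-- The projection commutes with the divergence. -/
theorem divPair_Qh (hd : d = 2 ∨ d = 3) (hΩ_open : IsOpen Ω)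
    (hΩ_reg : interior (closure Ω) = Ω) (hΩ : Bornology.IsBounded Ω)
    (heps : ∀ i, (eps i).PosDef) (hu : MemHdiv Ω (fun x => rmul (M.pwConst eps x) (u x)))
    (hG : ∀ i, M.IsWeakDiffVec i u (M.traceVec i u) (G i)) (i : ι)
    {φ : E d → ℂ} (hφ : IsPolyOn (N := 1) k Set.univ (fun x _ => φ x)) :
    M.divPair i (fun x => rmul (eps i) ((M.Qh k eps u).1 i x)) (M.Qh k eps u).2 φ =
      ∫ x, weakDiv Ω (fun y => rmul (M.pwConst eps y) (u y)) x * φ x ∂(M.vol i) := by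
  have hw := isWeakDiffVec_pwConst_rmul (eps := eps) hd hΩ hG i
  have h1 : ∫ x, weakDiv Ω (fun y => rmul (M.pwConst eps y) (u y)) x * φ x ∂(M.vol i) =
      ∫ x, (∑ j, ∑ q, (eps i j q : ℂ) * G i q j x) * φ x ∂(M.vol i) := by
    refine integral_congr_ae ?_
    filter_upwards [M.weakDiv_eq_on_elem hd hΩ_reg hΩ (hasWeakDiv_weakDiv hu) hw] with x hx
    rw [hx]
  rw [h1, M.integral_divOf hd hΩ hw (hφ.contDiff 0), divPair, divPair]
  congr 1
  -- The constant symmetric matrix ε passes to ∇φ, which stays a polynomial of degree at most k, so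
  -- Q₀ can be dropped.
  · have e1 := (M.projVec_vol_spec hΩ i k ((hG i).memLp M)).2 _
      (((hφ.grad).mono_deg (Nat.sub_le k 1)).rmul (eps i))
    simp only [← rmul_dotProduct (heps i).1] at e1
    rw [neg_inj]
    refine e1.trans (integral_congr_ae ?_)
    filter_upwards [M.ae_mem_elem i] with x hx
    rw [M.pwConst_of_mem eps hx]
    rfl
  · refine Finset.sum_congr rfl fun e he => ?_
    rw [integral_normal_Qh hd hΩ he ((hG _).memLp_trace M (M.owner_mem e)) hφ]
    refine integral_congr_ae ?_
    filter_upwards [normal_eq_owner hd hΩ_open hΩ_reg hΩ hu hG he] with x hx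
    rw [hx]

theorem eq_zero_on_face (hd : 2 ≤ d) (hΩ : Bornology.IsBounded Ω) {e : κ} {f : E d → ℂ}
    (hf : Continuous f) (h : ∀ᵐ x ∂(M.surf e), f x = 0) : ∀ x ∈ M.face e, f x = 0 := by
  intro x hx
  by_contra h0
  obtain ⟨r, hr, hball⟩ := Metric.isOpen_iff.1 (isOpen_ne_fun hf continuous_const) x h0
  have hpos := M.surf_ball_pos hd hx hr
  have : M.surf e (Metric.ball x r) = 0 :=
    measure_mono_null (fun y hy => hball hy) (ae_iff.1 h)
  exact hpos.ne' this

theorem Qh_mem_Vh (hd : 2 ≤ d) (hΩ : Bornology.IsBounded Ω)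
    (hG : ∀ i, M.IsWeakDiffVec i u (M.traceVec i u) (G i)) : M.Qh k eps u ∈ M.Vh k :=
  ⟨fun i => (M.projVec_vol_spec hΩ i k ((hG i).memLp M)).1, fun e =>
    (isPolyOn_Qh_face hd hΩ e ((hG _).memLp_trace M (M.owner_mem e))).mono_set (Set.subset_univ _)⟩

/-- On Γ the tangential trace of u vanishes almost everywhere, so the polynomial (Q_h u) × n is
orthogonal to all polynomials of degree at most k on the face. It is then zero almost everywhere
and, by continuity, at every point of the face. -/
theorem Qh_mem_Vh01 (hd : d = 2 ∨ d = 3) (hΩ_open : IsOpen Ω)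
    (hΩ_reg : interior (closure Ω) = Ω) (hΩ : Bornology.IsBounded Ω) (hu : MemHcurl0 Ω u)
    (hG : ∀ i, M.IsWeakDiffVec i u (M.traceVec i u) (G i)) : M.Qh k eps u ∈ M.Vh01 k := by
  have hd2 : 2 ≤ d := by omega
  refine ⟨Qh_mem_Vh hd2 hΩ hG, fun e he i hi => ?_⟩
  have ht := (hG _).memLp_trace M (M.owner_mem e)
  have hpoly : IsPolyOn k Set.univ
      (fun x => cross ((M.Qh k eps u).2 e x) (cvec (M.normal i e))) := by
    have := (isPolyOn_Qh_face (k := k) (eps := eps) hd2 hΩ e ht).comb fun m j =>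
      ∑ l, crossCoeff d m j l * cvec (M.normal i e) l
    convert this using 3 with x m
    simp only [cross, Finset.sum_mul]
    exact Finset.sum_congr rfl fun _ _ => Finset.sum_congr rfl fun _ _ => by ring
  have hjump := M.tangential_jump hd hΩ_open hΩ_reg hΩ hu hG e
  have hio := M.mem_owners.2 hi
  rw [M.owners_eq_singleton hd2 hΩ_open hΩ_reg (M.owner_mem e) he] at hjump hio
  rw [Finset.mem_singleton] at hio
  simp only [Finset.sum_singleton] at hjump
  have hzero : ∀ ψ, IsPolyOn k Set.univ ψ →
      ∫ x, cross ((M.Qh k eps u).2 e x) (cvec (M.normal i e)) ⬝ᵥ ψ x ∂(M.surf e) = 0 := by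
    intro ψ hψ
    rw [integral_cross_Qh hd hΩ hi ht hψ]
    refine integral_eq_zero_of_ae ?_
    filter_upwards [hjump] with x hx
    rw [hio, hx, zero_dotProduct]
    rfl
  obtain ⟨P, hP, hPe⟩ := isPolyOn_univ_iff.1 hpoly
  have hae := ae_eq_zero_of_integral_ev_mul_eq_zero (m := M.surf e)
    (fun f hf => M.integrable_surf_of_continuous hd2 hΩ e hf) hP fun φ hφ => by
      rw [← hzero _ (isPolyOn_univ_iff.2 ⟨φ, hφ, rfl⟩)]
      refine integral_congr_ae (Eventually.of_forall fun x => ?_)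
      beta_reduce
      rw [congrFun hPe x]
      rfl
  intro x hx
  rw [congrFun hPe x]
  ext m
  exact eq_zero_on_face hd2 hΩ (continuous_ev (P m))
    (by filter_upwards [hae] with y hy using hy m) x hx

end Commutation

/-! ### Consistency of the scheme -/

section Consistency

variable {k : ℕ} {ω : ℝ} {mu : ι → Matrix (Fin (curlDim d)) (Fin (curlDim d)) ℝ}
  {eps : ι → Matrix (Fin d) (Fin d) ℝ} {σ : ι → ℝ} {je : E d → Fin d → ℂ} {ρ : E d → ℂ}
  {u : E d → Fin d → ℂ} {p : E d → ℂ} {G : ι → Fin d → Fin d → E d → ℂ}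
  {Gc : ι → Fin (curlDim d) → Fin d → E d → ℂ} {Gp : ι → Fin d → E d → ℂ}
  {v : WeakField d ι κ}

/-- Let c_h be the projection of c = μ⁻¹ ∇ × u. By commutation and symmetry the left side is the
pairing of {v₀, v_b} with c_h. Replacing v_b by v₀ on the boundary costs a jump term with c_h and
leaves (∇ × v₀, c_h), which equals (∇ × v₀, c) because ∇ × v₀ has degree at most k - 1. Integration
by parts onto c and the splitting v₀ = (v₀ - v_b) + v_b in the boundary term give the right side. -/
theorem integral_wcurl_Qh (hd : d = 2 ∨ d = 3) (hΩ_open : IsOpen Ω)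
    (hΩ_reg : interior (closure Ω) = Ω) (hΩ : Bornology.IsBounded Ω)
    (hmu : ∀ i, (mu i).PosDef) (hu : MemHcurl0 Ω u)
    (hG : ∀ i, M.IsWeakDiffVec i u (M.traceVec i u) (G i)) (hv : v ∈ M.Vh k) (i : ι)
    {tc : E d → Fin (curlDim d) → ℂ} {Gc : Fin (curlDim d) → Fin d → E d → ℂ}
    (hc : M.IsWeakDiffVec i (fun x => rmul (mu i)⁻¹ (weakCurl Ω u x)) tc Gc) :
    ∫ x, rmul (mu i)⁻¹ (M.wcurl (k - 1) (M.Qh k eps u) i x) ⬝ᵥ M.wcurl (k - 1) v i x ∂(M.vol i) =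
      ∫ x, adjCurlOf Gc x ⬝ᵥ v.1 i x ∂(M.vol i) +
      M.bdInt i (fun e x => (projVec (M.vol i) (k - 1) (fun y => rmul (mu i)⁻¹ (weakCurl Ω u y)) x
        - tc x) ⬝ᵥ cross (v.1 i x - v.2 e x) (cvec (M.normal i e))) -
      M.bdInt i (fun e x => tc x ⬝ᵥ cross (v.2 e x) (cvec (M.normal i e))) := by
  have hd2 : 2 ≤ d := by omega
  have hvL := memL2_of_mem_Vh hd2 hΩ hv
  have hQL := memL2_of_mem_Vh hd2 hΩ (Qh_mem_Vh (k := k) (eps := eps) hd2 hΩ hG)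
  have hwv := hvL.wcurl_spec hd2 hΩ (k - 1) i
  have hproj := M.projVec_vol_spec hΩ i (k - 1) (hc.memLp M)
  set c := projVec (M.vol i) (k - 1) (fun y => rmul (mu i)⁻¹ (weakCurl Ω u y)) with hcdef
  have hv0 := hv.1 i
  have hv0s : ∀ e, MemLp (v.1 i) 2 (M.surf e) := fun e =>
    IsPolyOn.memLp_surf M hd2 hΩ (hv0.mono_set (Set.subset_univ _))
  have hcs : ∀ e, MemLp c 2 (M.surf e) := fun e =>
    IsPolyOn.memLp_surf M hd2 hΩ (hproj.1.mono_set (Set.subset_univ _))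
  have hvi := M.isWeakDiffVec_pw (V := fun _ => v.1 i) hd hΩ (fun _ j => hv0.contDiff j) i
  rw [hQL.integral_wcurl hd2 hΩ hmu hvL, curlPair_Qh hd hΩ_open hΩ_reg hΩ hu hG i
    ((hwv.1.rmul _).mono_deg (Nat.sub_le k 1))]
  simp only [← rmul_dotProduct (hmu i).1.inv]
  rw [← hproj.2 _ hwv.1]
  simp only [dotProduct_comm (c _)]
  rw [hwv.2 _ hproj.1]
  have e1 := M.integral_curlOf hd hΩ hvi hproj.1.contDiff
  have e2 := hproj.2 _ hv0.curlOf
  have e3 := M.integral_dotProduct_curl hd hΩ hc hv0.contDiff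
  simp only [dotProduct_comm (curlOf _ _)] at e1
  rw [e2, e3] at e1
  have e4 : M.curlPair i (v.1 i) v.2 c = M.curlPair i (v.1 i) (fun _ => v.1 i) c +
      M.bdInt i (fun e x => c x ⬝ᵥ cross (v.1 i x - v.2 e x) (cvec (M.normal i e))) := by
    have hi : ∀ {β : κ → E d → Fin d → ℂ}, (∀ e, MemLp (β e) 2 (M.surf e)) → ∀ e ∈ M.faces i,
        Integrable (fun x => cross (β e x) (cvec (M.normal i e)) ⬝ᵥ c x) (M.surf e) := fun hβ e _ =>
      integrable_dotProduct (memLp_cross (hβ e) _) (hcs e)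
    simp only [curlPair, cross_sub_left, dotProduct_comm (c _), sub_dotProduct]
    rw [M.bdInt_sub (hi hv0s) (hi hvL.2)]
    ring
  rw [e4, ← e1]
  have hti : ∀ {τ : E d → Fin (curlDim d) → ℂ} {β : κ → E d → Fin d → ℂ},
      (∀ e ∈ M.faces i, MemLp τ 2 (M.surf e)) → (∀ e, MemLp (β e) 2 (M.surf e)) →
      ∀ e ∈ M.faces i, Integrable (fun x => τ x ⬝ᵥ cross (β e x) (cvec (M.normal i e)))
        (M.surf e) := fun hτ hβ e he => integrable_dotProduct (hτ e he) (memLp_cross (hβ e) _)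
  have htc := fun e (he : e ∈ M.faces i) => hc.memLp_trace M he
  have hj : ∀ e, MemLp (fun x => v.1 i x - v.2 e x) 2 (M.surf e) := memLp_jump hd2 hΩ hv i
  simp only [sub_dotProduct]
  rw [M.bdInt_sub (hti (fun e _ => hcs e) hj) (hti htc hj)]
  have e5 : M.bdInt i (fun e x => tc x ⬝ᵥ cross (v.1 i x) (cvec (M.normal i e))) =
      M.bdInt i (fun e x => tc x ⬝ᵥ cross (v.1 i x - v.2 e x) (cvec (M.normal i e))) +
      M.bdInt i (fun e x => tc x ⬝ᵥ cross (v.2 e x) (cvec (M.normal i e))) := by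
    rw [← M.bdInt_add (hti htc hj) (hti htc hvL.2)]
    simp only [← dotProduct_add, ← cross_add_left, sub_add_cancel]
  rw [e5]
  ring

/-- The coefficient is constant and symmetric on the element, so it acts on v₀, which remains of
degree at most k. -/
theorem integral_lowCoeff_Qh (hΩ : Bornology.IsBounded Ω) (heps : ∀ i, (eps i).PosDef)
    (hG : ∀ i, M.IsWeakDiffVec i u (M.traceVec i u) (G i)) (hv : v ∈ M.Vh k) (i : ι) :
    ∫ x, lowCoeff ω (σ i) (eps i) ((M.Qh k eps u).1 i x) ⬝ᵥ v.1 i x ∂(M.vol i) =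
      ∫ x, lowCoeff ω (σ i) (eps i) (u x) ⬝ᵥ v.1 i x ∂(M.vol i) := by
  have hsymm : ∀ a b, lowCoeff ω (σ i) (eps i) a ⬝ᵥ b = a ⬝ᵥ lowCoeff ω (σ i) (eps i) b :=
    fun a b => by
      simp only [lowCoeff, sub_dotProduct, dotProduct_sub, smul_dotProduct, dotProduct_smul,
        rmul_dotProduct (heps i).1]
  simp only [hsymm]
  exact (M.projVec_vol_spec hΩ i k ((hG i).memLp M)).2 _ ((hv.1 i).lowCoeff _ _ _)

/-- The argument of `integral_wcurl_Qh` for the divergence: ∇ · (εv₀) has degree at most k - 1 and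
does not distinguish p from its projection, so only the boundary jump term does. -/
theorem divPair_calQh (hd : d = 2 ∨ d = 3) (hΩ : Bornology.IsBounded Ω)
    (heps : ∀ i, (eps i).PosDef) (hv : v ∈ M.Vh k) (i : ι) {tp : E d → ℂ} {Gp : Fin d → E d → ℂ}
    (hp : M.IsWeakDiff i p tp Gp) :
    M.divPair i (fun x => rmul (eps i) (v.1 i x)) v.2 (M.calQh k p i) =
      -(∫ x, rmul (eps i) (fun j => Gp j x) ⬝ᵥ v.1 i x ∂(M.vol i)) +
      M.bdInt i (fun e x => (tp x - M.calQh k p i x) *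
        ((rmul (eps i) (v.1 i x) - v.2 e x) ⬝ᵥ cvec (M.normal i e))) +
      M.bdInt i (fun e x => tp x * (v.2 e x ⬝ᵥ cvec (M.normal i e))) := by
  have hd2 : 2 ≤ d := by omega
  have hvL := memL2_of_mem_Vh hd2 hΩ hv
  have hproj := M.proj_vol_spec hΩ i (k - 1) hp.memLp
  have hq : M.calQh k p i = proj (M.vol i) (k - 1) p := rfl
  rw [← hq] at hproj
  set q := M.calQh k p i
  have hw := (hv.1 i).rmul (eps i)
  have hwi := M.isWeakDiffVec_pw (V := fun _ x => rmul (eps i) (v.1 i x)) hd hΩ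
    (fun _ j => hw.contDiff j) i
  have hws : ∀ e, MemLp (fun x => rmul (eps i) (v.1 i x)) 2 (M.surf e) := fun e =>
    IsPolyOn.memLp_surf M hd2 hΩ (hw.mono_set (Set.subset_univ _))
  have hqs : ∀ e, MemLp q 2 (M.surf e) := fun e =>
    M.memLp_surf_of_continuous hd2 hΩ e (hproj.1.contDiff 0).continuous
  have e1 := M.integral_divOf hd hΩ hwi (hproj.1.contDiff 0)
  have e2 := hproj.2 _ hw.divergence
  have e3 := IsWeakDiff.integral_mul_div M hd hΩ hp (a := fun x => rmul (eps i) (v.1 i x))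
    hw.contDiff
  simp only [mul_comm (∑ j, pd j _ _)] at e1 e3
  rw [e2, e3] at e1
  have hti : ∀ {τ : E d → ℂ} {β : κ → E d → Fin d → ℂ},
      (∀ e ∈ M.faces i, MemLp τ 2 (M.surf e)) → (∀ e, MemLp (β e) 2 (M.surf e)) →
      ∀ e ∈ M.faces i, Integrable (fun x => τ x * (β e x ⬝ᵥ cvec (M.normal i e)))
        (M.surf e) := fun hτ hβ e he =>
    integrable_mul_of_memLp (hτ e he) (memLp_dotProduct_const (hβ e) _)
  have htp := hp.memLp_trace
  have hj : ∀ e, MemLp (fun x => rmul (eps i) (v.1 i x) - v.2 e x) 2 (M.surf e) :=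
    fun e => (hws e).sub (hvL.2 e)
  have e4 : M.divPair i (fun x => rmul (eps i) (v.1 i x)) v.2 q =
      M.divPair i (fun x => rmul (eps i) (v.1 i x)) (fun _ x => rmul (eps i) (v.1 i x)) q -
      M.bdInt i (fun e x => q x * ((rmul (eps i) (v.1 i x) - v.2 e x) ⬝ᵥ cvec (M.normal i e))) := by
    simp only [divPair, mul_comm _ (q _), sub_dotProduct, mul_sub]
    rw [M.bdInt_sub (hti (fun e _ => hqs e) hws) (hti (fun e _ => hqs e) hvL.2)]
    ring
  have e5 : M.bdInt i (fun e x => tp x * (rmul (eps i) (v.1 i x) ⬝ᵥ cvec (M.normal i e))) =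
      M.bdInt i (fun e x => tp x *
        ((rmul (eps i) (v.1 i x) - v.2 e x) ⬝ᵥ cvec (M.normal i e))) +
      M.bdInt i (fun e x => tp x * (v.2 e x ⬝ᵥ cvec (M.normal i e))) := by
    rw [← M.bdInt_add (hti htp hj) (hti htp hvL.2)]
    simp only [← mul_add, ← add_dotProduct, sub_add_cancel]
  rw [e4, ← e1, e5]
  simp only [sub_mul]
  rw [M.bdInt_sub (hti htp hj) (hti (fun e _ => hqs e) hj)]
  simp only [rmul_dotProduct (heps i).1]
  ring

theorem calQh_mem_Wh1 (hΩ : Bornology.IsBounded Ω) (hp : ∀ i, MemLp p 2 (M.vol i)) :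
    M.calQh k p ∈ M.Wh1 k := fun i => (M.proj_vol_spec hΩ i (k - 1) (hp i)).1

/-- The piecewise polynomial q, glued together by `pw`, is an admissible L² test function in the
second continuous equation; commutation with the divergence does the rest. -/
theorem b1_Qh (hd : d = 2 ∨ d = 3) (hΩ_open : IsOpen Ω)
    (hΩ_reg : interior (closure Ω) = Ω) (hΩ : Bornology.IsBounded Ω)
    (heps : ∀ i, (eps i).PosDef) (hρ : MemLp ρ 2 (volume.restrict Ω))
    (hup : M.SolvesElectric ω mu eps σ je ρ u p)
    (hG : ∀ i, M.IsWeakDiffVec i u (M.traceVec i u) (G i)) {q : ι → E d → ℂ} (hq : q ∈ M.Wh1 k) :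
    M.b1 k eps (M.Qh k eps u) q = ∑ i, ∫ x, ρ x * q i x ∂(M.vol i) := by
  have hd2 : 2 ≤ d := by omega
  have hqi : ∀ i, MemLp (q i) 2 (M.vol i) := fun i =>
    M.memLp_vol_of_continuous hΩ i ((hq i).contDiff 0).continuous
  have hdiv := M.memLp_elem hΩ_reg (hasWeakDiv_weakDiv hup.2.1).2.1
  have hpw : ∀ i, q i =ᵐ[M.vol i] M.pw q := fun i => by
    filter_upwards [M.ae_mem_elem i] with x hx using (M.pw_of_mem q hx).symm
  have main := hup.2.2.2.2 (M.pw q) (M.memLp_pw hd2 hΩ_reg hqi)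
  rw [M.integral_eq_sum hd2 hΩ_reg fun i => integrable_mul_of_memLp (hdiv i)
      ((hqi i).ae_eq (hpw i)), M.integral_eq_sum hd2 hΩ_reg fun i => integrable_mul_of_memLp
      (M.memLp_elem hΩ_reg hρ i) ((hqi i).ae_eq (hpw i))] at main
  rw [b1_eq hd2 hΩ (Qh_mem_Vh hd2 hΩ hG) hq]
  refine (Finset.sum_congr rfl fun i _ => ?_).trans
    (main.trans (Finset.sum_congr rfl fun i _ => ?_))
  · rw [divPair_Qh hd hΩ_open hΩ_reg hΩ heps hup.2.1 hG i ((hq i).mono_deg (Nat.sub_le k 1))]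
    refine integral_congr_ae ?_
    filter_upwards [hpw i] with x hx
    rw [hx]
  · refine integral_congr_ae ?_
    filter_upwards [hpw i] with x hx
    rw [hx]

/-- The projections of the exact solution satisfy the scheme up to the consistency errors. -/
theorem a1_Qh_sub_b1_calQh (hd : d = 2 ∨ d = 3) (hΩ_open : IsOpen Ω)
    (hΩ_reg : interior (closure Ω) = Ω) (hΩ : Bornology.IsBounded Ω)
    (hmu : ∀ i, (mu i).PosDef) (heps : ∀ i, (eps i).PosDef)
    (hje : MemLp je 2 (volume.restrict Ω)) (hup : M.SolvesElectric ω mu eps σ je ρ u p)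
    (hG : ∀ i, M.IsWeakDiffVec i u (M.traceVec i u) (G i))
    (hc : ∀ i, M.IsWeakDiffVec i (fun x => rmul (mu i)⁻¹ (weakCurl Ω u x))
      (fun x => rmul (mu i)⁻¹ (M.traceVec i (weakCurl Ω u) x)) (Gc i))
    (hp : ∀ i, M.IsWeakDiff i p (M.trace i p) (Gp i)) (hv : v ∈ M.Vh01 k) :
    M.a1 k ω mu eps σ (M.Qh k eps u) v - M.b1 k eps v (M.calQh k p) =
      -(∑ i, ∫ x, ((Complex.I * ω) • je x) ⬝ᵥ v.1 i x ∂(M.vol i)) +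
      (M.lFun k mu u v - M.thetaFun k eps p v + M.s1 eps (M.Qh k eps u) v) := by
  have hd2 : 2 ≤ d := by omega
  have hvL := memL2_of_mem_Vh hd2 hΩ hv.1
  -- The field v_b is single valued on each face and satisfies v_b × n = 0 on Γ, as the flux
  -- relation demands.
  have hflux := hup.sum_bdInt_flux hd hΩ_open hΩ_reg hΩ heps hje hc hp hvL.2 hv.2
  have hflux' : ∀ i, M.bdInt i (fun e x =>
        rmul (mu i)⁻¹ (M.traceVec i (weakCurl Ω u) x) ⬝ᵥ
          cross (v.2 e x) (cvec (M.normal i e)) +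
        M.trace i p x * (v.2 e x ⬝ᵥ cvec (M.normal i e))) =
      M.bdInt i (fun e x => rmul (mu i)⁻¹ (M.traceVec i (weakCurl Ω u) x) ⬝ᵥ
          cross (v.2 e x) (cvec (M.normal i e))) +
      M.bdInt i (fun e x => M.trace i p x * (v.2 e x ⬝ᵥ cvec (M.normal i e))) := fun i =>
    M.bdInt_add
      (fun e he => integrable_dotProduct ((hc i).memLp_trace M he) (memLp_cross (hvL.2 e) _))
      (fun e he => integrable_mul_of_memLp ((hp i).memLp_trace e he)
        (memLp_dotProduct_const (hvL.2 e) _))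
  have hui := M.memLp_elem hΩ_reg (hasWeakCurl_weakCurl hup.1.1).1
  have hjei := M.memLp_elem hΩ_reg hje
  -- The strong equation on the element, tested with v₀.
  have hres : ∀ i, ∫ x, adjCurlOf (Gc i) x ⬝ᵥ v.1 i x ∂(M.vol i) +
      ∫ x, lowCoeff ω (σ i) (eps i) (u x) ⬝ᵥ v.1 i x ∂(M.vol i) +
      ∫ x, rmul (eps i) (fun j => Gp i j x) ⬝ᵥ v.1 i x ∂(M.vol i) =
      -∫ x, ((Complex.I * ω) • je x) ⬝ᵥ v.1 i x ∂(M.vol i) := fun i => by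
    have c1 := integrable_dotProduct ((hc i).memLp_adjCurlOf M) (hvL.1 i)
    have c2 := integrable_dotProduct (memLp_lowCoeff ω (σ i) (eps i) (hui i)) (hvL.1 i)
    have c3 := integrable_dotProduct (memLp_rmul (eps i) (MemLp.of_eval (hp i).memLp_grad))
      (hvL.1 i)
    have c12 := c1.add c2
    rw [← integral_add c1 c2]
    erw [← integral_add c12 c3]
    rw [← integral_neg]
    refine integral_congr_ae ?_
    filter_upwards [hup.residual_eq_zero hd hΩ_open hΩ_reg hΩ heps hje hc hp i] with x hx
    rw [residual] at hx
    simp only [Pi.add_apply, ← add_dotProduct, ← neg_dotProduct]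
    rw [eq_neg_of_add_eq_zero_left hx]
  rw [a1, b1_eq hd2 hΩ hv.1 (calQh_mem_Wh1 hΩ fun i => (hp i).memLp)]
  simp only [fun i => integral_wcurl_Qh (eps := eps) hd hΩ_open hΩ_reg hΩ hmu hup.1 hG hv.1 i (hc i),
    integral_lowCoeff_Qh hΩ heps hG hv.1, fun i => divPair_calQh hd hΩ heps hv.1 i (hp i)]
  simp only [hflux'] at hflux
  rw [← Finset.sum_neg_distrib, lFun, thetaFun]
  simp only [← hres]
  simp only [Finset.sum_add_distrib, Finset.sum_sub_distrib, Finset.sum_neg_distrib] at hflux ⊢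
  -- After the strong equation has been inserted, the two sides differ exactly by the sum of the v_b
  -- fluxes.
  linear_combination -hflux

end Consistency

end Mesh

end WG

/-! ### The error equation -/

theorem mainTheorem6 {d : ℕ} (hd : d = 2 ∨ d = 3)
    {Ω : Set (WG.E d)} (hΩ_open : IsOpen Ω) (hΩ_bdd : Bornology.IsBounded Ω)
    (hΩ_reg : interior (closure Ω) = Ω)
    {ι κ : Type*} [Fintype ι] [Fintype κ] (M : WG.Mesh d Ω ι κ)
    (k : ℕ) (hk : 1 ≤ k) (ω : ℝ)
    (mu : ι → Matrix (Fin (WG.curlDim d)) (Fin (WG.curlDim d)) ℝ) (hmu : ∀ i, (mu i).PosDef)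
    (eps : ι → Matrix (Fin d) (Fin d) ℝ) (heps : ∀ i, (eps i).PosDef)
    (σ : ι → ℝ)
    (je : WG.E d → Fin d → ℂ) (hje : MemLp je 2 (volume.restrict Ω))
    (ρ : WG.E d → ℂ) (hρ : MemLp ρ 2 (volume.restrict Ω))
    (u : WG.E d → Fin d → ℂ) (p : WG.E d → ℂ)
    (hup : M.SolvesElectric ω mu eps σ je ρ u p)
    (hu : ∀ i j, M.MemH1 i (fun x => u x j))
    (hcurl : ∀ i m, M.MemH1 i (fun x => WG.weakCurl Ω u x m))
    (hp : ∀ i, M.MemH1 i p)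
    (uh : WG.WeakField d ι κ) (ph : ι → WG.E d → ℂ)
    (huh : M.SolvesScheme k ω mu eps σ je ρ uh ph) :
    M.Qh k eps u - uh ∈ M.Vh01 k ∧
    M.calQh k p - ph ∈ M.Wh1 k ∧
    (∀ v ∈ M.Vh01 k,
      M.a1 k ω mu eps σ (M.Qh k eps u - uh) v - M.b1 k eps v (M.calQh k p - ph)
        = M.lFun k mu u v - M.thetaFun k eps p v + M.s1 eps (M.Qh k eps u) v) ∧
    (∀ q ∈ M.Wh1 k, M.b1 k eps (M.Qh k eps u - uh) q = 0) := by
  classical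
  have hd2 : 2 ≤ d := by omega
  -- The traces come from the definition of `trace`, so they are the ones in `Qh`, `lFun` and
  -- `thetaFun`; only the weak gradients are chosen here.
  choose G hG using fun i j => WG.Mesh.MemH1.isWeakDiff M hd hΩ_bdd (hu i j)
  choose Gc hGc using fun i m => WG.Mesh.MemH1.isWeakDiff M hd hΩ_bdd (hcurl i m)
  choose Gp hGp using fun i => WG.Mesh.MemH1.isWeakDiff M hd hΩ_bdd (hp i)
  have hG' : ∀ i, M.IsWeakDiffVec i u (M.traceVec i u) (G i) := hG
  have hc' : ∀ i, M.IsWeakDiffVec i (WG.weakCurl Ω u) (M.traceVec i (WG.weakCurl Ω u)) (Gc i) := hGc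
  have hc := fun i => (hc' i).rmul hd hΩ_bdd (mu i)⁻¹
  have hQ := WG.Mesh.Qh_mem_Vh01 (k := k) (eps := eps) hd hΩ_open hΩ_reg hΩ_bdd hup.1 hG'
  have hq := WG.Mesh.calQh_mem_Wh1 (k := k) hΩ_bdd fun i => (hGp i).memLp
  refine ⟨WG.Mesh.sub_mem_Vh01 hQ huh.1, WG.Mesh.sub_mem_Wh1 hq huh.2.1, fun v hv => ?_,
    fun q hq => ?_⟩
  · rw [WG.Mesh.a1_sub_left hd2 hΩ_bdd hmu hQ.1 huh.1.1 hv.1,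
      WG.Mesh.b1_sub_right hd2 hΩ_bdd hv.1 hq huh.2.1]
    have h1 := WG.Mesh.a1_Qh_sub_b1_calQh hd hΩ_open hΩ_reg hΩ_bdd hmu heps hje hup hG' hc hGp hv
    have h2 := huh.2.2.1 v hv
    linear_combination h1 - h2
  · rw [WG.Mesh.b1_sub_left hd2 hΩ_bdd hQ.1 huh.1.1 hq,
      WG.Mesh.b1_Qh hd hΩ_open hΩ_reg hΩ_bdd heps hρ hup hG' hq, huh.2.2.2 q hq, sub_self]
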